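/- All vector spaces are over $\mathbb{C}$. A Lie conformal superalgebra is a $\mathbb{Z}/2$-graded $\mathbb{C}[\partial]$-module $R$ with a $\mathbb{C}$-bilinear, parity-preserving $\lambda$-bracket $[a_\lambda b]\in R[\lambda]$ such that $[\partial a_\lambda b]=-\lambda[a_\lambda b]$, $[a_\lambda\partial b]=(\partial+\lambda)[a_\lambda b]$, $[b_\lambda a]=-(-1)^{p(a)p(b)}[a_{-\lambda-\partial}b]$ and $[a_\lambda[b_\mu c]]=[[a_\lambda b]_{\lambda+\mu}c]+(-1)^{p(a)p(b)}[b_\mu[a_\lambda c]]$ for homogeneous $a,b$. Let $\Lambda(N)$ be the Grassmann algebra in odd $\xi_1,\dots,\xi_N$, let $\partial_i=\partial/\partial\xi_i$, and let $W(N)=\{\sum_i P_i\partial_i : P_i\in\Lambda(N)\}$ be its Lie superalgebra of derivations. The Lie conformal superalgebra $W_N=\mathbb{C}[\partial]\otimes(W(N)\oplus\Lambda(N))$ has the $\lambda$-bracket determined, for homogeneous $a,b\in W(N)$ and $f,g\in\Lambda(N)$, by $$[a_\lambda b]=[a,b],\qquad [a_\lambda f]=a(f)-\lambda(-1)^{p(a)p(f)}fa,\qquad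 [f_\lambda g]=-\partial(fg)-2\lambda fg .$$ For $D=\sum_i P_i(\partial,\xi)\partial_i+f(\partial,\xi)\in W_N$ and $a\in\mathbb{C}$ put $$\mathrm{div}\,D=\sum_i(-1)^{p(P_i)}\partial_iP_i-\partial f,\qquad \mathrm{div}_a D=\mathrm{div}\,D+af .$$ Let $S_{N,a}=\{D\in W_N : \mathrm{div}_aD=0\}$ and, for $N$ even, $\widetilde S_N=\{D\in W_N : \mathrm{div}((1+\xi_1\cdots\xi_N)D)=0\}$; these are subalgebras of $W_N$. A central extension of $R$ by a Lie conformal superalgebra $K$ is a short exact sequence $0\to K\to S\to R\to 0$ of Lie conformal superalgebras, split as a sequence of $\mathbb{Z}/2$-graded $\mathbb{C}[\partial]$-modules, with $K$ central in $S$ and $\partial$ acting as $0$ on $K$. It is trivial if there is a homomorphism of Lie conformal superalgebras $R\to S$ that is a section of $S\to R$. Let $\widetilde C^n(R)$ be the space of $\mathbb{C}$-multilinear maps $\gamma_{\lambda_1,\dots,\lambda_n}(a_1,\dots,a_n)\in\mathbb{C}[\lambda_1,\dots,\lambda_n]$ that are skew-symmetric in the super sense under simultaneous permutation of the $a_i$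 and the $\lambda_i$, and for which replacing $a_i$ by $\partial a_i$ multiplies the value by $-\lambda_i$. On it $\partial$ acts as multiplication by $\lambda_1+\dots+\lambda_n$, and it carries the basic differential of the complex with trivial coefficients, in low degrees $(d\phi)_{\lambda_1,\lambda_2}(a,b)=-\phi_{\lambda_1+\lambda_2}([a_{\lambda_1}b])$ and, for homogeneous $a,b,c$, $$(d\gamma)_{\lambda_1,\lambda_2,\lambda_3}(a,b,c)=-\gamma_{\lambda_1+\lambda_2,\lambda_3}([a_{\lambda_1}b],c)+(-1)^{p(b)p(c)}\gamma_{\lambda_1+\lambda_3,\lambda_2}([a_{\lambda_1}c],b)-(-1)^{p(a)(p(b)+p(c))}\gamma_{\lambda_2+\lambda_3,\lambda_1}([b_{\lambda_2}c],a).$$ The reduced cohomology $H^\bullet(R)$ is the cohomology of $\widetilde C^\bullet(R)/\partial\widetilde C^\bullet(R)$. **Proposition.** Let $N>2$. For every $a\in\mathbb{C}$, the Lie conformal superalgebra $S_{N,a}$ has no non-trivial central extensions (every central extension of it is trivial), and $H^2(S_{N,a})=0$. If moreover $N$ is even, then $\widetilde S_N$ has no non-trivial central extensions, and $H^2(\widetilde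 S_N)=0$. -/

import Mathlib

noncomputable section

namespace LieConf

open Polynomial TensorProduct

/-- The sign `(-1)^(i j)` for two parities `i`, `j`. -/
def superSign (i j : ZMod 2) : ℂ := if i = 1 ∧ j = 1 then -1 else 1

/-- For a family `a, b ↦ a_(n) b` of `n`-th products on a `ℂ[∂]`-module, the value at `λ = t` of
`[a_λ b] = ∑ₙ λⁿ/n! a_(n) b`; here `t ∈ ℂ[∂]`, which covers `λ ∈ ℂ` and `-λ - ∂`. -/
def lamEval {R : Type*} [AddCommGroup R] [Module ℂ R] [Module ℂ[X] R]
    (nprod : ℕ → R →ₗ[ℂ] R →ₗ[ℂ] R) (t : ℂ[X]) (a b : R) : R :=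
  ∑ᶠ n : ℕ, ((n.factorial : ℂ)⁻¹) • (t ^ n • nprod n a b)

/-- A Lie conformal superalgebra. The indeterminate `X` of `ℂ[X]` acts as `∂`. The `λ`-bracket
`[a_λ b] = ∑ₙ λⁿ/n! a_(n) b` is given by its coefficients, the `n`-th products; identities
between polynomials in `λ`, `μ` are stated for all complex values of `λ`, `μ`. -/
class LieConformalSuperalgebra (R : Type*) [AddCommGroup R] [Module ℂ R] [Module ℂ[X] R]
    [IsScalarTower ℂ ℂ[X] R] where
  /-- the homogeneous elements of parity `i` -/
  part : ZMod 2 → Submodule ℂ[X] R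
  isCompl_part : IsCompl (part 0) (part 1)
  nprod : ℕ → R →ₗ[ℂ] R →ₗ[ℂ] R
  nprod_mem : ∀ (n : ℕ) {i j : ZMod 2} {a b : R}, a ∈ part i → b ∈ part j →
    nprod n a b ∈ part (i + j)
  locality : ∀ a b : R, ∃ m : ℕ, ∀ n, m ≤ n → nprod n a b = 0
  sesqui_left : ∀ (l : ℂ) (a b : R),
    lamEval nprod (C l) ((X : ℂ[X]) • a) b = -(l • lamEval nprod (C l) a b)
  sesqui_right : ∀ (l : ℂ) (a b : R),
    lamEval nprod (C l) a ((X : ℂ[X]) • b) = ((X : ℂ[X]) + C l) • lamEval nprod (C l) a b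
  skew : ∀ (l : ℂ) {i j : ZMod 2} {a b : R}, a ∈ part i → b ∈ part j →
    lamEval nprod (C l) b a = -(superSign i j • lamEval nprod (-C l - X) a b)
  jacobi : ∀ (l m : ℂ) {i j : ZMod 2} {a b : R} (c : R), a ∈ part i → b ∈ part j →
    lamEval nprod (C l) a (lamEval nprod (C m) b c) =
      lamEval nprod (C (l + m)) (lamEval nprod (C l) a b) c +
        superSign i j • lamEval nprod (C m) b (lamEval nprod (C l) a c)

/-! ### Grassmann algebra -/

/-- The Grassmann algebra `Λ(N)` in `ξ₁, …, ξ_N`. -/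
abbrev Gr (N : ℕ) : Type := ExteriorAlgebra ℂ (Fin N → ℂ)

variable {N : ℕ}

/-- The generator `ξᵢ`. -/
def xi (i : Fin N) : Gr N := ExteriorAlgebra.ι ℂ (Pi.single i 1)

/-- The odd derivation `∂ᵢ = ∂/∂ξᵢ`. -/
def pd (i : Fin N) : Gr N →ₗ[ℂ] Gr N :=
  CliffordAlgebra.contractLeft (LinearMap.proj i : Module.Dual ℂ (Fin N → ℂ))

/-- The parity involution `f ↦ (-1)^{p(f)} f`. -/
def inv (N : ℕ) : Gr N →ₗ[ℂ] Gr N :=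
  (CliffordAlgebra.involute : Gr N →ₐ[ℂ] Gr N).toLinearMap

/-- The product `ξ₁ ⋯ ξ_N`. -/
def xiTop (N : ℕ) : Gr N := (List.ofFn fun i : Fin N => xi i).prod

theorem inv_mul (x y : Gr N) : inv N (x * y) = inv N x * inv N y :=
  map_mul (CliffordAlgebra.involute : Gr N →ₐ[ℂ] Gr N) x y

theorem inv_inv (x : Gr N) : inv N (inv N x) = x := CliffordAlgebra.involute_involute x

theorem inv_one : inv N 1 = 1 :=
  map_one (CliffordAlgebra.involute : Gr N →ₐ[ℂ] Gr N)

theorem inv_ι (v : Fin N → ℂ) : inv N (ExteriorAlgebra.ι ℂ v) = -ExteriorAlgebra.ι ℂ v :=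
  CliffordAlgebra.involute_ι v

theorem pd_ι_mul (i : Fin N) (v : Fin N → ℂ) (x : Gr N) :
    pd i (ExteriorAlgebra.ι ℂ v * x) = v i • x - ExteriorAlgebra.ι ℂ v * pd i x :=
  CliffordAlgebra.contractLeft_ι_mul _ v x

theorem pd_one (i : Fin N) : pd i (1 : Gr N) = 0 := CliffordAlgebra.contractLeft_one _ _

theorem pd_algebraMap (i : Fin N) (r : ℂ) : pd i (algebraMap ℂ (Gr N) r) = 0 :=
  CliffordAlgebra.contractLeft_algebraMap _ _ r

theorem pd_xi (i j : Fin N) : pd i (xi j) = if i = j then 1 else 0 := by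
  have := CliffordAlgebra.contractLeft_ι (Q := (0 : QuadraticForm ℂ (Fin N → ℂ)))
    (LinearMap.proj i : Module.Dual ℂ (Fin N → ℂ)) (Pi.single j 1)
  refine this.trans ?_
  by_cases h : i = j
  · subst h; simp
  · simp [h]

theorem pd_pd (i j : Fin N) (x : Gr N) : pd i (pd j x) = -pd j (pd i x) :=
  CliffordAlgebra.contractLeft_comm _ _ x

theorem inv_pd (i : Fin N) (x : Gr N) : inv N (pd i x) = -pd i (inv N x) := by
  induction x using CliffordAlgebra.left_induction with
  | algebraMap r =>
    have h : inv N (algebraMap ℂ (Gr N) r) = algebraMap ℂ (Gr N) r := AlgHom.commutes _ r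
    change inv N (pd i (algebraMap ℂ (Gr N) r)) = -pd i (inv N (algebraMap ℂ (Gr N) r))
    rw [h, pd_algebraMap]; simp
  | add x y hx hy => simp only [map_add, hx, hy]; abel
  | ι_mul x v hx =>
    change inv N (pd i (ExteriorAlgebra.ι ℂ v * x)) =
      -pd i (inv N (ExteriorAlgebra.ι ℂ v * x))
    rw [pd_ι_mul, inv_mul, inv_ι, map_sub, inv_mul, inv_ι, hx, map_smul]
    simp only [neg_mul, map_neg, pd_ι_mul, mul_neg, neg_neg, neg_sub]

theorem pd_mul (i : Fin N) (x y : Gr N) : pd i (x * y) = pd i x * y + inv N x * pd i y := by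
  induction x using CliffordAlgebra.left_induction with
  | algebraMap r =>
    have h : inv N (algebraMap ℂ (Gr N) r) = algebraMap ℂ (Gr N) r := AlgHom.commutes _ r
    change pd i (algebraMap ℂ (Gr N) r * y) = pd i (algebraMap ℂ (Gr N) r) * y +
      inv N (algebraMap ℂ (Gr N) r) * pd i y
    rw [h, pd_algebraMap, ← Algebra.smul_def, map_smul, ← Algebra.smul_def]; simp
  | add x x' hx hy => simp only [map_add, hx, hy, add_mul]; abel
  | ι_mul x v hx =>
    change pd i ((ExteriorAlgebra.ι ℂ v * x) * y) = pd i (ExteriorAlgebra.ι ℂ v * x) * y +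
      inv N (ExteriorAlgebra.ι ℂ v * x) * pd i y
    rw [mul_assoc, pd_ι_mul, pd_ι_mul, inv_mul, inv_ι, hx]
    simp only [mul_add, sub_mul, smul_mul_assoc, neg_mul, mul_assoc]
    abel

theorem ι_mul_comm (v : Fin N → ℂ) (y : Gr N) :
    ExteriorAlgebra.ι ℂ v * y = inv N y * ExteriorAlgebra.ι ℂ v := by
  induction y using CliffordAlgebra.left_induction with
  | algebraMap r =>
    have h : inv N (algebraMap ℂ (Gr N) r) = algebraMap ℂ (Gr N) r := AlgHom.commutes _ r
    change ExteriorAlgebra.ι ℂ v * algebraMap ℂ (Gr N) r =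
      inv N (algebraMap ℂ (Gr N) r) * ExteriorAlgebra.ι ℂ v
    rw [h, Algebra.commutes]
  | add x x' hx hy => simp only [map_add, mul_add, hx, hy, add_mul]
  | ι_mul x w hx =>
    change ExteriorAlgebra.ι ℂ v * (ExteriorAlgebra.ι ℂ w * x) =
      inv N (ExteriorAlgebra.ι ℂ w * x) * ExteriorAlgebra.ι ℂ v
    have h := ExteriorAlgebra.ι_add_mul_swap (R := ℂ) v w
    rw [inv_mul, inv_ι, mul_assoc, ← hx, ← mul_assoc, ← mul_assoc, eq_neg_of_add_eq_zero_left h]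
    simp

theorem super_comm_aux (x : Gr N) :
    (∀ y, (x + inv N x) * y = y * (x + inv N x)) ∧
      (∀ y, (x - inv N x) * y = inv N y * (x - inv N x)) := by
  induction x using CliffordAlgebra.left_induction with
  | algebraMap r =>
    have h : inv N (algebraMap ℂ (Gr N) r) = algebraMap ℂ (Gr N) r := AlgHom.commutes _ r
    have h' : inv N (algebraMap ℂ (CliffordAlgebra (0 : QuadraticForm ℂ (Fin N → ℂ))) r) =
      algebraMap ℂ (CliffordAlgebra (0 : QuadraticForm ℂ (Fin N → ℂ))) r := h
    rw [h']
    constructor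
    · intro y
      rw [← map_add, Algebra.commutes]
    · intro y; simp
  | add x x' hx hy =>
    constructor
    · intro y
      have e : x + x' + inv N (x + x') = (x + inv N x) + (x' + inv N x') := by
        rw [map_add]; abel
      rw [e, add_mul, mul_add, hx.1, hy.1]
    · intro y
      have e : x + x' - inv N (x + x') = (x - inv N x) + (x' - inv N x') := by
        rw [map_add]; abel
      rw [e, add_mul, mul_add, hx.2, hy.2]
  | ι_mul x v hx =>
    have e1 : ExteriorAlgebra.ι ℂ v * x + inv N (ExteriorAlgebra.ι ℂ v * x) =
        ExteriorAlgebra.ι ℂ v * (x - inv N x) := by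
      rw [inv_mul, inv_ι]; noncomm_ring
    have e2 : ExteriorAlgebra.ι ℂ v * x - inv N (ExteriorAlgebra.ι ℂ v * x) =
        ExteriorAlgebra.ι ℂ v * (x + inv N x) := by
      rw [inv_mul, inv_ι]; noncomm_ring
    constructor
    · intro y
      change (ExteriorAlgebra.ι ℂ v * x + inv N (ExteriorAlgebra.ι ℂ v * x)) * y =
        y * (ExteriorAlgebra.ι ℂ v * x + inv N (ExteriorAlgebra.ι ℂ v * x))
      rw [e1, mul_assoc, hx.2, ← mul_assoc, ι_mul_comm v (inv N y), inv_inv, mul_assoc]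
    · intro y
      change (ExteriorAlgebra.ι ℂ v * x - inv N (ExteriorAlgebra.ι ℂ v * x)) * y =
        inv N y * (ExteriorAlgebra.ι ℂ v * x - inv N (ExteriorAlgebra.ι ℂ v * x))
      rw [e2, mul_assoc, hx.1, ← mul_assoc, ι_mul_comm v y, mul_assoc]

theorem even_comm {x : Gr N} (hx : inv N x = x) (y : Gr N) : x * y = y * x := by
  have h := (super_comm_aux x).1 y
  rw [hx, ← two_smul ℂ x, smul_mul_assoc, mul_smul_comm] at h
  exact smul_right_injective _ (two_ne_zero : (2 : ℂ) ≠ 0) h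

theorem odd_comm {x : Gr N} (hx : inv N x = -x) (y : Gr N) : x * y = inv N y * x := by
  have h := (super_comm_aux x).2 y
  rw [hx, sub_neg_eq_add, ← two_smul ℂ x, smul_mul_assoc, mul_smul_comm] at h
  exact smul_right_injective _ (two_ne_zero : (2 : ℂ) ≠ 0) h

/-! ### Sesquilinear extensions to `ℂ[∂] ⊗ V` -/

section Sesquilinear

variable {V U T : Type*} [AddCommGroup V] [Module ℂ V] [AddCommGroup U] [Module ℂ U]
  [AddCommGroup T] [Module ℂ T]

/-- Multiplication by `λ` on `ℂ[λ] ⊗ (ℂ[∂] ⊗ V)`. -/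
def mulLam (V : Type*) [AddCommGroup V] [Module ℂ V] : Module.End ℂ (ℂ[X] ⊗[ℂ] (ℂ[X] ⊗[ℂ] V)) :=
  LinearMap.rTensor (ℂ[X] ⊗[ℂ] V) (LinearMap.mulLeft ℂ X)

/-- Multiplication by `∂` on `ℂ[λ] ⊗ (ℂ[∂] ⊗ V)`. -/
def mulD (V : Type*) [AddCommGroup V] [Module ℂ V] : Module.End ℂ (ℂ[X] ⊗[ℂ] (ℂ[X] ⊗[ℂ] V)) :=
  LinearMap.lTensor ℂ[X] (Algebra.lsmul ℂ ℂ (ℂ[X] ⊗[ℂ] V) (X : ℂ[X]))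

/-- `[v_λ q(∂) w] = q(∂ + λ) [v_λ w]`, where `β w = [v_λ w]`. -/
def lamExtAux (β : V →ₗ[ℂ] ℂ[X] ⊗[ℂ] (ℂ[X] ⊗[ℂ] V)) :
    ℂ[X] ⊗[ℂ] V →ₗ[ℂ] ℂ[X] ⊗[ℂ] (ℂ[X] ⊗[ℂ] V) :=
  TensorProduct.lift ((aeval (mulD V + mulLam V) : ℂ[X] →ₐ[ℂ] _).toLinearMap.compl₂ β)

theorem lamExtAux_add (β γ : V →ₗ[ℂ] ℂ[X] ⊗[ℂ] (ℂ[X] ⊗[ℂ] V)) :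
    lamExtAux (β + γ) = lamExtAux β + lamExtAux γ :=
  TensorProduct.ext' fun q u => by simp [lamExtAux]

theorem lamExtAux_smul (c : ℂ) (β : V →ₗ[ℂ] ℂ[X] ⊗[ℂ] (ℂ[X] ⊗[ℂ] V)) :
    lamExtAux (c • β) = c • lamExtAux β :=
  TensorProduct.ext' fun q u => by simp [lamExtAux]

/-- The sesquilinear extension `[p(∂) v_λ q(∂) w] = p(-λ) q(∂ + λ) [v_λ w]` to `ℂ[∂] ⊗ V` of a
`λ`-bracket `β v w = [v_λ w] ∈ ℂ[λ] ⊗ (ℂ[∂] ⊗ V)` on generators. -/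
def lamExt (β : V →ₗ[ℂ] V →ₗ[ℂ] ℂ[X] ⊗[ℂ] (ℂ[X] ⊗[ℂ] V)) :
    ℂ[X] ⊗[ℂ] V →ₗ[ℂ] ℂ[X] ⊗[ℂ] V →ₗ[ℂ] ℂ[X] ⊗[ℂ] (ℂ[X] ⊗[ℂ] V) :=
  TensorProduct.lift (LinearMap.mk₂ ℂ
    (fun (p : ℂ[X]) (v : V) => (aeval (-mulLam V) p : Module.End ℂ _) ∘ₗ lamExtAux (β v))
    (fun p q v => by rw [map_add, LinearMap.add_comp])
    (fun c p v => by rw [map_smul, LinearMap.smul_comp])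
    (fun p v w => by rw [map_add, lamExtAux_add, LinearMap.comp_add])
    (fun c p v => by rw [map_smul, lamExtAux_smul, LinearMap.comp_smul]))

/-- The coefficient of `λⁿ` of an element of `ℂ[λ] ⊗ R`. -/
def lamCoeff (R : Type*) [AddCommGroup R] [Module ℂ R] (n : ℕ) : ℂ[X] ⊗[ℂ] R →ₗ[ℂ] R :=
  (TensorProduct.lid ℂ R).toLinearMap ∘ₗ LinearMap.rTensor R (lcoeff ℂ n)

/-- The `n`-th products of the `λ`-bracket `lamExt β`. -/
def nprodExt (β : V →ₗ[ℂ] V →ₗ[ℂ] ℂ[X] ⊗[ℂ] (ℂ[X] ⊗[ℂ] V)) (n : ℕ) :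
    ℂ[X] ⊗[ℂ] V →ₗ[ℂ] ℂ[X] ⊗[ℂ] V →ₗ[ℂ] ℂ[X] ⊗[ℂ] V :=
  (lamExt β).compr₂ ((n.factorial : ℂ) • lamCoeff (ℂ[X] ⊗[ℂ] V) n)

theorem C_smul {M : Type*} [AddCommGroup M] [Module ℂ M] [Module ℂ[X] M] [IsScalarTower ℂ ℂ[X] M]
    (c : ℂ) (x : M) : (C c : ℂ[X]) • x = c • x := by
  rw [← mul_one (C c), ← smul_eq_C_mul, smul_assoc, one_smul]

/-- Induction on elements of `ℂ[∂] ⊗ V`. -/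
theorem dInduction {p : ℂ[X] ⊗[ℂ] V → Prop}
    (gen : ∀ v, p (1 ⊗ₜ v)) (add : ∀ x y, p x → p y → p (x + y))
    (hX : ∀ x, p x → p ((X : ℂ[X]) • x)) (x : ℂ[X] ⊗[ℂ] V) : p x := by
  induction x using TensorProduct.induction_on with
  | zero => simpa using gen 0
  | tmul q v =>
    induction q using Polynomial.induction_on with
    | C a =>
      have : (C a) ⊗ₜ[ℂ] v = (1 : ℂ[X]) ⊗ₜ[ℂ] (a • v) := by
        rw [← mul_one (C a), ← smul_eq_C_mul, smul_tmul]
      rw [this]; exact gen _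
    | add q q' h h' => rw [add_tmul]; exact add _ _ h h'
    | monomial n a h =>
      have e : (C a * X ^ (n + 1)) ⊗ₜ[ℂ] v = (X : ℂ[X]) • ((C a * X ^ n) ⊗ₜ[ℂ] v) := by
        rw [smul_tmul', smul_eq_mul]; congr 1; ring
      rw [e]; exact hX _ h
  | add x y hx hy => exact add _ _ hx hy

/-- The value at `λ = t` of an element of `ℂ[λ] ⊗ R`. -/
def evLam {R : Type*} [AddCommGroup R] [Module ℂ R] [Module ℂ[X] R] [IsScalarTower ℂ ℂ[X] R]
    (t : ℂ[X]) : ℂ[X] ⊗[ℂ] R →ₗ[ℂ] R :=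
  TensorProduct.lift ((Algebra.lsmul ℂ ℂ R).toLinearMap ∘ₗ
    (aeval t : ℂ[X] →ₐ[ℂ] ℂ[X]).toLinearMap)

theorem lamExt_tmul (β : V →ₗ[ℂ] V →ₗ[ℂ] ℂ[X] ⊗[ℂ] (ℂ[X] ⊗[ℂ] V)) (p q : ℂ[X]) (v w : V) :
    lamExt β (p ⊗ₜ v) (q ⊗ₜ w) =
      aeval (-mulLam V) p (aeval (mulD V + mulLam V) q (β v w)) := rfl

section

variable {R : Type*} [AddCommGroup R] [Module ℂ R]

theorem lamCoeff_finite (z : ℂ[X] ⊗[ℂ] R) : ∃ m : ℕ, ∀ n, m ≤ n → lamCoeff R n z = 0 := by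
  induction z using TensorProduct.induction_on with
  | zero => exact ⟨0, by simp⟩
  | tmul p x =>
    refine ⟨p.natDegree + 1, fun n hn => ?_⟩
    simp [lamCoeff, coeff_eq_zero_of_natDegree_lt (show p.natDegree < n by omega)]
  | add x y hx hy =>
    obtain ⟨m, hm⟩ := hx
    obtain ⟨m', hm'⟩ := hy
    exact ⟨max m m', fun n hn => by
      rw [map_add, hm n (le_trans (le_max_left _ _) hn), hm' n (le_trans (le_max_right _ _) hn),
        add_zero]⟩

variable [Module ℂ[X] R]

theorem lamCoeff_support (t : ℂ[X]) (z : ℂ[X] ⊗[ℂ] R) :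
    (Function.support fun n => t ^ n • lamCoeff R n z).Finite := by
  obtain ⟨m, hm⟩ := lamCoeff_finite z
  refine (Finset.range m).finite_toSet.subset fun n hn => ?_
  simp only [Finset.coe_range, Set.mem_Iio]
  by_contra h
  exact hn (by simp [hm n (not_lt.mp h)])

variable [IsScalarTower ℂ ℂ[X] R]

theorem evLam_tmul (t p : ℂ[X]) (x : R) : evLam t (p ⊗ₜ[ℂ] x) = (aeval t p) • x := rfl

theorem finsum_lamCoeff (t : ℂ[X]) (z : ℂ[X] ⊗[ℂ] R) :
    ∑ᶠ n, t ^ n • lamCoeff R n z = evLam t z := by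
  induction z using TensorProduct.induction_on with
  | zero => simp
  | tmul p x =>
    rw [evLam_tmul, finsum_eq_sum_of_support_subset (s := Finset.range (p.natDegree + 1)),
      aeval_eq_sum_range, Finset.sum_smul]
    · refine Finset.sum_congr rfl fun n _ => ?_
      simp only [lamCoeff, LinearMap.comp_apply, LinearMap.rTensor_tmul, lcoeff_apply,
        LinearEquiv.coe_coe, TensorProduct.lid_tmul]
      rw [smul_comm, smul_assoc]
    · intro n hn
      simp only [Finset.coe_range, Set.mem_Iio]
      by_contra h
      exact hn (by simp [lamCoeff, coeff_eq_zero_of_natDegree_lt (show p.natDegree < n by omega)])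
  | add x y hx hy =>
    simp only [map_add, smul_add]
    rw [finsum_add_distrib (lamCoeff_support t x) (lamCoeff_support t y), hx, hy]

end

section

variable (β : V →ₗ[ℂ] V →ₗ[ℂ] ℂ[X] ⊗[ℂ] (ℂ[X] ⊗[ℂ] V))

theorem lamEval_nprodExt (t : ℂ[X]) (x y : ℂ[X] ⊗[ℂ] V) :
    lamEval (nprodExt β) t x y = evLam t (lamExt β x y) := by
  rw [← finsum_lamCoeff]
  refine finsum_congr fun n => ?_
  have h : (n.factorial : ℂ) ≠ 0 := by exact_mod_cast n.factorial_ne_zero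
  simp only [nprodExt, LinearMap.compr₂_apply, LinearMap.smul_apply]
  rw [smul_comm, inv_smul_smul₀ h]

theorem nprodExt_locality (x y : ℂ[X] ⊗[ℂ] V) :
    ∃ m : ℕ, ∀ n, m ≤ n → nprodExt β n x y = 0 := by
  obtain ⟨m, hm⟩ := lamCoeff_finite (lamExt β x y)
  exact ⟨m, fun n hn => by simp [nprodExt, hm n hn]⟩

theorem evLam_mulLam (t : ℂ[X]) (z : ℂ[X] ⊗[ℂ] (ℂ[X] ⊗[ℂ] V)) :
    evLam t (mulLam V z) = t • evLam t z := by
  induction z using TensorProduct.induction_on with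
  | zero => simp
  | tmul p x => simp [mulLam, evLam_tmul, mul_smul]
  | add x y hx hy => simp only [map_add, smul_add, hx, hy]

theorem evLam_mulD (t : ℂ[X]) (z : ℂ[X] ⊗[ℂ] (ℂ[X] ⊗[ℂ] V)) :
    evLam t (mulD V z) = (X : ℂ[X]) • evLam t z := by
  induction z using TensorProduct.induction_on with
  | zero => simp
  | tmul p x =>
    simp only [mulD, LinearMap.lTensor_tmul, evLam_tmul, Algebra.lsmul_coe]; rw [smul_comm]
  | add x y hx hy => simp only [map_add, smul_add, hx, hy]

theorem lamExt_X_left (x y : ℂ[X] ⊗[ℂ] V) :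
    lamExt β ((X : ℂ[X]) • x) y = -mulLam V (lamExt β x y) := by
  induction x using TensorProduct.induction_on with
  | zero => simp
  | tmul p v =>
    induction y using TensorProduct.induction_on with
    | zero => simp
    | tmul q w =>
      rw [smul_tmul', smul_eq_mul, lamExt_tmul, lamExt_tmul, map_mul, aeval_X]; rfl
    | add y y' hy hy' => simp only [map_add, hy, hy', neg_add]
  | add x x' hx hx' => simp only [smul_add, map_add, LinearMap.add_apply, hx, hx', neg_add]

theorem mulD_mulLam (z : ℂ[X] ⊗[ℂ] (ℂ[X] ⊗[ℂ] V)) :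
    mulD V (mulLam V z) = mulLam V (mulD V z) := by
  induction z using TensorProduct.induction_on with
  | zero => simp
  | tmul p x => simp [mulLam, mulD]
  | add x y hx hy => simp only [map_add, hx, hy]

theorem lamExt_X_right (x y : ℂ[X] ⊗[ℂ] V) :
    lamExt β x ((X : ℂ[X]) • y) = mulD V (lamExt β x y) + mulLam V (lamExt β x y) := by
  induction x using TensorProduct.induction_on with
  | zero => simp
  | tmul p v =>
    induction y using TensorProduct.induction_on with
    | zero => simp
    | tmul q w =>
      have hc : Commute (aeval (-mulLam V) p : Module.End ℂ (ℂ[X] ⊗[ℂ] (ℂ[X] ⊗[ℂ] V)))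
          (mulD V + mulLam V) := by
        have h1 : Commute (-mulLam V) (mulD V + mulLam V) :=
          LinearMap.ext fun z => by simp [Module.End.mul_apply, mulD_mulLam, add_comm]
        induction p using Polynomial.induction_on' with
        | add p q hp hq => rw [map_add]; exact hp.add_left hq
        | monomial n a =>
          rw [aeval_monomial]
          exact Commute.mul_left (Algebra.commutes a _) (h1.pow_left n)
      rw [smul_tmul', smul_eq_mul, lamExt_tmul, lamExt_tmul, map_mul, aeval_X,
        Module.End.mul_apply]
      exact LinearMap.congr_fun hc.eq _
    | add y y' hy hy' => simp only [smul_add, map_add, hy, hy']; abel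
  | add x x' hx hx' => simp only [map_add, LinearMap.add_apply, hx, hx']; abel

theorem lamEval_ext_gen (t : ℂ[X]) (v w : V) :
    lamEval (nprodExt β) t (1 ⊗ₜ v) (1 ⊗ₜ w) = evLam t (β v w) := by
  rw [lamEval_nprodExt, lamExt_tmul, map_one, map_one]; rfl

theorem lamEval_ext_add_left (t : ℂ[X]) (x x' y : ℂ[X] ⊗[ℂ] V) :
    lamEval (nprodExt β) t (x + x') y =
      lamEval (nprodExt β) t x y + lamEval (nprodExt β) t x' y := by
  simp only [lamEval_nprodExt, map_add, LinearMap.add_apply]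

theorem lamEval_ext_add_right (t : ℂ[X]) (x y y' : ℂ[X] ⊗[ℂ] V) :
    lamEval (nprodExt β) t x (y + y') =
      lamEval (nprodExt β) t x y + lamEval (nprodExt β) t x y' := by
  simp only [lamEval_nprodExt, map_add]

theorem lamEval_ext_X_left (t : ℂ[X]) (x y : ℂ[X] ⊗[ℂ] V) :
    lamEval (nprodExt β) t ((X : ℂ[X]) • x) y = -(t • lamEval (nprodExt β) t x y) := by
  rw [lamEval_nprodExt, lamEval_nprodExt, lamExt_X_left, map_neg, evLam_mulLam]

theorem lamEval_ext_X_right (t : ℂ[X]) (x y : ℂ[X] ⊗[ℂ] V) :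
    lamEval (nprodExt β) t x ((X : ℂ[X]) • y) =
      ((X : ℂ[X]) + t) • lamEval (nprodExt β) t x y := by
  rw [lamEval_nprodExt, lamEval_nprodExt, lamExt_X_right, map_add, evLam_mulD, evLam_mulLam,
    add_smul]

/-- An element of `ℂ[λ] ⊗ R` all of whose values lie in a submodule has all its coefficients in
that submodule. -/
theorem lamCoeff_mem {R : Type*} [AddCommGroup R] [Module ℂ R] [Module ℂ[X] R]
    [IsScalarTower ℂ ℂ[X] R] (S : Submodule ℂ R) (z : ℂ[X] ⊗[ℂ] R)
    (h : ∀ l : ℂ, evLam (C l) z ∈ S) (n : ℕ) : lamCoeff R n z ∈ S := by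
  rw [← Submodule.Quotient.mk_eq_zero, ← Submodule.mkQ_apply]
  by_contra hne
  obtain ⟨φ, hφ⟩ : ∃ φ : Module.Dual ℂ (R ⧸ S), φ (S.mkQ (lamCoeff R n z)) ≠ 0 := by
    by_contra hcon
    push Not at hcon
    exact hne ((Module.forall_dual_apply_eq_zero_iff ℂ _).mp hcon)
  let ψ : R →ₗ[ℂ] ℂ := φ ∘ₗ S.mkQ
  let P : ℂ[X] ⊗[ℂ] R →ₗ[ℂ] ℂ[X] :=
    (TensorProduct.rid ℂ ℂ[X]).toLinearMap ∘ₗ LinearMap.lTensor ℂ[X] ψ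
  have h1 : ∀ (l : ℂ) y, eval l (P y) = ψ (evLam (C l) y) := by
    intro l y
    induction y using TensorProduct.induction_on with
    | zero => simp
    | tmul p x =>
      have hp : aeval (C l : ℂ[X]) p = C (eval l p) := by
        have := aeval_algebraMap_apply ℂ[X] l p
        rw [coe_aeval_eq_eval] at this
        exact this
      rw [evLam_tmul, hp, C_smul]
      simp [P, mul_comm]
    | add x y hx hy => simp only [map_add, eval_add, hx, hy]
  have h2 : ∀ y, (P y).coeff n = ψ (lamCoeff R n y) := by
    intro y
    induction y using TensorProduct.induction_on with
    | zero => simp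
    | tmul p x => simp [P, lamCoeff, mul_comm]
    | add x y hx hy => simp only [map_add, coeff_add, hx, hy]
  have h3 : P z = 0 := by
    refine Polynomial.funext fun l => ?_
    rw [h1, eval_zero]
    have : S.mkQ (evLam (C l) z) = 0 := by
      rw [Submodule.mkQ_apply, Submodule.Quotient.mk_eq_zero]; exact h l
    simp [ψ, this]
  apply hφ
  have := h2 z
  rw [h3, coeff_zero] at this
  exact this.symm

end

/-- The map `p(∂) v, q(∂) u ↦ p(-l) q(∂ + l) f(v, u)`. -/
def sesq (l : ℂ) (f : V →ₗ[ℂ] U →ₗ[ℂ] ℂ[X] ⊗[ℂ] T) :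
    ℂ[X] ⊗[ℂ] V →ₗ[ℂ] ℂ[X] ⊗[ℂ] U →ₗ[ℂ] ℂ[X] ⊗[ℂ] T :=
  TensorProduct.lift (LinearMap.mk₂ ℂ
    (fun (p : ℂ[X]) (v : V) => eval (-l) p • TensorProduct.lift
      (((Algebra.lsmul ℂ ℂ (ℂ[X] ⊗[ℂ] T)).toLinearMap ∘ₗ
        (aeval (X + C l : ℂ[X]) : ℂ[X] →ₐ[ℂ] ℂ[X]).toLinearMap).compl₂ (f v)))
    (fun p q v => by rw [eval_add, add_smul])
    (fun c p v => by rw [eval_smul, smul_assoc])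
    (fun p v w => by
      rw [← smul_add]; congr 1
      exact TensorProduct.ext' fun q u => by simp)
    (fun c p v => by
      rw [smul_comm]; congr 1
      exact TensorProduct.ext' fun q u => by simp))

section

variable (l : ℂ) (f : V →ₗ[ℂ] U →ₗ[ℂ] ℂ[X] ⊗[ℂ] T)

theorem sesq_tmul (p r : ℂ[X]) (v : V) (h : U) :
    sesq l f (p ⊗ₜ v) (r ⊗ₜ h) = eval (-l) p • aeval (X + C l : ℂ[X]) r • f v h := rfl

theorem sesq_gen (v : V) (h : U) : sesq l f (1 ⊗ₜ v) (1 ⊗ₜ h) = f v h := by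
  rw [sesq_tmul]; simp

theorem sesq_X_left (x : ℂ[X] ⊗[ℂ] V) (m : ℂ[X] ⊗[ℂ] U) :
    sesq l f ((X : ℂ[X]) • x) m = -l • sesq l f x m := by
  induction x using TensorProduct.induction_on with
  | zero => simp
  | tmul p v =>
    induction m using TensorProduct.induction_on with
    | zero => simp
    | tmul r h =>
      rw [smul_tmul', smul_eq_mul, sesq_tmul, sesq_tmul, eval_mul, eval_X, mul_smul]
    | add y y' hy hy' => simp only [map_add, hy, hy', smul_add]
  | add x x' hx hx' => simp only [smul_add, map_add, LinearMap.add_apply, hx, hx']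

theorem sesq_X_right (x : ℂ[X] ⊗[ℂ] V) (m : ℂ[X] ⊗[ℂ] U) :
    sesq l f x ((X : ℂ[X]) • m) = (X + C l : ℂ[X]) • sesq l f x m := by
  induction x using TensorProduct.induction_on with
  | zero => simp
  | tmul p v =>
    induction m using TensorProduct.induction_on with
    | zero => simp
    | tmul r h =>
      rw [smul_tmul', smul_eq_mul, sesq_tmul, sesq_tmul, map_mul, aeval_X, mul_smul, smul_comm]
    | add y y' hy hy' => simp only [map_add, hy, hy', smul_add]
  | add x x' hx hx' => simp only [smul_add, map_add, LinearMap.add_apply, hx, hx']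

theorem sesq_smul_left (p : ℂ[X]) (x : ℂ[X] ⊗[ℂ] V) (m : ℂ[X] ⊗[ℂ] U) :
    sesq l f (p • x) m = eval (-l) p • sesq l f x m := by
  induction p using Polynomial.induction_on with
  | C a => rw [C_smul (M := ℂ[X] ⊗[ℂ] V), map_smul, LinearMap.smul_apply, eval_C]
  | add p q hp hq => rw [add_smul, map_add, LinearMap.add_apply, hp, hq, eval_add, add_smul]
  | monomial n a h =>
    rw [show (C a * X ^ (n + 1) : ℂ[X]) = X * (C a * X ^ n) by ring, mul_smul, sesq_X_left, h,
      eval_mul (p := X), eval_X, mul_smul]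

theorem sesq_smul_right (p : ℂ[X]) (x : ℂ[X] ⊗[ℂ] V) (m : ℂ[X] ⊗[ℂ] U) :
    sesq l f x (p • m) = p.comp (X + C l) • sesq l f x m := by
  induction p using Polynomial.induction_on with
  | C a => rw [C_smul (M := ℂ[X] ⊗[ℂ] U), map_smul, C_comp, C_smul (M := ℂ[X] ⊗[ℂ] T)]
  | add p q hp hq => rw [add_smul, map_add, hp, hq, add_comp, add_smul]
  | monomial n a h =>
    rw [show (C a * X ^ (n + 1) : ℂ[X]) = X * (C a * X ^ n) by ring, mul_smul, sesq_X_right, h,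
      mul_comp (p := X), X_comp, mul_smul]

/-- The value at `∂ = -l`. -/
def evD (l : ℂ) : ℂ[X] ⊗[ℂ] V →ₗ[ℂ] V :=
  TensorProduct.lift ((LinearMap.lsmul ℂ V) ∘ₗ (aeval (-l) : ℂ[X] →ₐ[ℂ] ℂ).toLinearMap)

theorem evD_tmul (p : ℂ[X]) (v : V) : evD l (p ⊗ₜ v) = eval (-l) p • v := by
  simp [evD, coe_aeval_eq_eval]

theorem sesq_eq_evD (x : ℂ[X] ⊗[ℂ] V) (m : ℂ[X] ⊗[ℂ] U) :
    sesq l f x m = sesq l f (1 ⊗ₜ evD l x) m := by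
  induction x using TensorProduct.induction_on with
  | zero => simp
  | tmul p v =>
    have e : p ⊗ₜ[ℂ] v = p • ((1 : ℂ[X]) ⊗ₜ[ℂ] v) := by rw [smul_tmul', smul_eq_mul, mul_one]
    rw [e, sesq_smul_left, ← e, evD_tmul, tmul_smul, map_smul, LinearMap.smul_apply]
  | add x y hx hy => rw [map_add, map_add, tmul_add, map_add, LinearMap.add_apply, hx, hy]; rfl

theorem eq_zero_of_evD {x : ℂ[X] ⊗[ℂ] V} (h : ∀ l, evD l x = 0) : x = 0 := by
  let b := Module.Free.chooseBasis ℂ V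
  let B := Algebra.TensorProduct.basis ℂ[X] b
  apply B.ext_elem
  intro i
  have hc : ∀ l (y : ℂ[X] ⊗[ℂ] V), eval (-l) (B.repr y i) = b.repr (evD l y) i := by
    intro l y
    induction y using TensorProduct.induction_on with
    | zero => simp
    | tmul p v =>
      rw [evD_tmul, Algebra.TensorProduct.basis_repr_tmul]
      simp
    | add x y hx hy => simp only [map_add, Finsupp.add_apply, eval_add, hx, hy]
  rw [map_zero, Finsupp.zero_apply]
  refine Polynomial.funext fun r => ?_
  have := hc (-r) x
  rw [neg_neg] at this
  rw [this, h]; simp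

end

end Sesquilinear

/-! ### The Lie conformal superalgebra `W_N` -/

/-- The generators `W(N) ⊕ Λ(N)` of `W_N`; the derivation `∑ᵢ Pᵢ ∂ᵢ` of `Λ(N)` is given by the
family `P` of its coefficients. -/
abbrev Gen (N : ℕ) : Type := (Fin N → Gr N) × Gr N

/-- `W_N = ℂ[∂] ⊗ (W(N) ⊕ Λ(N))`. -/
abbrev W (N : ℕ) : Type := ℂ[X] ⊗[ℂ] Gen N

/-- The derivation `∑ᵢ Pᵢ ∂ᵢ` applied to `g`. -/
def der (P : Fin N → Gr N) (g : Gr N) : Gr N := ∑ i, P i * pd i g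

/-- For homogeneous `b = ∑ᵢ Qᵢ ∂ᵢ` and `f`, this is `(-1)^{p(f)p(b)} b(f)`. -/
def derSwap (f : Gr N) (Q : Fin N → Gr N) : Gr N := ∑ i, pd i (inv N f) * inv N (Q i)

/-- The Lie superbracket of `W(N)` in coordinates: for `A, B ∈ Λ(N)`,
`[A ∂ᵢ, B ∂ⱼ] = A (∂ᵢ B) ∂ⱼ + (-1)^{p(A)} (∂ⱼ A) B ∂ᵢ`. -/
def wBracket (P Q : Fin N → Gr N) : Fin N → Gr N :=
  fun k => (∑ i, P i * pd i (Q k)) + ∑ j, pd j (inv N (P k)) * Q j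

/-- The bilinear map sending `v, w ∈ W(N) ⊕ Λ(N)` to the coefficient of `λ⁰` of `[v_λ w]`. -/
def genBr₀ (N : ℕ) : Gen N →ₗ[ℂ] Gen N →ₗ[ℂ] W N :=
  LinearMap.mk₂ ℂ
    (fun v w => (1 : ℂ[X]) ⊗ₜ[ℂ] ((wBracket v.1 w.1, der v.1 w.2 - derSwap v.2 w.1) : Gen N) -
      (X : ℂ[X]) ⊗ₜ[ℂ] ((fun k => v.2 * w.1 k, v.2 * w.2) : Gen N))
    (by
      intro v v' w
      rw [sub_add_sub_comm, ← tmul_add, ← tmul_add]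
      congr 2
      · ext <;> simp [wBracket, der, derSwap, add_mul, Finset.sum_add_distrib] <;> abel
      · ext <;> simp [add_mul])
    (by
      intro c v w
      rw [smul_sub, ← tmul_smul, ← tmul_smul]
      congr 2
      · ext <;> simp [wBracket, der, derSwap, Finset.smul_sum, smul_sub]
      · ext <;> simp)
    (by
      intro v w w'
      rw [sub_add_sub_comm, ← tmul_add, ← tmul_add]
      congr 2
      · ext <;> simp [wBracket, der, derSwap, mul_add, Finset.sum_add_distrib] <;> abel
      · ext <;> simp [mul_add])
    (by
      intro c v w
      rw [smul_sub, ← tmul_smul, ← tmul_smul]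
      congr 2
      · ext <;> simp [wBracket, der, derSwap, Finset.smul_sum, smul_sub]
      · ext <;> simp)

/-- The bilinear map sending `v, w ∈ W(N) ⊕ Λ(N)` to the coefficient of `λ¹` of `[v_λ w]`. -/
def genBr₁ (N : ℕ) : Gen N →ₗ[ℂ] Gen N →ₗ[ℂ] W N :=
  LinearMap.mk₂ ℂ
    (fun v w => -((1 : ℂ[X]) ⊗ₜ[ℂ]
      ((fun k => v.1 k * inv N w.2 + v.2 * w.1 k, (2 : ℂ) • (v.2 * w.2)) : Gen N)))
    (by
      intro v v' w
      rw [← neg_add, ← tmul_add]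
      congr 2
      ext
      · simp [add_mul]; abel
      · simp [add_mul])
    (by
      intro c v w
      rw [smul_neg, ← tmul_smul]
      congr 2
      refine Prod.ext (funext fun k => ?_) ?_
      · simp
      · simp [smul_comm c (2 : ℂ)])
    (by
      intro v w w'
      rw [← neg_add, ← tmul_add]
      congr 2
      ext
      · simp [mul_add]; abel
      · simp [mul_add])
    (by
      intro c v w
      rw [smul_neg, ← tmul_smul]
      congr 2
      refine Prod.ext (funext fun k => ?_) ?_
      · simp
      · simp [smul_comm c (2 : ℂ)])

/-- The `λ`-bracket of `W_N` on generators: for `a = ∑ᵢ Pᵢ ∂ᵢ`, `b ∈ W(N)` and `f, g ∈ Λ(N)`,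
`[a_λ b] = [a, b]`, `[a_λ g] = a(g) - λ (-1)^{p(a)p(g)} g a`, `[f_λ g] = -∂(fg) - 2λ fg`, and
`[f_λ b] = -(-1)^{p(f)p(b)} b(f) - (∂ + λ) f b` as skew-commutativity requires. Note that
`(-1)^{p(a)p(g)} g a = ∑ᵢ Pᵢ (-1)^{p(g)} g ∂ᵢ`. -/
def genBr (N : ℕ) : Gen N →ₗ[ℂ] Gen N →ₗ[ℂ] ℂ[X] ⊗[ℂ] W N :=
  (genBr₀ N).compr₂ (TensorProduct.mk ℂ ℂ[X] (W N) 1) +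
    (genBr₁ N).compr₂ (TensorProduct.mk ℂ ℂ[X] (W N) X)

/-- The parity involution of `W(N) ⊕ Λ(N)`; `A ∂ᵢ` has parity `p(A) + 1`. -/
def genInv (N : ℕ) : Gen N →ₗ[ℂ] Gen N where
  toFun v := (fun k => -inv N (v.1 k), inv N v.2)
  map_add' v w := by ext <;> simp [add_comm]
  map_smul' c v := by ext <;> simp

/-- The parity involution `x ↦ (-1)^{p(x)} x` of `W_N`. -/
def wInv (N : ℕ) : W N →ₗ[ℂ[X]] W N := (genInv N).baseChange ℂ[X]

/-- The elements of parity `i` in `W_N`, the `(-1)^i`-eigenspace of the parity involution. -/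
def wPart (N : ℕ) (i : ZMod 2) : Submodule ℂ[X] (W N) :=
  LinearMap.ker (wInv N - C (superSign i 1) • LinearMap.id)

theorem superSign_zero_left (i : ZMod 2) : superSign 0 i = 1 := by simp [superSign]

theorem superSign_one_one : superSign 1 1 = -1 := by simp [superSign]

theorem zmod2_cases (i : ZMod 2) : i = 0 ∨ i = 1 := by revert i; decide

theorem superSign_add (i j : ZMod 2) : superSign (i + j) 1 = superSign i 1 * superSign j 1 := by
  rcases zmod2_cases i with rfl | rfl <;> rcases zmod2_cases j with rfl | rfl <;>
    simp [superSign, show (1 : ZMod 2) + 1 = 0 from rfl]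

theorem mem_wPart {i : ZMod 2} {x : W N} : x ∈ wPart N i ↔ wInv N x = superSign i 1 • x := by
  rw [wPart, LinearMap.mem_ker, LinearMap.sub_apply, sub_eq_zero, LinearMap.smul_apply,
    LinearMap.id_apply, C_smul (M := W N)]

theorem genInv_genInv (v : Gen N) : genInv N (genInv N v) = v := by
  ext <;> simp [genInv, inv_inv]

theorem wInv_tmul (p : ℂ[X]) (v : Gen N) : wInv N (p ⊗ₜ v) = p ⊗ₜ genInv N v := rfl

theorem wInv_wInv (x : W N) : wInv N (wInv N x) = x := by
  induction x using TensorProduct.induction_on with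
  | zero => simp
  | tmul p v => rw [wInv_tmul, wInv_tmul, genInv_genInv]
  | add x y hx hy => simp only [map_add, hx, hy]

theorem wInv_smul (c : ℂ) (x : W N) : wInv N (c • x) = c • wInv N x := by
  rw [← C_smul (M := W N), map_smul, C_smul (M := W N)]

theorem mem_wPart_zero {x : W N} : x ∈ wPart N 0 ↔ wInv N x = x := by
  rw [mem_wPart, superSign_zero_left, one_smul ℂ x]

theorem mem_wPart_one {x : W N} : x ∈ wPart N 1 ↔ wInv N x = -x := by
  rw [mem_wPart, superSign_one_one, neg_smul (1 : ℂ) x, one_smul ℂ x]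

theorem w_decomp (x : W N) :
    x = (2⁻¹ : ℂ) • (x + wInv N x) + (2⁻¹ : ℂ) • (x - wInv N x) := by
  rw [← smul_add, add_add_sub_cancel, ← two_smul ℂ x, inv_smul_smul₀ two_ne_zero]

theorem half_add_mem (x : W N) : (2⁻¹ : ℂ) • (x + wInv N x) ∈ wPart N 0 := by
  rw [mem_wPart_zero, wInv_smul, map_add, wInv_wInv, add_comm]

theorem half_sub_mem (x : W N) : (2⁻¹ : ℂ) • (x - wInv N x) ∈ wPart N 1 := by
  rw [mem_wPart_one, wInv_smul, map_sub, wInv_wInv, ← neg_sub x (wInv N x)]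
  exact smul_neg _ _

theorem wPart_isCompl (N : ℕ) : IsCompl (wPart N 0) (wPart N 1) := by
  constructor
  · rw [Submodule.disjoint_def]
    intro x h0 h1
    rw [mem_wPart_zero] at h0
    rw [mem_wPart_one, h0] at h1
    have h2 : (2 : ℂ) • x = 0 := by rw [two_smul]; nth_rewrite 1 [h1]; simp
    exact (smul_eq_zero.mp h2).resolve_left two_ne_zero
  · rw [codisjoint_iff, eq_top_iff]
    intro x _
    rw [w_decomp x]
    exact Submodule.add_mem_sup (half_add_mem x) (half_sub_mem x)

/-! The axioms are checked through the faithful action `a_λ g = a(g)`, `f_λ g = -(∂ + λ) f g` of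
`W_N` on `ℂ[∂] ⊗ Λ(N)`. -/

/-- The action of generators on `Λ(N)`, at `λ = l`. -/
def actGen (N : ℕ) (l : ℂ) : Gen N →ₗ[ℂ] Gr N →ₗ[ℂ] ℂ[X] ⊗[ℂ] Gr N :=
  LinearMap.mk₂ ℂ
    (fun v h => (1 : ℂ[X]) ⊗ₜ[ℂ] der v.1 h - (X + C l : ℂ[X]) ⊗ₜ[ℂ] (v.2 * h))
    (by
      intro v v' w
      rw [sub_add_sub_comm, ← tmul_add, ← tmul_add]
      simp [der, add_mul, Finset.sum_add_distrib])
    (by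
      intro c v w
      rw [smul_sub, ← tmul_smul, ← tmul_smul]
      simp [der, Finset.smul_sum])
    (by
      intro v w w'
      rw [sub_add_sub_comm, ← tmul_add, ← tmul_add]
      simp [der, mul_add, Finset.sum_add_distrib])
    (by
      intro c v w
      rw [smul_sub, ← tmul_smul, ← tmul_smul]
      simp [der, Finset.smul_sum])

theorem actGen_apply (l : ℂ) (v : Gen N) (h : Gr N) : actGen N l v h =
    (1 : ℂ[X]) ⊗ₜ[ℂ] der v.1 h - (X + C l : ℂ[X]) ⊗ₜ[ℂ] (v.2 * h) := rfl

/-- The action of `W_N` on `ℂ[∂] ⊗ Λ(N)`, at `λ = l`. -/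
def act (l : ℂ) : W N →ₗ[ℂ] ℂ[X] ⊗[ℂ] Gr N →ₗ[ℂ] ℂ[X] ⊗[ℂ] Gr N := sesq l (actGen N l)

/-- The action is faithful. -/
theorem act_faithful {x : W N} (hx : ∀ l m, act l x m = 0) : x = 0 := by
  refine eq_zero_of_evD fun l => ?_
  set v := evD l x with hv
  have h : ∀ g : Gr N, (1 : ℂ[X]) ⊗ₜ[ℂ] der v.1 g - (X + C l : ℂ[X]) ⊗ₜ[ℂ] (v.2 * g) = 0 := by
    intro g
    rw [← actGen_apply, ← sesq_gen l, hv, ← sesq_eq_evD]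
    exact hx _ _
  have hf : v.2 = 0 := by
    have := congrArg (lamCoeff (Gr N) 1) (h 1)
    simpa [lamCoeff, coeff_one, coeff_X, coeff_C] using this
  have hP : ∀ g, der v.1 g = 0 := by
    intro g
    have := congrArg (lamCoeff (Gr N) 0) (h g)
    simpa [lamCoeff, hf] using this
  refine Prod.ext (funext fun k => ?_) hf
  have := hP (xi k)
  simpa [der, pd_xi] using this

/-- The `n`-th products of `W_N`. -/
def wProd (N n : ℕ) : W N →ₗ[ℂ] W N →ₗ[ℂ] W N := nprodExt (genBr N) n

theorem evLam_genBr (t : ℂ[X]) (v w : Gen N) :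
    evLam t (genBr N v w) = genBr₀ N v w + t • genBr₁ N v w := by
  simp only [genBr, LinearMap.add_apply, LinearMap.compr₂_apply, TensorProduct.mk_apply, map_add,
    evLam_tmul, map_one, one_smul, aeval_X]

/-- The map `w ↦ (-1)^{i p(w)} w`. -/
def genSgn (i : ZMod 2) (w : Gen N) : Gen N := if i = 1 then genInv N w else w

theorem genSgn_zero (w : Gen N) : genSgn 0 w = w := by simp [genSgn]

theorem genSgn_one (w : Gen N) : genSgn 1 w = (fun k => -inv N (w.1 k), inv N w.2) := by
  simp [genSgn, genInv]

theorem gen_even {v : Gen N} (hv : genInv N v = superSign 0 1 • v) :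
    (∀ k, inv N (v.1 k) = -v.1 k) ∧ inv N v.2 = v.2 := by
  rw [superSign_zero_left, one_smul] at hv
  refine ⟨fun k => ?_, congrArg Prod.snd hv⟩
  have := congrFun (congrArg Prod.fst hv) k
  exact neg_eq_iff_eq_neg.mp this

theorem gen_odd {v : Gen N} (hv : genInv N v = superSign 1 1 • v) :
    (∀ k, inv N (v.1 k) = v.1 k) ∧ inv N v.2 = -v.2 := by
  rw [superSign_one_one, neg_smul, one_smul] at hv
  refine ⟨fun k => ?_, congrArg Prod.snd hv⟩
  have := congrFun (congrArg Prod.fst hv) k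
  exact neg_injective this

theorem inv_pd_even {x : Gr N} (hx : inv N x = x) (i : Fin N) : inv N (pd i x) = -pd i x := by
  rw [inv_pd, hx]

theorem inv_pd_odd {x : Gr N} (hx : inv N x = -x) (i : Fin N) : inv N (pd i x) = pd i x := by
  rw [inv_pd, hx, map_neg, neg_neg]

/-- `∑_{i,k} A_i B_k ∂_i ∂_k h + ∑_{i,k} A_k B_i ∂_i ∂_k h = 0`. -/
theorem pd_antisymm (F : Fin N → Fin N → Gr N) (h : Gr N) :
    ∑ i, ∑ k, F i k * pd i (pd k h) + ∑ i, ∑ k, F k i * pd i (pd k h) = 0 := by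
  rw [Finset.sum_comm (f := fun i k => F k i * pd i (pd k h)), ← Finset.sum_add_distrib]
  refine Finset.sum_eq_zero fun i _ => ?_
  rw [← Finset.sum_add_distrib]
  refine Finset.sum_eq_zero fun k _ => ?_
  rw [pd_pd k i]; simp

theorem der_der (P Q : Fin N → Gr N) (h : Gr N) :
    der P (der Q h) = ∑ i, ∑ k, P i * pd i (Q k) * pd k h +
      ∑ i, ∑ k, P i * inv N (Q k) * pd i (pd k h) := by
  simp only [der, map_sum, pd_mul, mul_add, Finset.mul_sum, Finset.sum_add_distrib, mul_assoc]

theorem der_wBracket_apply (P Q : Fin N → Gr N) (h : Gr N) :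
    der (wBracket P Q) h = ∑ i, ∑ k, P i * pd i (Q k) * pd k h +
      ∑ j, ∑ k, pd j (inv N (P k)) * Q j * pd k h := by
  simp only [der, wBracket, add_mul, Finset.sum_add_distrib, Finset.sum_mul]
  congr 1
  · exact Finset.sum_comm
  · exact Finset.sum_comm

theorem der_wBracket (i : ZMod 2) (v w : Gen N) (hv : genInv N v = superSign i 1 • v) (h : Gr N) :
    der (wBracket v.1 w.1) h = der v.1 (der w.1 h) - der (genSgn i w).1 (der v.1 h) := by
  rcases zmod2_cases i with rfl | rfl
  · obtain ⟨hP, -⟩ := gen_even hv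
    rw [genSgn_zero, der_wBracket_apply, der_der, der_der]
    have h1 : ∑ j, ∑ k, pd j (inv N (v.1 k)) * w.1 j * pd k h =
        -∑ j, ∑ k, w.1 j * pd j (v.1 k) * pd k h := by
      simp only [← Finset.sum_neg_distrib]
      refine Finset.sum_congr rfl fun j _ => Finset.sum_congr rfl fun k _ => ?_
      rw [hP, map_neg, neg_mul, even_comm (inv_pd_odd (hP k) j), neg_mul]
    have h2 : ∑ i, ∑ k, v.1 i * inv N (w.1 k) * pd i (pd k h) =
        ∑ i, ∑ k, w.1 i * inv N (v.1 k) * pd i (pd k h) := by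
      have := pd_antisymm (fun i k => w.1 k * v.1 i) h
      rw [add_eq_zero_iff_eq_neg] at this
      simp only [hP, mul_neg, neg_mul, Finset.sum_neg_distrib, ← this]
      refine Finset.sum_congr rfl fun j _ => Finset.sum_congr rfl fun k _ => ?_
      rw [odd_comm (hP j), inv_inv]
    rw [h1, h2]; abel
  · obtain ⟨hP, -⟩ := gen_odd hv
    rw [genSgn_one, der_wBracket_apply, der_der, der_der]
    have h1 : ∑ j, ∑ k, pd j (inv N (v.1 k)) * w.1 j * pd k h =
        ∑ j, ∑ k, inv N (w.1 j) * pd j (v.1 k) * pd k h := by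
      refine Finset.sum_congr rfl fun j _ => Finset.sum_congr rfl fun k _ => ?_
      rw [hP, odd_comm (inv_pd_even (hP k) j)]
    have h2 : ∑ i, ∑ k, v.1 i * inv N (w.1 k) * pd i (pd k h) =
        -∑ i, ∑ k, inv N (w.1 i) * inv N (v.1 k) * pd i (pd k h) := by
      have := pd_antisymm (fun i k => v.1 i * inv N (w.1 k)) h
      rw [add_eq_zero_iff_eq_neg] at this
      rw [this]
      congr 1
      refine Finset.sum_congr rfl fun j _ => Finset.sum_congr rfl fun k _ => ?_
      rw [hP, even_comm (hP k)]
    rw [h1, h2]; simp only [neg_mul, Finset.sum_neg_distrib]; abel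

theorem mul_inv_swap (i : ZMod 2) (v w : Gen N) (hv : genInv N v = superSign i 1 • v)
    (k : Fin N) : v.1 k * inv N w.2 = (genSgn i w).2 * v.1 k := by
  rcases zmod2_cases i with rfl | rfl
  · rw [genSgn_zero, odd_comm ((gen_even hv).1 k), inv_inv]
  · rw [genSgn_one, even_comm ((gen_odd hv).1 k)]

theorem mul_swap (i : ZMod 2) (v w : Gen N) (hv : genInv N v = superSign i 1 • v) :
    v.2 * w.2 = (genSgn i w).2 * v.2 := by
  rcases zmod2_cases i with rfl | rfl
  · rw [genSgn_zero, even_comm (gen_even hv).2]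
  · rw [genSgn_one, odd_comm (gen_odd hv).2]

theorem der_mul (P : Fin N → Gr N) (g h : Gr N) :
    der P (g * h) = der P g * h + ∑ k, P k * inv N g * pd k h := by
  simp only [der, pd_mul, mul_add, Finset.sum_add_distrib, Finset.sum_mul, mul_assoc]

theorem der_mul_left (i : ZMod 2) (v w : Gen N) (hv : genInv N v = superSign i 1 • v) (h : Gr N) :
    der v.1 (w.2 * h) = der v.1 w.2 * h + (genSgn i w).2 * der v.1 h := by
  rw [der_mul, der, der, Finset.mul_sum]
  congr 1
  exact Finset.sum_congr rfl fun k _ => by rw [mul_inv_swap i v w hv, mul_assoc]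

theorem der_sgn_mul (i : ZMod 2) (v w : Gen N) (hv : genInv N v = superSign i 1 • v) (h : Gr N) :
    der (genSgn i w).1 (v.2 * h) = derSwap v.2 w.1 * h + v.2 * der w.1 h := by
  rw [der_mul, der, derSwap, der, Finset.mul_sum]
  rcases zmod2_cases i with rfl | rfl
  · have hf := (gen_even hv).2
    rw [genSgn_zero]
    congr 1
    · congr 1
      exact Finset.sum_congr rfl fun k _ => by
        rw [hf, odd_comm (inv_pd_even hf k), inv_inv]
    · exact Finset.sum_congr rfl fun k _ => by rw [hf, ← even_comm hf, mul_assoc]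
  · have hf := (gen_odd hv).2
    rw [genSgn_one]
    congr 1
    · congr 1
      exact Finset.sum_congr rfl fun k _ => by
        rw [hf, map_neg, neg_mul (pd k v.2), even_comm (inv_pd_odd hf k)]; simp
    · exact Finset.sum_congr rfl fun k _ => by
        rw [hf, ← mul_assoc, odd_comm hf]; simp

/-- Compatibility of the action with the bracket, on generators. -/
theorem act_bracket_gen (l m : ℂ) (i : ZMod 2) (v w : Gen N)
    (hv : genInv N v = superSign i 1 • v) (h : Gr N) :
    act (l + m) (lamEval (wProd N) (C l) (1 ⊗ₜ v) (1 ⊗ₜ w)) (1 ⊗ₜ h) =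
      act l (1 ⊗ₜ v) (act m (1 ⊗ₜ w) (1 ⊗ₜ h)) -
        act m (1 ⊗ₜ genSgn i w) (act l (1 ⊗ₜ v) (1 ⊗ₜ h)) := by
  have e : ∀ (p : ℂ[X]) (x : Gr N), p ⊗ₜ[ℂ] x = p • TensorProduct.mk ℂ ℂ[X] (Gr N) 1 x :=
    fun p x => by rw [TensorProduct.mk_apply, smul_tmul', smul_eq_mul, mul_one]
  have e' : ∀ (p : ℂ[X]) (x : Gen N), p ⊗ₜ[ℂ] x = p • ((1 : ℂ[X]) ⊗ₜ[ℂ] x) :=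
    fun p x => by rw [smul_tmul', smul_eq_mul, mul_one]
  have a1 : ∀ (l : ℂ) (u : Gen N) (x : Gr N), act l (1 ⊗ₜ u) (TensorProduct.mk ℂ ℂ[X] (Gr N) 1 x) =
      TensorProduct.mk ℂ ℂ[X] (Gr N) 1 (der u.1 x) -
        (X + C l : ℂ[X]) • TensorProduct.mk ℂ ℂ[X] (Gr N) 1 (u.2 * x) := by
    intro l u x
    rw [TensorProduct.mk_apply, act, sesq_gen, actGen_apply, e (X + C l)]; rfl
  have a2 : ∀ (l : ℂ) (u : Gen N) (p : ℂ[X]) (x : ℂ[X] ⊗[ℂ] Gr N),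
      act l (1 ⊗ₜ u) (p • x) = p.comp (X + C l) • act l (1 ⊗ₜ u) x :=
    fun l u p x => sesq_smul_right _ _ _ _ _
  have a3 : ∀ (l : ℂ) (p : ℂ[X]) (x : W N) (y : ℂ[X] ⊗[ℂ] Gr N),
      act l (p • x) y = C (eval (-l) p) • act l x y :=
    fun l p x y => by rw [act, sesq_smul_left, C_smul (M := ℂ[X] ⊗[ℂ] Gr N)]
  have d1 : der (fun k => v.2 * w.1 k) h = v.2 * der w.1 h := by
    simp only [der, Finset.mul_sum, mul_assoc]
  have d2 : der (fun k => v.1 k * inv N w.2 + v.2 * w.1 k) h =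
      (genSgn i w).2 * der v.1 h + v.2 * der w.1 h := by
    simp only [der, Finset.mul_sum, add_mul, Finset.sum_add_distrib, mul_inv_swap i v w hv,
      mul_assoc]
  rw [show wProd N = nprodExt (genBr N) from rfl, lamEval_ext_gen, evLam_genBr]
  simp only [genBr₀, genBr₁, LinearMap.mk₂_apply]
  rw [e' X]
  rw [show (1 : ℂ[X]) ⊗ₜ[ℂ] h = TensorProduct.mk ℂ ℂ[X] (Gr N) 1 h from rfl]
  simp only [map_add, map_sub, map_neg, smul_neg, LinearMap.add_apply, LinearMap.sub_apply,
    LinearMap.neg_apply, a1, a2, a3, der_wBracket i v w hv, der_mul_left i v w hv,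
    der_sgn_mul i v w hv, d1, d2, mul_swap i v w hv, sub_mul, smul_mul_assoc, map_smul,
    eval_X, eval_C, add_comp, X_comp, C_comp, mul_assoc, ← C_smul (M := ℂ[X] ⊗[ℂ] Gr N)]
  have hsw : ∀ y, v.2 * (w.2 * y) = (genSgn i w).2 * (v.2 * y) := fun y => by
    rw [← mul_assoc, mul_swap i v w hv, mul_assoc]
  simp only [hsw]
  have c2 : (C 2 : ℂ[X]) = 2 := rfl
  rw [c2]
  module

/-- The map `x ↦ (-1)^{i p(x)} x` on `W_N`. -/
def wSgn (i : ZMod 2) : W N →ₗ[ℂ[X]] W N := if i = 1 then wInv N else LinearMap.id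

theorem wSgn_zero (x : W N) : wSgn 0 x = x := by simp [wSgn]

theorem wSgn_one (x : W N) : wSgn 1 x = wInv N x := by simp [wSgn]

theorem wSgn_gen (i : ZMod 2) (w : Gen N) :
    wSgn i ((1 : ℂ[X]) ⊗ₜ[ℂ] w) = 1 ⊗ₜ genSgn i w := by
  rcases zmod2_cases i with rfl | rfl
  · rw [wSgn_zero, genSgn_zero]
  · rw [wSgn_one, wInv_tmul]; simp [genSgn]

theorem superSign_comm (i j : ZMod 2) : superSign i j = superSign j i := by
  simp only [superSign, and_comm]

theorem superSign_mul_self (i j : ZMod 2) : superSign i j * superSign i j = 1 := by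
  unfold superSign; split_ifs <;> simp

theorem wSgn_of_mem {i j : ZMod 2} {x : W N} (hx : x ∈ wPart N j) :
    wSgn i x = superSign i j • x := by
  rcases zmod2_cases i with rfl | rfl
  · rw [wSgn_zero, superSign_zero_left, one_smul]
  · rw [wSgn_one, superSign_comm, ← mem_wPart]; exact hx

theorem wSgn_wSgn (i j : ZMod 2) (x : W N) : wSgn i (wSgn j x) = wSgn (i + j) x := by
  rcases zmod2_cases i with rfl | rfl <;> rcases zmod2_cases j with rfl | rfl
  · simp [wSgn_zero]
  · simp [wSgn_zero]
  · simp [wSgn_zero]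
  · rw [show (1 : ZMod 2) + 1 = 0 from rfl, wSgn_zero, wSgn_one, wSgn_one, wInv_wInv]

/-- The projection to the part of parity `i`. -/
def wProj (i : ZMod 2) (x : W N) : W N := (2⁻¹ : ℂ) • (x + superSign i 1 • wInv N x)

theorem wProj_of_mem {i : ZMod 2} {x : W N} (hx : x ∈ wPart N i) : wProj i x = x := by
  rw [wProj, mem_wPart.mp hx, smul_smul, superSign_mul_self, one_smul, ← two_smul ℂ x,
    inv_smul_smul₀ two_ne_zero]

theorem wProj_add (i : ZMod 2) (x y : W N) : wProj i (x + y) = wProj i x + wProj i y := by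
  simp only [wProj, map_add, smul_add]; abel

theorem wProj_X (i : ZMod 2) (x : W N) :
    wProj i ((X : ℂ[X]) • x) = (X : ℂ[X]) • wProj i x := by
  simp only [wProj, map_smul, smul_add, smul_comm (X : ℂ[X])]

theorem wProj_gen (i : ZMod 2) (v : Gen N) :
    ∃ u : Gen N, genInv N u = superSign i 1 • u ∧ wProj i ((1 : ℂ[X]) ⊗ₜ[ℂ] v) = 1 ⊗ₜ u := by
  refine ⟨(2⁻¹ : ℂ) • (v + superSign i 1 • genInv N v), ?_, ?_⟩
  · rw [map_smul, map_add, map_smul, genInv_genInv, smul_comm (superSign i 1) (2⁻¹ : ℂ)]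
    congr 1
    rw [smul_add, smul_smul, superSign_mul_self, one_smul, add_comm]
  · rw [wProj, wInv_tmul, ← tmul_smul, ← tmul_add, ← tmul_smul]

theorem act_X_left (l : ℂ) (x : W N) (m : ℂ[X] ⊗[ℂ] Gr N) :
    act l ((X : ℂ[X]) • x) m = -l • act l x m := sesq_X_left _ _ _ _

theorem act_X_right (l : ℂ) (x : W N) (m : ℂ[X] ⊗[ℂ] Gr N) :
    act l x ((X : ℂ[X]) • m) = (X + C l : ℂ[X]) • act l x m := sesq_X_right _ _ _ _

theorem act_smul_left (l : ℂ) (p : ℂ[X]) (x : W N) (m : ℂ[X] ⊗[ℂ] Gr N) :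
    act l (p • x) m = eval (-l) p • act l x m := sesq_smul_left _ _ _ _ _

theorem act_smul_right (l : ℂ) (p : ℂ[X]) (x : W N) (m : ℂ[X] ⊗[ℂ] Gr N) :
    act l x (p • m) = p.comp (X + C l) • act l x m := sesq_smul_right _ _ _ _ _

/-- The value at `λ = t` of the `λ`-bracket of `W_N`. -/
def wBr (t : ℂ[X]) (x y : W N) : W N := lamEval (wProd N) t x y

theorem wBr_add_left (t : ℂ[X]) (x x' y : W N) : wBr t (x + x') y = wBr t x y + wBr t x' y :=
  lamEval_ext_add_left _ _ _ _ _

theorem wBr_add_right (t : ℂ[X]) (x y y' : W N) : wBr t x (y + y') = wBr t x y + wBr t x y' :=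
  lamEval_ext_add_right _ _ _ _ _

theorem wBr_X_left (t : ℂ[X]) (x y : W N) : wBr t ((X : ℂ[X]) • x) y = -(t • wBr t x y) :=
  lamEval_ext_X_left _ _ _ _

theorem wBr_X_right (t : ℂ[X]) (x y : W N) :
    wBr t x ((X : ℂ[X]) • y) = ((X : ℂ[X]) + t) • wBr t x y :=
  lamEval_ext_X_right _ _ _ _

theorem wBr_gen (t : ℂ[X]) (v w : Gen N) :
    wBr t (1 ⊗ₜ v) (1 ⊗ₜ w) = genBr₀ N v w + t • genBr₁ N v w :=
  (lamEval_ext_gen _ _ _ _).trans (evLam_genBr _ _ _)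

theorem wBr_smul_right (t : ℂ[X]) (c : ℂ) (x y : W N) : wBr t x (c • y) = c • wBr t x y := by
  simp only [wBr, show wProd N = nprodExt (genBr N) from rfl, lamEval_nprodExt, map_smul]

theorem wBr_smul_left (t : ℂ[X]) (c : ℂ) (x y : W N) : wBr t (c • x) y = c • wBr t x y := by
  simp only [wBr, show wProd N = nprodExt (genBr N) from rfl, lamEval_nprodExt, map_smul,
    LinearMap.smul_apply]

theorem act_wBr_proj (l m : ℂ) (i : ZMod 2) (x y : W N) (z : ℂ[X] ⊗[ℂ] Gr N) :
    act (l + m) (wBr (C l) (wProj i x) y) z =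
      act l (wProj i x) (act m y z) - act m (wSgn i y) (act l (wProj i x) z) := by
  induction x using dInduction with
  | gen v =>
    obtain ⟨u, hu, e⟩ := wProj_gen i v
    rw [e]
    induction y using dInduction with
    | gen w =>
      rw [wSgn_gen]
      induction z using dInduction with
      | gen h => exact act_bracket_gen l m i u w hu h
      | add z z' hz hz' => simp only [map_add, hz, hz']; abel
      | hX z hz =>
        simp only [hz, act_smul_right, add_comp, X_comp, C_comp, C_add]
        rw [smul_sub]
        congr 2 <;> ring
    | add y y' hy hy' =>
      simp only [wBr_add_right, map_add, LinearMap.add_apply, hy, hy']; abel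
    | hX y hy =>
      rw [wBr_X_right, act_smul_left, hy, act_X_left, map_smul, map_smul, act_X_left]
      simp only [eval_add, eval_X, eval_C]
      module
  | add x x' hx hx' =>
    simp only [wProj_add, wBr_add_left, map_add, LinearMap.add_apply, hx, hx']; abel
  | hX x hx =>
    rw [wProj_X, wBr_X_left, map_neg, LinearMap.neg_apply, act_smul_left, hx, act_X_left,
      act_X_left, map_smul, eval_C]
    module

theorem act_wBr (l m : ℂ) {i : ZMod 2} {x : W N} (hx : x ∈ wPart N i) (y : W N)
    (z : ℂ[X] ⊗[ℂ] Gr N) :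
    act (l + m) (wBr (C l) x y) z = act l x (act m y z) - act m (wSgn i y) (act l x z) := by
  have := act_wBr_proj l m i x y z
  rwa [wProj_of_mem hx] at this

theorem genBr_genInv (t : ℂ[X]) (v w : Gen N) :
    wInv N (genBr₀ N v w + t • genBr₁ N v w) =
      genBr₀ N (genInv N v) (genInv N w) + t • genBr₁ N (genInv N v) (genInv N w) := by
  simp only [genBr₀, genBr₁, LinearMap.mk₂_apply, map_add, map_sub, map_neg, map_smul, wInv_tmul]
  congr 3
  · refine Prod.ext (funext fun k => ?_) ?_
    · simp [genInv, wBracket, inv_mul, inv_pd, inv_inv, add_comm]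
    · simp [genInv, der, derSwap, inv_mul, inv_pd, inv_inv]
  · refine Prod.ext (funext fun k => ?_) ?_
    · simp [genInv, inv_mul]
    · simp [genInv, inv_mul]
  · congr 2
    refine Prod.ext (funext fun k => ?_) ?_
    · simp [genInv, inv_mul, add_comm]
    · simp [genInv, inv_mul]

theorem wInv_wBr (t : ℂ[X]) (x y : W N) : wInv N (wBr t x y) = wBr t (wInv N x) (wInv N y) := by
  induction x using dInduction with
  | gen v =>
    induction y using dInduction with
    | gen w => rw [wBr_gen, wInv_tmul, wInv_tmul, wBr_gen, genBr_genInv]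
    | add y y' hy hy' => simp only [wBr_add_right, map_add, hy, hy']
    | hX y hy => rw [wBr_X_right, map_smul, map_smul, wBr_X_right, hy]
  | add x x' hx hx' => simp only [wBr_add_left, map_add, hx, hx']
  | hX x hx => rw [wBr_X_left, map_neg, map_smul, map_smul, wBr_X_left, hx]

theorem wSgn_wBr (i : ZMod 2) (t : ℂ[X]) (x y : W N) :
    wSgn i (wBr t x y) = wBr t (wSgn i x) (wSgn i y) := by
  rcases zmod2_cases i with rfl | rfl
  · simp only [wSgn_zero]
  · simp only [wSgn_one, wInv_wBr]

theorem wBr_mem (t : ℂ[X]) {i j : ZMod 2} {x y : W N} (hx : x ∈ wPart N i) (hy : y ∈ wPart N j) :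
    wBr t x y ∈ wPart N (i + j) := by
  rw [mem_wPart, wInv_wBr, mem_wPart.mp hx, mem_wPart.mp hy, wBr_smul_left, wBr_smul_right,
    smul_smul, superSign_add]

/-- If all values of `[x_λ y]` lie in a subspace, so do the `n`-th products. -/
theorem wProd_mem (S : Submodule ℂ (W N)) (x y : W N) (h : ∀ l : ℂ, wBr (C l) x y ∈ S) (n : ℕ) :
    wProd N n x y ∈ S := by
  refine S.smul_mem _ (lamCoeff_mem S _ (fun l => ?_) n)
  rw [← lamEval_nprodExt]
  exact h l

theorem act_evLam (k : ℂ) (t : ℂ[X]) (z : ℂ[X] ⊗[ℂ] W N) (m : ℂ[X] ⊗[ℂ] Gr N) :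
    act k (evLam t z) m = act k (evLam (C (eval (-k) t)) z) m := by
  induction z using TensorProduct.induction_on with
  | zero => simp
  | tmul p x =>
    rw [evLam_tmul, evLam_tmul, act_smul_left, act_smul_left]
    congr 1
    induction p using Polynomial.induction_on' with
    | add p q hp hq => simp only [map_add, eval_add, hp, hq]
    | monomial n a => simp [aeval_monomial]
  | add x y hx hy => simp only [map_add, LinearMap.add_apply, hx, hy]

theorem act_wBr_poly (k : ℂ) (t : ℂ[X]) (x y : W N) (m : ℂ[X] ⊗[ℂ] Gr N) :
    act k (wBr t x y) m = act k (wBr (C (eval (-k) t)) x y) m := by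
  simp only [wBr, show wProd N = nprodExt (genBr N) from rfl, lamEval_nprodExt]
  exact act_evLam _ _ _ _

theorem w_skew (l : ℂ) {i j : ZMod 2} {a b : W N} (ha : a ∈ wPart N i) (hb : b ∈ wPart N j) :
    wBr (C l) b a = -(superSign i j • wBr (-C l - X) a b) := by
  rw [← sub_eq_zero, sub_neg_eq_add]
  refine act_faithful fun k m => ?_
  have e1 := act_wBr l (k - l) hb a m
  have e2 := act_wBr (k - l) l ha b m
  rw [add_sub_cancel] at e1
  rw [sub_add_cancel] at e2
  have e3 : eval (-k) (-C l - X : ℂ[X]) = k - l := by simp; ring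
  rw [map_add, map_smul, LinearMap.add_apply, LinearMap.smul_apply, act_wBr_poly k (-C l - X), e3,
    e1, e2, wSgn_of_mem ha, wSgn_of_mem hb, map_smul, map_smul, LinearMap.smul_apply,
    LinearMap.smul_apply, smul_sub, smul_smul, superSign_mul_self, one_smul, superSign_comm j i]
  abel

theorem w_jacobi (l m : ℂ) {i j : ZMod 2} {a b : W N} (c : W N) (ha : a ∈ wPart N i)
    (hb : b ∈ wPart N j) :
    wBr (C l) a (wBr (C m) b c) =
      wBr (C (l + m)) (wBr (C l) a b) c + superSign i j • wBr (C m) b (wBr (C l) a c) := by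
  rw [← sub_eq_zero]
  refine act_faithful fun k z => ?_
  obtain ⟨n, rfl⟩ : ∃ n, k = l + (m + n) := ⟨k - l - m, by ring⟩
  have f1 : ∀ z, act (l + (m + n)) (wBr (C l) a (wBr (C m) b c)) z = _ :=
    fun z => act_wBr l (m + n) ha (wBr (C m) b c) z
  have f2 : ∀ z, act (l + (m + n)) (wBr (C m) b (wBr (C l) a c)) z = _ := fun z =>
    (by rw [show l + (m + n) = m + (l + n) by ring] :
      act (l + (m + n)) (wBr (C m) b (wBr (C l) a c)) z =
        act (m + (l + n)) (wBr (C m) b (wBr (C l) a c)) z).trans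
      (act_wBr m (l + n) hb (wBr (C l) a c) z)
  have f3 : ∀ z, act (l + (m + n)) (wBr (C (l + m)) (wBr (C l) a b) c) z = _ := fun z =>
    (by rw [← add_assoc] : act (l + (m + n)) (wBr (C (l + m)) (wBr (C l) a b) c) z =
        act (l + m + n) (wBr (C (l + m)) (wBr (C l) a b) c) z).trans
      (act_wBr (l + m) n (wBr_mem (C l) ha hb) c z)
  have g1 : ∀ c z, act (m + n) (wBr (C m) b c) z = _ := fun c z => act_wBr m n hb c z
  have g2 : ∀ c z, act (l + n) (wBr (C l) a c) z = _ := fun c z => act_wBr l n ha c z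
  have g3 : ∀ z, act (l + m) (wBr (C l) a b) z = _ := fun z => act_wBr l m ha b z
  rw [map_sub, map_add, map_smul, LinearMap.sub_apply, LinearMap.add_apply, LinearMap.smul_apply,
    f1, f2, f3, wSgn_wBr, wSgn_wBr, wSgn_of_mem hb, wSgn_of_mem ha, wBr_smul_left, wBr_smul_left,
    map_smul, map_smul, LinearMap.smul_apply, LinearMap.smul_apply, g1, g1, g2, g2, g3, g3,
    wSgn_of_mem hb, wSgn_wSgn, wSgn_wSgn, superSign_comm j i, add_comm j i]
  simp only [map_sub, map_smul, LinearMap.smul_apply, smul_sub, smul_smul, superSign_mul_self,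
    one_smul]
  abel

instance : LieConformalSuperalgebra (W N) where
  part := wPart N
  isCompl_part := wPart_isCompl N
  nprod := wProd N
  nprod_mem n _ _ _ _ ha hb :=
    wProd_mem ((wPart N _).restrictScalars ℂ) _ _ (fun l => wBr_mem (C l) ha hb) n
  locality := nprodExt_locality (genBr N)
  sesqui_left l a b := (wBr_X_left (C l) a b).trans (by rw [C_smul (M := W N)]; rfl)
  sesqui_right l a b := wBr_X_right (C l) a b
  skew l _ _ _ _ ha hb := w_skew l ha hb
  jacobi l m _ _ _ _ c ha hb := w_jacobi l m c ha hb

/-! ### Subalgebras -/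

/-- A (graded) subalgebra of a Lie conformal superalgebra. -/
structure ConformalSubalgebra (R : Type*) [AddCommGroup R] [Module ℂ R] [Module ℂ[X] R]
    [IsScalarTower ℂ ℂ[X] R] [LieConformalSuperalgebra R] where
  carrier : Submodule ℂ[X] R
  nprod_mem : ∀ (n : ℕ) {a b : R}, a ∈ carrier → b ∈ carrier →
    LieConformalSuperalgebra.nprod n a b ∈ carrier
  graded : ∀ a ∈ carrier, ∃ a₀ ∈ carrier, ∃ a₁ ∈ carrier,
    a₀ ∈ LieConformalSuperalgebra.part 0 ∧ a₁ ∈ LieConformalSuperalgebra.part 1 ∧ a = a₀ + a₁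

section Subalgebra

open LieConformalSuperalgebra

variable {R : Type*} [AddCommGroup R] [Module ℂ R] [Module ℂ[X] R]
  [IsScalarTower ℂ ℂ[X] R] [LieConformalSuperalgebra R]

/-- The restriction of the `n`-th product to a subalgebra. -/
def ConformalSubalgebra.prod (S : ConformalSubalgebra R) (n : ℕ) :
    S.carrier →ₗ[ℂ] S.carrier →ₗ[ℂ] S.carrier :=
  LinearMap.mk₂ ℂ (fun a b => ⟨nprod n (a : R) (b : R), S.nprod_mem n a.2 b.2⟩)
    (fun a a' b => Subtype.ext (by simp))
    (fun c a b => Subtype.ext (by simp))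
    (fun a b b' => Subtype.ext (by simp))
    (fun c a b => Subtype.ext (by simp))

theorem ConformalSubalgebra.coe_lamEval (S : ConformalSubalgebra R) (t : ℂ[X]) (a b : S.carrier) :
    ((lamEval S.prod t a b : S.carrier) : R) = lamEval nprod t (a : R) (b : R) :=
  AddMonoidHom.map_finsum_of_injective S.carrier.subtype.toAddMonoidHom
    Subtype.val_injective _

instance (S : ConformalSubalgebra R) : LieConformalSuperalgebra S.carrier where
  part i := (part i).comap S.carrier.subtype
  isCompl_part := by
    have h := isCompl_part (R := R)
    constructor
    · rw [Submodule.disjoint_def]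
      intro x h0 h1
      exact Subtype.ext ((Submodule.disjoint_def.mp h.disjoint) x h0 h1)
    · rw [codisjoint_iff, eq_top_iff]
      rintro ⟨x, hx⟩ -
      obtain ⟨a, ha, b, hb, ha0, hb1, rfl⟩ := S.graded x hx
      exact Submodule.mem_sup.mpr ⟨⟨a, ha⟩, ha0, ⟨b, hb⟩, hb1, rfl⟩
  nprod := S.prod
  nprod_mem n _ _ _ _ ha hb := nprod_mem (R := R) n ha hb
  locality a b := by
    obtain ⟨m, hm⟩ := locality (a : R) (b : R)
    exact ⟨m, fun n hn => Subtype.ext (hm n hn)⟩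
  sesqui_left l a b := Subtype.ext (by
    simpa [S.coe_lamEval] using sesqui_left l (a : R) (b : R))
  sesqui_right l a b := Subtype.ext (by
    simpa [S.coe_lamEval] using sesqui_right l (a : R) (b : R))
  skew l _ _ _ _ ha hb := Subtype.ext (by
    simpa [S.coe_lamEval] using skew (R := R) l ha hb)
  jacobi l m _ _ _ _ c ha hb := Subtype.ext (by
    simpa [S.coe_lamEval] using jacobi (R := R) l m (c : R) ha hb)

end Subalgebra

/-! ### The Lie conformal superalgebras `S_{N,a}` and `S̃_N` -/

/-- The divergence `∑ᵢ (-1)^{p(Pᵢ)} ∂ᵢ Pᵢ` of the derivation part `∑ᵢ Pᵢ ∂ᵢ` of a generator. -/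
def divGen (N : ℕ) : Gen N →ₗ[ℂ] Gr N where
  toFun v := ∑ i, pd i (inv N (v.1 i))
  map_add' v w := by simp [Finset.sum_add_distrib]
  map_smul' c v := by simp [Finset.smul_sum]

/-- The coefficient `f` of `D = ∑ᵢ Pᵢ(∂, ξ) ∂ᵢ + f(∂, ξ) ∈ W_N`. -/
def coeffF (N : ℕ) : W N →ₗ[ℂ[X]] ℂ[X] ⊗[ℂ] Gr N :=
  (LinearMap.snd ℂ (Fin N → Gr N) (Gr N)).baseChange ℂ[X]

/-- The divergence `div D = ∑ᵢ (-1)^{p(Pᵢ)} ∂ᵢ Pᵢ - ∂ f` of `D = ∑ᵢ Pᵢ(∂, ξ) ∂ᵢ + f(∂, ξ)`. -/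
def div (N : ℕ) : W N →ₗ[ℂ[X]] ℂ[X] ⊗[ℂ] Gr N :=
  (divGen N).baseChange ℂ[X] - (X : ℂ[X]) • coeffF N

/-- The deformed divergence `div_a D = div D + a f`. -/
def divA (N : ℕ) (a : ℂ) : W N →ₗ[ℂ[X]] ℂ[X] ⊗[ℂ] Gr N := div N + (C a : ℂ[X]) • coeffF N

/-- Left multiplication by `u ∈ Λ(N)` on `W(N) ⊕ Λ(N)`. -/
def mulGen (u : Gr N) : Gen N →ₗ[ℂ] Gen N where
  toFun v := (fun k => u * v.1 k, u * v.2)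
  map_add' v w := by ext <;> simp [mul_add]
  map_smul' c v := by ext <;> simp

/-- Multiplication by `1 + ξ₁ ⋯ ξ_N` on `W_N`. -/
def mulTop (N : ℕ) : W N →ₗ[ℂ[X]] W N := (mulGen (1 + xiTop N)).baseChange ℂ[X]

/-- The map `D ↦ div_a D + ∑ᵢ Pᵢ ∂ᵢ ω`. -/
def divTw (ω : Gr N) (a : ℂ) : W N →ₗ[ℂ[X]] ℂ[X] ⊗[ℂ] Gr N :=
  divA N a + LinearMap.baseChange ℂ[X]
    { toFun := fun v : Gen N => der v.1 ω
      map_add' := fun v w => by simp [der, add_mul, Finset.sum_add_distrib]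
      map_smul' := fun c v => by simp [der, Finset.smul_sum] }

/-- The constant term of `divTw`. -/
def dvGen (ω : Gr N) (a : ℂ) (v : Gen N) : Gr N := divGen N v + a • v.2 + der v.1 ω

theorem divTw_gen (ω : Gr N) (a : ℂ) (v : Gen N) :
    divTw ω a ((1 : ℂ[X]) ⊗ₜ[ℂ] v) = 1 ⊗ₜ dvGen ω a v - (X : ℂ[X]) • 1 ⊗ₜ v.2 := by
  simp only [divTw, divA, div, coeffF, LinearMap.add_apply, LinearMap.sub_apply,
    LinearMap.smul_apply, LinearMap.baseChange_tmul, LinearMap.coe_mk,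
    LinearMap.snd_apply, dvGen, tmul_add, tmul_smul, C_smul (M := ℂ[X] ⊗[ℂ] Gr N)]
  abel

/-- On generators, `(-1)^{p(h)p(w)}` times the action of `w` on `h` at `-λ - ∂`. -/
def coactGen (N : ℕ) (l : ℂ) : Gr N →ₗ[ℂ] Gen N →ₗ[ℂ] ℂ[X] ⊗[ℂ] Gr N :=
  LinearMap.mk₂ ℂ (fun h w => (1 : ℂ[X]) ⊗ₜ[ℂ] (derSwap h w.1 + l • (h * w.2)))
    (by intro h h' w; rw [← tmul_add]; congr 1
        simp [derSwap, add_mul, Finset.sum_add_distrib]; abel)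
    (by intro c h w; rw [← tmul_smul]; congr 1
        simp [derSwap, Finset.smul_sum, smul_comm c l])
    (by intro h w w'; rw [← tmul_add]; congr 1
        simp [derSwap, mul_add, Finset.sum_add_distrib]; abel)
    (by intro c h w; rw [← tmul_smul]; congr 1
        simp [derSwap, Finset.smul_sum, smul_comm c l])

theorem dvGen_B (ω : Gr N) (a : ℂ) (f g : Gr N) (Q : Fin N → Gr N) :
    dvGen ω a (fun k => f * Q k, f * g) = f * dvGen ω a (Q, g) + derSwap f Q := by
  simp only [dvGen, divGen, derSwap, der, LinearMap.coe_mk, AddHom.coe_mk, inv_mul, pd_mul,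
    inv_inv, Finset.sum_add_distrib, mul_add, Finset.mul_sum, mul_smul_comm, mul_assoc]
  abel

theorem dvGen_C {ω : Gr N} (hω : inv N ω = ω) (a : ℂ) (P : Fin N → Gr N) (f g : Gr N) :
    dvGen ω a (fun k => P k * inv N g, f * g) = dvGen ω a (P, f) * g + der P g := by
  have h : ∀ k, inv N g * pd k ω = pd k ω * g := fun k => (odd_comm (inv_pd_even hω k) g).symm
  simp only [dvGen, divGen, der, LinearMap.coe_mk, AddHom.coe_mk, inv_mul, pd_mul,
    inv_inv, Finset.sum_add_distrib, add_mul, Finset.sum_mul, smul_mul_assoc, mul_assoc, h]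
  abel

theorem div_wBracket (P Q : Fin N → Gr N) :
    ∑ k, pd k (inv N (wBracket P Q k)) =
      der P (∑ k, pd k (inv N (Q k))) - derSwap (∑ k, pd k (inv N (P k))) Q := by
  have e1 : ∀ k i, pd k (inv N (P i * pd i (Q k))) =
      P i * pd i (pd k (inv N (Q k))) - pd k (inv N (P i)) * pd i (inv N (Q k)) := by
    intro k i
    rw [inv_mul, inv_pd, mul_neg, map_neg, pd_mul, inv_inv, pd_pd k i]; simp; abel
  have e2 : ∀ k j, pd k (inv N (pd j (inv N (P k)) * Q j)) =
      pd j (pd k (P k)) * inv N (Q j) + pd j (inv N (P k)) * pd k (inv N (Q j)) := by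
    intro k j
    rw [inv_mul, inv_pd, inv_inv, neg_mul, map_neg, pd_mul, inv_pd, pd_pd k j]; simp [add_comm]
  simp only [wBracket, map_add, map_sum, e1, e2, der, derSwap, Finset.sum_add_distrib,
    Finset.sum_sub_distrib, inv_pd, inv_inv, map_neg, neg_mul, Finset.sum_neg_distrib,
    Finset.mul_sum, Finset.sum_mul]
  rw [Finset.sum_comm (f := fun k i => P i * pd i (pd k (inv N (Q k)))),
    Finset.sum_comm (f := fun k i => pd k (inv N (P i)) * pd i (inv N (Q k))),
    Finset.sum_comm (f := fun k j => pd j (pd k (P k)) * inv N (Q j))]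
  abel

theorem der_wBracket_omega {ω : Gr N} (hω : inv N ω = ω) (P Q : Fin N → Gr N) :
    der (wBracket P Q) ω = der P (der Q ω) - derSwap (der P ω) Q := by
  have h1 : derSwap (der P ω) Q =
      -∑ j, ∑ k, pd j (inv N (P k)) * Q j * pd k ω -
        ∑ i, ∑ k, P k * inv N (Q i) * pd i (pd k ω) := by
    simp only [derSwap, der, map_sum, Finset.sum_mul, ← Finset.sum_neg_distrib,
      ← Finset.sum_sub_distrib]
    refine Finset.sum_congr rfl fun i _ => Finset.sum_congr rfl fun k _ => ?_
    have ho := inv_pd_even hω k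
    have he := inv_pd_odd ho i
    rw [inv_mul, ho, mul_neg, map_neg, pd_mul, inv_inv, neg_mul, add_mul, mul_assoc,
      odd_comm ho, inv_inv, mul_assoc, even_comm he, mul_assoc, mul_assoc]
    abel
  have h2 := pd_antisymm (fun i k => P i * inv N (Q k)) ω
  rw [der_wBracket_apply, der_der, h1, eq_neg_of_add_eq_zero_left h2]
  abel

theorem dvGen_A {ω : Gr N} (hω : inv N ω = ω) (a : ℂ) (v w : Gen N) :
    dvGen ω a (wBracket v.1 w.1, der v.1 w.2 - derSwap v.2 w.1) =
      der v.1 (dvGen ω a w) - derSwap (dvGen ω a v) w.1 := by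
  have d1 : ∀ x y, der v.1 (x + y) = der v.1 x + der v.1 y := fun x y => by
    simp [der, mul_add, Finset.sum_add_distrib]
  have d2 : ∀ x, der v.1 (a • x) = a • der v.1 x := fun x => by
    simp [der, Finset.smul_sum]
  have s1 : ∀ x y, derSwap (x + y) w.1 = derSwap x w.1 + derSwap y w.1 := fun x y => by
    simp [derSwap, add_mul, Finset.sum_add_distrib]
  have s2 : ∀ x, derSwap (a • x) w.1 = a • derSwap x w.1 := fun x => by
    simp [derSwap, Finset.smul_sum]
  simp only [dvGen, d1, d2, s1, s2, smul_sub, der_wBracket_omega hω, divGen, LinearMap.coe_mk,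
    AddHom.coe_mk, div_wBracket]
  abel

theorem dvGen_sub (ω : Gr N) (a : ℂ) (v w : Gen N) :
    dvGen ω a (v - w) = dvGen ω a v - dvGen ω a w := by
  simp [dvGen, der, sub_mul, Finset.sum_sub_distrib, smul_sub]; abel

theorem divTw_wBr {ω : Gr N} (hω : inv N ω = ω) (a l : ℂ) (x y : W N) :
    divTw ω a (wBr (C l) x y) =
      act l x (divTw ω a y) - sesq l (coactGen N l) (divTw ω a x) y := by
  induction x using dInduction with
  | gen v =>
    induction y using dInduction with
    | gen w =>
      have e : ∀ (p : ℂ[X]) (x : Gr N), p ⊗ₜ[ℂ] x = p • ((1 : ℂ[X]) ⊗ₜ[ℂ] x) :=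
        fun p x => by rw [smul_tmul', smul_eq_mul, mul_one]
      have e' : ∀ (p : ℂ[X]) (x : Gen N), p ⊗ₜ[ℂ] x = p • ((1 : ℂ[X]) ⊗ₜ[ℂ] x) :=
        fun p x => by rw [smul_tmul', smul_eq_mul, mul_one]
      have a1 : ∀ x : Gr N, act l (1 ⊗ₜ v) (1 ⊗ₜ x) =
          (1 : ℂ[X]) ⊗ₜ[ℂ] der v.1 x - (X + C l : ℂ[X]) • (1 : ℂ[X]) ⊗ₜ[ℂ] (v.2 * x) := by
        intro x
        rw [act, sesq_gen, actGen_apply, e (X + C l)]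
      have a2 : ∀ (x : Gr N), sesq l (coactGen N l) (1 ⊗ₜ x) (1 ⊗ₜ w) =
          (1 : ℂ[X]) ⊗ₜ[ℂ] derSwap x w.1 + (C l : ℂ[X]) • (1 : ℂ[X]) ⊗ₜ[ℂ] (x * w.2) := by
        intro x
        rw [sesq_gen, C_smul (M := ℂ[X] ⊗[ℂ] Gr N), ← tmul_smul, ← tmul_add]; rfl
      have hB := dvGen_B ω a v.2 w.2 w.1
      have hC : dvGen ω a (fun k => v.1 k * inv N w.2 + v.2 * w.1 k, (2 : ℂ) • (v.2 * w.2)) =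
          dvGen ω a v * w.2 + der v.1 w.2 + (v.2 * dvGen ω a w + derSwap v.2 w.1) := by
        rw [← dvGen_C hω a v.1 v.2 w.2, ← hB, ← sub_eq_iff_eq_add, ← dvGen_sub]
        congr 1
        refine Prod.ext (funext fun k => ?_) ?_
        · simp
        · simp [two_smul]
      rw [wBr_gen]
      simp only [genBr₀, genBr₁, LinearMap.mk₂_apply]
      rw [e' X]
      simp only [map_add, map_sub, map_smul, map_neg, divTw_gen, dvGen_A hω, hB, hC, a1, a2,
        LinearMap.sub_apply, act_smul_right, sesq_X_left, X_comp, tmul_add, tmul_sub, tmul_smul,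
        ← C_smul (M := ℂ[X] ⊗[ℂ] Gr N)]
      have c2 : (C 2 : ℂ[X]) = 2 := rfl
      rw [c2]
      module
    | add y y' hy hy' => simp only [wBr_add_right, map_add, hy, hy']; abel
    | hX y hy =>
      simp only [wBr_X_right, map_smul, hy, act_X_right, sesq_X_right]
      module
  | add x x' hx hx' => simp only [wBr_add_left, map_add, hx, hx', LinearMap.add_apply]; abel
  | hX x hx =>
    simp only [wBr_X_left, map_neg, map_smul, hx, act_X_left, sesq_X_left,
      ← C_smul (M := ℂ[X] ⊗[ℂ] Gr N)]
    module

theorem divTw_wInv {ω : Gr N} (hω : inv N ω = ω) (a : ℂ) (x : W N) :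
    divTw ω a (wInv N x) = (inv N).baseChange ℂ[X] (divTw ω a x) := by
  induction x using dInduction with
  | gen v =>
    rw [wInv_tmul, divTw_gen, divTw_gen, map_sub, map_smul, LinearMap.baseChange_tmul,
      LinearMap.baseChange_tmul]
    congr 2
    simp only [dvGen, divGen, genInv, der, LinearMap.coe_mk, AddHom.coe_mk, map_add, map_sum,
      map_smul, inv_mul, inv_pd, inv_inv, hω, map_neg, mul_neg, neg_mul]
  | add x y hx hy => simp only [map_add, hx, hy]
  | hX x hx => simp only [map_smul, hx]

/-- The subalgebra of `W_N` cut out by `divTw ω a`. -/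
def kerSub (ω : Gr N) (hω : inv N ω = ω) (a : ℂ) (K : Submodule ℂ[X] (W N))
    (hK : ∀ x, x ∈ K ↔ divTw ω a x = 0) : ConformalSubalgebra (W N) where
  carrier := K
  nprod_mem n x y hx hy := by
    refine wProd_mem (K.restrictScalars ℂ) x y (fun l => ?_) n
    rw [Submodule.restrictScalars_mem, hK, divTw_wBr hω, (hK x).mp hx, (hK y).mp hy]
    simp
  graded x hx := by
    have hτ : wInv N x ∈ K := by rw [hK, divTw_wInv hω, (hK x).mp hx, map_zero]
    refine ⟨_, ?_, _, ?_, half_add_mem x, half_sub_mem x, w_decomp x⟩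
    · exact (K.restrictScalars ℂ).smul_mem _ (K.add_mem hx hτ)
    · exact (K.restrictScalars ℂ).smul_mem _ (K.sub_mem hx hτ)

/-- `S_{N,a} = {D ∈ W_N | div_a D = 0}`. -/
def SAlg (N : ℕ) (a : ℂ) : ConformalSubalgebra (W N) :=
  kerSub 0 (map_zero _) a (LinearMap.ker (divA N a)) (fun x => by
    have h : divTw (0 : Gr N) a x = divA N a x := by
      induction x using dInduction with
      | gen v =>
        rw [divTw, LinearMap.add_apply, LinearMap.baseChange_tmul]
        simp [der]
      | add x y hx hy => simp only [map_add, hx, hy]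
      | hX x hx => simp only [map_smul, hx]
    rw [LinearMap.mem_ker, h])

theorem inv_xiTop (hN : Even N) : inv N (xiTop N) = xiTop N := by
  have h : ∀ l : List (Gr N), (∀ x ∈ l, inv N x = -x) →
      inv N l.prod = (-1 : ℂ) ^ l.length • l.prod := by
    intro l
    induction l with
    | nil => intro _; simp [inv_one]
    | cons x l ih =>
      intro hl
      rw [List.prod_cons, inv_mul, hl x (by simp), ih (fun y hy => hl y (by simp [hy])),
        List.length_cons, pow_succ]
      simp
  rw [xiTop, h, List.length_ofFn, hN.neg_one_pow, one_smul]
  intro x hx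
  rw [List.mem_ofFn] at hx
  obtain ⟨i, rfl⟩ := hx
  exact inv_ι _

theorem xi_mul_xiTop (i : Fin N) : xi i * xiTop N = 0 := by
  have h : xi i * xiTop N =
      ExteriorAlgebra.ιMulti ℂ (N + 1) (Fin.cons (Pi.single i 1) fun j => Pi.single j 1) := by
    rw [ExteriorAlgebra.ιMulti_succ_apply, ExteriorAlgebra.ιMulti_apply]; rfl
  rw [h]
  exact AlternatingMap.map_eq_zero_of_eq _ _ (i := 0) (j := i.succ) (by simp)
    (Fin.succ_ne_zero i).symm

theorem xiTop_mul_self (hN : N ≠ 0) : xiTop N * xiTop N = 0 := by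
  obtain ⟨n, rfl⟩ := Nat.exists_eq_succ_of_ne_zero hN
  have h : ∀ l : List (Fin (n + 1)), l ≠ [] → (l.map xi).prod * xiTop (n + 1) = 0 := by
    intro l
    induction l with
    | nil => intro h; exact absurd rfl h
    | cons i l ih =>
      intro _
      rw [List.map_cons, List.prod_cons, mul_assoc]
      by_cases hl : l = []
      · subst hl; simp [xi_mul_xiTop]
      · rw [ih hl, mul_zero]
  have e : xiTop (n + 1) = ((List.finRange (n + 1)).map xi).prod := by
    rw [xiTop, List.ofFn_eq_map]
  nth_rewrite 1 [e]
  exact h _ (by simp [List.finRange_succ])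

theorem div_mulTop (hN : Even N) (x : W N) :
    div N (mulTop N x) = (LinearMap.mulLeft ℂ (1 + xiTop N)).baseChange ℂ[X]
      (divTw (xiTop N) 0 x) := by
  have hω := inv_xiTop hN
  have h0 : ∀ k : Fin N, xiTop N * pd k (xiTop N) = 0 := by
    intro k
    have h := congrArg (pd k) (xiTop_mul_self (N := N) (by have := k.2; omega))
    rw [pd_mul, hω, map_zero, odd_comm (inv_pd_even hω k), hω, ← two_smul ℂ] at h
    exact (smul_eq_zero.mp h).resolve_left two_ne_zero
  induction x using dInduction with
  | gen v =>
    have e : div N (mulTop N ((1 : ℂ[X]) ⊗ₜ[ℂ] v)) =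
        1 ⊗ₜ divGen N (mulGen (1 + xiTop N) v) - (X : ℂ[X]) • 1 ⊗ₜ ((1 + xiTop N) * v.2) := rfl
    rw [e, divTw_gen, map_sub, map_smul, LinearMap.baseChange_tmul, LinearMap.baseChange_tmul,
      LinearMap.mulLeft_apply, LinearMap.mulLeft_apply]
    congr 2
    have e1 : inv N (1 + xiTop N) = 1 + xiTop N := by rw [map_add, inv_one, hω]
    have e2 : ∀ k : Fin N, pd k (1 + xiTop N) = pd k (xiTop N) := fun k => by
      rw [map_add, pd_one, zero_add]
    have e3 : ∀ k : Fin N, (1 + xiTop N) * (v.1 k * pd k (xiTop N)) = v.1 k * pd k (xiTop N) := by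
      intro k
      rw [add_mul, one_mul, ← mul_assoc, even_comm hω, mul_assoc, h0, mul_zero, add_zero]
    simp only [dvGen, divGen, mulGen, der, LinearMap.coe_mk, AddHom.coe_mk, inv_mul, e1, pd_mul,
      e2, Finset.sum_add_distrib, zero_smul, add_zero, mul_add, Finset.mul_sum, e3]
    rw [add_comm]
    congr 1
    exact Finset.sum_congr rfl fun k _ => by rw [odd_comm (inv_pd_even hω k), inv_inv]
  | add x y hx hy => simp only [map_add, hx, hy]
  | hX x hx => simp only [map_smul, hx]

theorem mem_ker_div_mulTop (hN : Even N) (x : W N) :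
    x ∈ LinearMap.ker (div N ∘ₗ mulTop N) ↔ divTw (xiTop N) 0 x = 0 := by
  rw [LinearMap.mem_ker, LinearMap.comp_apply, div_mulTop hN]
  refine ⟨fun h => ?_, fun h => by rw [h, map_zero]⟩
  rcases Nat.eq_zero_or_pos N with rfl | hpos
  · have e : xiTop 0 = 1 := by simp [xiTop]
    rw [e] at h ⊢
    have h2 := congrArg ((LinearMap.mulLeft ℂ ((2⁻¹ : ℂ) • (1 : Gr 0))).baseChange ℂ[X]) h
    rw [map_zero, ← LinearMap.comp_apply, ← LinearMap.baseChange_comp, ← LinearMap.mulLeft_mul]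
      at h2
    have e3 : ((2⁻¹ : ℂ) • (1 : Gr 0)) * (1 + 1) = 1 := by
      rw [smul_mul_assoc, one_mul, ← two_smul ℂ (1 : Gr 0), inv_smul_smul₀ two_ne_zero]
    rw [e3, LinearMap.mulLeft_one, LinearMap.baseChange_id] at h2
    exact h2
  · have h2 := congrArg ((LinearMap.mulLeft ℂ (1 - xiTop N)).baseChange ℂ[X]) h
    rw [map_zero, ← LinearMap.comp_apply, ← LinearMap.baseChange_comp, ← LinearMap.mulLeft_mul]
      at h2
    have e3 : (1 - xiTop N) * (1 + xiTop N) = 1 := by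
      rw [sub_mul, one_mul, mul_add, mul_one, xiTop_mul_self (by omega)]; abel
    rw [e3, LinearMap.mulLeft_one, LinearMap.baseChange_id] at h2
    exact h2

/-- `S̃_N = {D ∈ W_N | div ((1 + ξ₁ ⋯ ξ_N) D) = 0}`, for even `N`. -/
def STildeAlg (N : ℕ) (hN : Even N) : ConformalSubalgebra (W N) :=
  kerSub (xiTop N) (inv_xiTop hN) 0 (LinearMap.ker (div N ∘ₗ mulTop N))
    (fun x => mem_ker_div_mulTop hN x)

/-! ### Central extensions -/

section CentralExtensions

open LieConformalSuperalgebra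

/-- Homomorphisms of Lie conformal superalgebras. -/
structure IsConformalHom {R S : Type*} [AddCommGroup R] [Module ℂ R] [Module ℂ[X] R]
    [IsScalarTower ℂ ℂ[X] R] [LieConformalSuperalgebra R] [AddCommGroup S] [Module ℂ S]
    [Module ℂ[X] S] [IsScalarTower ℂ ℂ[X] S] [LieConformalSuperalgebra S]
    (f : R →ₗ[ℂ[X]] S) : Prop where
  map_part : ∀ (i : ZMod 2) (a : R), a ∈ part i → f a ∈ part i
  map_nprod : ∀ (n : ℕ) (a b : R), f (nprod n a b) = nprod n (f a) (f b)

/-- `0 → K → S → R → 0` is a central extension of `R` by `K`: a short exact sequence of Lie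
conformal superalgebras, split as a sequence of (graded) `ℂ[∂]`-modules, in which `K` is central
in `S` and `∂` acts on `K` by zero. -/
structure IsCentralExtension {K S R : Type*} [AddCommGroup K] [Module ℂ K] [Module ℂ[X] K]
    [IsScalarTower ℂ ℂ[X] K] [LieConformalSuperalgebra K] [AddCommGroup S] [Module ℂ S]
    [Module ℂ[X] S] [IsScalarTower ℂ ℂ[X] S] [LieConformalSuperalgebra S] [AddCommGroup R]
    [Module ℂ R] [Module ℂ[X] R] [IsScalarTower ℂ ℂ[X] R] [LieConformalSuperalgebra R]
    (ι : K →ₗ[ℂ[X]] S) (π : S →ₗ[ℂ[X]] R) : Prop where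
  hom_ι : IsConformalHom ι
  hom_π : IsConformalHom π
  injective : Function.Injective ι
  exact : Function.Exact ι π
  surjective : Function.Surjective π
  split : ∃ s : R →ₗ[ℂ[X]] S, (∀ (i : ZMod 2) (a : R), a ∈ part i → s a ∈ part i) ∧
    π ∘ₗ s = LinearMap.id
  central : ∀ (n : ℕ) (k : K) (x : S), nprod n (ι k) x = 0
  X_smul : ∀ k : K, (X : ℂ[X]) • k = 0

/-- `R` has no non-trivial central extensions: for every central extension `0 → K → S → R → 0`
there is a section `R → S` which is a homomorphism of Lie conformal superalgebras; equivalently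
the extension is equivalent to the direct sum `K ⊕ R`. -/
def HasOnlyTrivialCentralExtensions.{u, v, w} (R : Type u) [AddCommGroup R] [Module ℂ R]
    [Module ℂ[X] R] [IsScalarTower ℂ ℂ[X] R] [LieConformalSuperalgebra R] : Prop :=
  ∀ (K : Type v) (S : Type w) [AddCommGroup K] [Module ℂ K] [Module ℂ[X] K]
    [IsScalarTower ℂ ℂ[X] K] [LieConformalSuperalgebra K] [AddCommGroup S] [Module ℂ S]
    [Module ℂ[X] S] [IsScalarTower ℂ ℂ[X] S] [LieConformalSuperalgebra S]
    (ι : K →ₗ[ℂ[X]] S) (π : S →ₗ[ℂ[X]] R), IsCentralExtension ι π →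
    ∃ σ : R →ₗ[ℂ[X]] S, IsConformalHom σ ∧ π ∘ₗ σ = LinearMap.id

end CentralExtensions

/-- The subquotient `Z / (Z ∩ B)` of a vector space. -/
abbrev Subquotient {V : Type*} [AddCommGroup V] [Module ℂ V] (Z B : Submodule ℂ V) : Type _ :=
  Z ⧸ B.submoduleOf Z

/-! ### The second reduced cohomology

`C̃ⁿ(R)` is the space of basic `n`-cochains with trivial coefficients, `ℂ`-multilinear maps
`γ_{λ₁,…,λₙ}(a₁,…,aₙ)` with values in `ℂ[λ₁,…,λₙ]` which are sesquilinear and skew-symmetric in the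
super sense; `∂` acts on it as multiplication by `λ₁ + ⋯ + λₙ`. The reduced complex is
`C̃(R) / ∂ C̃(R)`. -/

section Cohomology

open LieConformalSuperalgebra

variable (R : Type*) [AddCommGroup R] [Module ℂ R] [Module ℂ[X] R] [IsScalarTower ℂ ℂ[X] R]
  [LieConformalSuperalgebra R]

/-- `C̃¹(R)`. -/
def Cochain₁ : Submodule ℂ (R →ₗ[ℂ] MvPolynomial (Fin 1) ℂ) where
  carrier := {φ | ∀ a, φ ((X : ℂ[X]) • a) = -(MvPolynomial.X 0 * φ a)}
  add_mem' hφ hψ a := by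
    rw [LinearMap.add_apply, hφ a, hψ a, LinearMap.add_apply]; ring
  zero_mem' a := by simp
  smul_mem' c φ hφ a := by
    rw [LinearMap.smul_apply, hφ a, LinearMap.smul_apply, mul_smul_comm, smul_neg]

/-- `C̃²(R)`. -/
def Cochain₂ : Submodule ℂ (R →ₗ[ℂ] R →ₗ[ℂ] MvPolynomial (Fin 2) ℂ) where
  carrier := {γ |
    (∀ a b, γ ((X : ℂ[X]) • a) b = -(MvPolynomial.X 0 * γ a b)) ∧
    (∀ a b, γ a ((X : ℂ[X]) • b) = -(MvPolynomial.X 1 * γ a b)) ∧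
    (∀ (i j : ZMod 2) (a b : R), a ∈ part i → b ∈ part j →
      γ b a = -(superSign i j • MvPolynomial.rename (Equiv.swap 0 1) (γ a b)))}
  add_mem' := by
    rintro γ δ ⟨h1, h2, h3⟩ ⟨k1, k2, k3⟩
    refine ⟨fun a b => ?_, fun a b => ?_, fun i j a b ha hb => ?_⟩
    · simp only [LinearMap.add_apply, h1, k1]; ring
    · simp only [LinearMap.add_apply, h2, k2]; ring
    · simp only [LinearMap.add_apply, h3 i j a b ha hb, k3 i j a b ha hb, map_add, smul_add]; ring
  zero_mem' := by simp
  smul_mem' := by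
    rintro c γ ⟨h1, h2, h3⟩
    refine ⟨fun a b => ?_, fun a b => ?_, fun i j a b ha hb => ?_⟩
    · simp only [LinearMap.smul_apply, h1, mul_smul_comm, smul_neg]
    · simp only [LinearMap.smul_apply, h2, mul_smul_comm, smul_neg]
    · simp only [LinearMap.smul_apply, h3 i j a b ha hb, map_smul, smul_neg, smul_comm c]

/-- `C̃³(R)`. -/
def Cochain₃ : Submodule ℂ (R →ₗ[ℂ] R →ₗ[ℂ] R →ₗ[ℂ] MvPolynomial (Fin 3) ℂ) where
  carrier := {β |
    (∀ a b c, β ((X : ℂ[X]) • a) b c = -(MvPolynomial.X 0 * β a b c)) ∧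
    (∀ a b c, β a ((X : ℂ[X]) • b) c = -(MvPolynomial.X 1 * β a b c)) ∧
    (∀ a b c, β a b ((X : ℂ[X]) • c) = -(MvPolynomial.X 2 * β a b c)) ∧
    (∀ (i j : ZMod 2) (a b c : R), a ∈ part i → b ∈ part j →
      β b a c = -(superSign i j • MvPolynomial.rename (Equiv.swap 0 1) (β a b c))) ∧
    (∀ (j k : ZMod 2) (a b c : R), b ∈ part j → c ∈ part k →
      β a c b = -(superSign j k • MvPolynomial.rename (Equiv.swap 1 2) (β a b c)))}
  add_mem' := by
    rintro γ δ ⟨h1, h2, h3, h4, h5⟩ ⟨k1, k2, k3, k4, k5⟩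
    refine ⟨fun a b c => ?_, fun a b c => ?_, fun a b c => ?_, fun i j a b c ha hb => ?_,
      fun i j a b c hb hc => ?_⟩
    · simp only [LinearMap.add_apply, h1, k1]; ring
    · simp only [LinearMap.add_apply, h2, k2]; ring
    · simp only [LinearMap.add_apply, h3, k3]; ring
    · simp only [LinearMap.add_apply, h4 i j a b c ha hb, k4 i j a b c ha hb, map_add, smul_add]
      ring
    · simp only [LinearMap.add_apply, h5 i j a b c hb hc, k5 i j a b c hb hc, map_add, smul_add]
      ring
  zero_mem' := by simp
  smul_mem' := by
    rintro r γ ⟨h1, h2, h3, h4, h5⟩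
    refine ⟨fun a b c => ?_, fun a b c => ?_, fun a b c => ?_, fun i j a b c ha hb => ?_,
      fun i j a b c hb hc => ?_⟩
    · simp only [LinearMap.smul_apply, h1, mul_smul_comm, smul_neg]
    · simp only [LinearMap.smul_apply, h2, mul_smul_comm, smul_neg]
    · simp only [LinearMap.smul_apply, h3, mul_smul_comm, smul_neg]
    · simp only [LinearMap.smul_apply, h4 i j a b c ha hb, map_smul, smul_neg, smul_comm r]
    · simp only [LinearMap.smul_apply, h5 i j a b c hb hc, map_smul, smul_neg, smul_comm r]

variable {R}

/-- `f([a_λ b])` for a linear map `f` and a polynomial `λ = l`. -/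
def onBracket {σ : Type*} (f : R →ₗ[ℂ] MvPolynomial σ ℂ) (l : MvPolynomial σ ℂ) (a b : R) :
    MvPolynomial σ ℂ :=
  ∑ᶠ n : ℕ, ((n.factorial : ℂ)⁻¹) • (l ^ n * f (nprod n a b))

theorem onBracket_support {σ : Type*} (f : R →ₗ[ℂ] MvPolynomial σ ℂ) (l : MvPolynomial σ ℂ)
    (a b : R) :
    (Function.support fun n : ℕ =>
      ((n.factorial : ℂ)⁻¹) • (l ^ n * f (nprod n a b))).Finite := by
  obtain ⟨m, hm⟩ := locality a b
  refine (Finset.range m).finite_toSet.subset fun n hn => ?_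
  simp only [Finset.coe_range, Set.mem_Iio]
  by_contra h
  exact hn (by simp [hm n (not_lt.mp h)])

theorem onBracket_add {σ : Type*} (f g : R →ₗ[ℂ] MvPolynomial σ ℂ) (l : MvPolynomial σ ℂ)
    (a b : R) : onBracket (f + g) l a b = onBracket f l a b + onBracket g l a b := by
  rw [onBracket, onBracket, onBracket,
    ← finsum_add_distrib (onBracket_support f l a b) (onBracket_support g l a b)]
  exact finsum_congr fun n => by rw [LinearMap.add_apply, mul_add, smul_add]

theorem onBracket_smul {σ : Type*} (c : ℂ) (f : R →ₗ[ℂ] MvPolynomial σ ℂ) (l : MvPolynomial σ ℂ)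
    (a b : R) : onBracket (c • f) l a b = c • onBracket f l a b := by
  rw [onBracket, onBracket, smul_finsum' c (onBracket_support f l a b)]
  exact finsum_congr fun n => by rw [LinearMap.smul_apply, mul_smul_comm, smul_comm]

/-- The differential `(dφ)_{λ₁,λ₂}(a, b) = -φ_{λ₁+λ₂}([a_{λ₁} b])`. -/
def dOne (φ : R →ₗ[ℂ] MvPolynomial (Fin 1) ℂ) (a b : R) : MvPolynomial (Fin 2) ℂ :=
  -onBracket ((MvPolynomial.aeval ![MvPolynomial.X 0 + MvPolynomial.X 1]).toLinearMap ∘ₗ φ)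
    (MvPolynomial.X 0) a b

/-- The differential
`(dγ)_{λ₁,λ₂,λ₃}(a, b, c) = -γ_{λ₁+λ₂,λ₃}([a_{λ₁} b], c)
  + (-1)^{p(b)p(c)} γ_{λ₁+λ₃,λ₂}([a_{λ₁} c], b)
  - (-1)^{p(a)(p(b)+p(c))} γ_{λ₂+λ₃,λ₁}([b_{λ₂} c], a)`
on elements `a, b, c` of parities `i, j, k`. -/
def dTwo (γ : R →ₗ[ℂ] R →ₗ[ℂ] MvPolynomial (Fin 2) ℂ) (i j k : ZMod 2) (a b c : R) :
    MvPolynomial (Fin 3) ℂ :=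
  -onBracket ((MvPolynomial.aeval
      ![MvPolynomial.X 0 + MvPolynomial.X 1, MvPolynomial.X 2]).toLinearMap ∘ₗ γ.flip c)
      (MvPolynomial.X 0) a b
    + superSign j k • onBracket ((MvPolynomial.aeval
      ![MvPolynomial.X 0 + MvPolynomial.X 2, MvPolynomial.X 1]).toLinearMap ∘ₗ γ.flip b)
      (MvPolynomial.X 0) a c
    - superSign i (j + k) • onBracket ((MvPolynomial.aeval
      ![MvPolynomial.X 1 + MvPolynomial.X 2, MvPolynomial.X 0]).toLinearMap ∘ₗ γ.flip a)
      (MvPolynomial.X 1) b c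

theorem dOne_add (φ ψ : R →ₗ[ℂ] MvPolynomial (Fin 1) ℂ) (a b : R) :
    dOne (φ + ψ) a b = dOne φ a b + dOne ψ a b := by
  simp only [dOne, LinearMap.comp_add, onBracket_add]; ring

theorem dOne_smul (r : ℂ) (φ : R →ₗ[ℂ] MvPolynomial (Fin 1) ℂ) (a b : R) :
    dOne (r • φ) a b = r • dOne φ a b := by
  simp only [dOne, LinearMap.comp_smul, onBracket_smul, smul_neg]

theorem dTwo_add (γ δ : R →ₗ[ℂ] R →ₗ[ℂ] MvPolynomial (Fin 2) ℂ) (i j k : ZMod 2) (a b c : R) :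
    dTwo (γ + δ) i j k a b c = dTwo γ i j k a b c + dTwo δ i j k a b c := by
  have h : ∀ x, (γ + δ).flip x = γ.flip x + δ.flip x := fun x => rfl
  simp only [dTwo, h, LinearMap.comp_add, onBracket_add, smul_add]; ring

theorem dTwo_smul (r : ℂ) (γ : R →ₗ[ℂ] R →ₗ[ℂ] MvPolynomial (Fin 2) ℂ) (i j k : ZMod 2)
    (a b c : R) : dTwo (r • γ) i j k a b c = r • dTwo γ i j k a b c := by
  have h : ∀ x, (r • γ).flip x = r • γ.flip x := fun x => rfl
  simp only [dTwo, h, LinearMap.comp_smul, onBracket_smul, smul_add, smul_sub, smul_neg,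
    smul_comm r]

variable (R)

/-- The reduced `2`-cocycles: `γ ∈ C̃²(R)` with `dγ ∈ ∂ C̃³(R)`. -/
def ReducedZ₂ : Submodule ℂ (R →ₗ[ℂ] R →ₗ[ℂ] MvPolynomial (Fin 2) ℂ) where
  carrier := {γ | γ ∈ Cochain₂ R ∧ ∃ β ∈ Cochain₃ R, ∀ (i j k : ZMod 2) (a b c : R),
    a ∈ part i → b ∈ part j → c ∈ part k → dTwo γ i j k a b c =
      (MvPolynomial.X 0 + MvPolynomial.X 1 + MvPolynomial.X 2) * β a b c}
  add_mem' := by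
    rintro γ δ ⟨hγ, β, hβ, h⟩ ⟨hδ, β', hβ', h'⟩
    refine ⟨add_mem hγ hδ, β + β', add_mem hβ hβ', fun i j k a b c ha hb hc => ?_⟩
    rw [dTwo_add, h i j k a b c ha hb hc, h' i j k a b c ha hb hc]
    simp only [LinearMap.add_apply]; ring
  zero_mem' := by
    refine ⟨zero_mem _, 0, zero_mem _, fun i j k a b c _ _ _ => ?_⟩
    rw [← zero_smul ℂ (0 : R →ₗ[ℂ] R →ₗ[ℂ] MvPolynomial (Fin 2) ℂ), dTwo_smul]; simp
  smul_mem' := by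
    rintro r γ ⟨hγ, β, hβ, h⟩
    refine ⟨Submodule.smul_mem _ r hγ, r • β, Submodule.smul_mem _ r hβ,
      fun i j k a b c ha hb hc => ?_⟩
    rw [dTwo_smul, h i j k a b c ha hb hc]
    simp only [LinearMap.smul_apply, mul_smul_comm]

/-- The representatives of reduced `2`-coboundaries: `dφ + ∂η` with `φ ∈ C̃¹(R)`, `η ∈ C̃²(R)`. -/
def ReducedB₂ : Submodule ℂ (R →ₗ[ℂ] R →ₗ[ℂ] MvPolynomial (Fin 2) ℂ) where
  carrier := {γ | ∃ φ ∈ Cochain₁ R, ∃ η ∈ Cochain₂ R, ∀ a b : R,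
    γ a b = dOne φ a b + (MvPolynomial.X 0 + MvPolynomial.X 1) * η a b}
  add_mem' := by
    rintro γ δ ⟨φ, hφ, η, hη, h⟩ ⟨φ', hφ', η', hη', h'⟩
    refine ⟨φ + φ', add_mem hφ hφ', η + η', add_mem hη hη', fun a b => ?_⟩
    simp only [LinearMap.add_apply, h, h', dOne_add]; ring
  zero_mem' := by
    refine ⟨0, zero_mem _, 0, zero_mem _, fun a b => ?_⟩
    rw [← zero_smul ℂ (0 : R →ₗ[ℂ] MvPolynomial (Fin 1) ℂ), dOne_smul]; simp
  smul_mem' := by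
    rintro r γ ⟨φ, hφ, η, hη, h⟩
    refine ⟨r • φ, Submodule.smul_mem _ r hφ, r • η, Submodule.smul_mem _ r hη, fun a b => ?_⟩
    simp only [LinearMap.smul_apply, h, dOne_smul, smul_add, mul_smul_comm]

/-- The second reduced cohomology `H²(R)` with trivial coefficients. -/
abbrev ReducedH₂ : Type _ :=
  Subquotient (V := R →ₗ[ℂ] R →ₗ[ℂ] MvPolynomial (Fin 2) ℂ) (ReducedZ₂ R) (ReducedB₂ R)

end Cohomology

end LieConf

end

universe v w

namespace LieConf

open Polynomial TensorProduct

noncomputable section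

variable {N : ℕ}

/-! ### Weight vectors of the Grassmann algebra -/

/-! Both kinds of algebra are kernels of a twisted divergence. Let u be an even multiple of ξ₁⋯ξ_N:
u = 0 for S_{N,a}, and u = ξ₁⋯ξ_N with a = 0 for S̃_N. Multiplication by 1 + u, whose inverse is 1 -
u, carries the twisted condition to div_a = 0. Write F^ for the parity involution of F. A Poincaré
lemma for div_a shows that the algebra R is spanned over ℂ[∂] by the potentials `pot j F` = (1 -
u)((∂ - a) F^ ∂ⱼ + ∂ⱼF) and the curls `curl i j F` = (1 - u)(∂ⱼF ∂ᵢ + ∂ᵢF ∂ⱼ) (`mem_spanW`). The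
structure `IsDivFree` records this situation, so that both cases are handled at once.

Both conclusions follow from `IsDivFree.exists_eq_coboundary`: a family α_λ of bilinear maps into a
vector space, satisfying the cocycle identities for the trivial action (`IsCocycle`), has the form
φ([a_λ b]) with φ linear and zero on ∂R. For a central extension with section s, take for α the
K-component of [s(a)_λ s(b)]; adding to s the parity-preserving part of φ turns it into a
homomorphism. For a reduced 2-cocycle γ, take for α the restriction of γ to the line λ₁ + λ₂ = 0; φ
lifts to a 1-cochain ψ because ∂W_N ∩ R = ∂R, and γ + dψ vanishes on that line, hence is divisible
by λ₁ + λ₂.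

To see that α is a coboundary, choose a torus element ∑ cᵢ ξᵢ∂ᵢ with ∑ cᵢ = 0 and c otherwise
generic. It lies in R and acts diagonally at λ = 0 on the spanning elements, so contraction with it
gives a coboundary whose subtraction makes α vanish on the relevant pairs of nonzero total weight
(`exists_normalization`). For `pd i` = (1 - u)∂ᵢ the only remaining partners are, up to scalars,
`pot k (ξᵢξₖ)` and `curl j k (ξᵢξⱼξₖ)`. The values of α on these satisfy a Jacobi relation, a
relation expressing a difference of potentials by a curl, and a symmetry. By `exists_solution` they
are determined by vectors y, x₁, …, x_N, and the coboundary of `constTerm y x` takes exactly these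
values. Subtracting it, which does not spoil the normalization, gives α(`pd i`, ·) = 0.

The elements `pot i G` with G of top degree have the weights of the `pd i`, hence the same possible
partners. There α vanishes by Jacobi identities with `pot j ξⱼ` and with ξₘ∂ₘ - ξₗ∂ₗ. Homogeneous
elements annihilated by α are closed under brackets, and the `pd i` together with the top potentials
generate R (`eq_zero_of_generators`), so α is now zero. -/

theorem pd_xi_mul (i j : Fin N) (F : Gr N) :
    pd i (xi j * F) = (if i = j then F else 0) - xi j * pd i F := by
  rw [xi, pd_ι_mul]
  congr 1
  by_cases h : i = j
  · subst h; simp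
  · simp [h]

theorem pd_xi_mul_self (i : Fin N) (F : Gr N) : pd i (xi i * F) = F - xi i * pd i F := by
  rw [pd_xi_mul, if_pos rfl]

theorem pd_xi_mul_of_ne {i j : Fin N} (h : i ≠ j) (F : Gr N) :
    pd i (xi j * F) = -(xi j * pd i F) := by
  rw [pd_xi_mul, if_neg h, zero_sub]

theorem xi_anticomm (i j : Fin N) : xi i * xi j = -(xi j * xi i) :=
  eq_neg_of_add_eq_zero_left (ExteriorAlgebra.ι_add_mul_swap _ _)

theorem xi_mul_xi_mul (i j : Fin N) (F : Gr N) : xi i * (xi j * F) = -(xi j * (xi i * F)) := by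
  rw [← mul_assoc, xi_anticomm, neg_mul, mul_assoc]

theorem xi_mul_self (i : Fin N) : xi i * xi i = 0 := ExteriorAlgebra.ι_sq_zero _

theorem xi_mul_xi_mul_self (i : Fin N) (F : Gr N) : xi i * (xi i * F) = 0 := by
  rw [← mul_assoc, xi_mul_self, zero_mul]

theorem inv_xi (i : Fin N) : inv N (xi i) = -xi i := inv_ι _

theorem xi_mul_comm (i : Fin N) (F : Gr N) : xi i * F = inv N F * xi i := ι_mul_comm _ _

theorem pd_pd_self (i : Fin N) (F : Gr N) : pd i (pd i F) = 0 := by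
  have h := pd_pd i i F
  rw [eq_neg_iff_add_eq_zero, ← two_smul ℂ] at h
  exact (smul_eq_zero.mp h).resolve_left two_ne_zero

theorem ι_eq_sum (v : Fin N → ℂ) : ExteriorAlgebra.ι ℂ v = ∑ i, v i • xi i := by
  conv_lhs => rw [pi_eq_sum_univ' v]
  rw [map_sum]
  refine Finset.sum_congr rfl fun i _ => ?_
  rw [xi, ← map_smul]

/-- `F` is a multiple of the product of the `ξᵢ`, `i ∈ J`. -/
def IsWt (J : Finset (Fin N)) (F : Gr N) : Prop :=
  (∀ i ∈ J, xi i * F = 0) ∧ ∀ i ∉ J, pd i F = 0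

theorem IsWt.zero (J : Finset (Fin N)) : IsWt J (0 : Gr N) := by simp [IsWt]

theorem IsWt.smul {J : Finset (Fin N)} {F : Gr N} (hF : IsWt J F) (c : ℂ) : IsWt J (c • F) :=
  ⟨fun i hi => by rw [mul_smul_comm, hF.1 i hi, smul_zero],
    fun i hi => by rw [map_smul, hF.2 i hi, smul_zero]⟩

theorem isWt_one : IsWt ∅ (1 : Gr N) := ⟨by simp, fun i _ => pd_one i⟩

theorem IsWt.xi_mul {J : Finset (Fin N)} {F : Gr N} (hF : IsWt J F) {i : Fin N} (hi : i ∉ J) :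
    IsWt (insert i J) (xi i * F) := by
  refine ⟨fun k hk => ?_, fun k hk => ?_⟩
  · rcases Finset.mem_insert.mp hk with rfl | hk
    · exact xi_mul_xi_mul_self _ _
    · rw [xi_mul_xi_mul, hF.1 k hk, mul_zero, neg_zero]
  · rw [Finset.mem_insert, not_or] at hk
    rw [pd_xi_mul_of_ne hk.1, hF.2 k hk.2, mul_zero, neg_zero]

theorem IsWt.pd {J : Finset (Fin N)} {F : Gr N} (hF : IsWt J F) (i : Fin N) :
    IsWt (J.erase i) (pd i F) := by
  refine ⟨fun k hk => ?_, fun k hk => ?_⟩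
  · rw [Finset.mem_erase] at hk
    have h := pd_xi_mul_of_ne hk.1.symm F
    rw [hF.1 k hk.2, map_zero] at h
    exact neg_eq_zero.mp h.symm
  · rw [Finset.mem_erase, not_and_or, not_not] at hk
    rcases hk with rfl | hk
    · exact pd_pd_self _ _
    · rw [pd_pd, hF.2 k hk, map_zero, neg_zero]

/-- Apply ∂ᵢ to ξᵢF = 0. This is how a variable is split off from a weight vector throughout. -/
theorem IsWt.xi_mul_pd {J : Finset (Fin N)} {F : Gr N} (hF : IsWt J F) {i : Fin N} (hi : i ∈ J) :
    xi i * LieConf.pd i F = F := by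
  have h := pd_xi_mul_self i F
  rw [hF.1 i hi, map_zero] at h
  exact (sub_eq_zero.mp h.symm).symm

theorem IsWt.pd_xi_mul {J : Finset (Fin N)} {F : Gr N} (hF : IsWt J F) {i : Fin N} (hi : i ∉ J) :
    LieConf.pd i (xi i * F) = F := by
  rw [pd_xi_mul_self, hF.2 i hi, mul_zero, sub_zero]

/-- Every element of `Λ(N)` is a sum of weight vectors. -/
theorem wtInduction {p : Gr N → Prop} (wt : ∀ J F, IsWt J F → p F)
    (add : ∀ F G, p F → p G → p (F + G)) (F : Gr N) : p F := by
  have key : F ∈ Submodule.span ℂ {F : Gr N | ∃ J, IsWt J F} := by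
    induction F using CliffordAlgebra.left_induction with
    | algebraMap r =>
      refine Submodule.subset_span ⟨∅, ?_⟩
      have := (isWt_one (N := N)).smul r
      rwa [← Algebra.algebraMap_eq_smul_one] at this
    | add x y hx hy => exact add_mem hx hy
    | ι_mul x v hx =>
      change ExteriorAlgebra.ι ℂ v * x ∈ _
      rw [ι_eq_sum, Finset.sum_mul]
      refine sum_mem fun i _ => ?_
      rw [smul_mul_assoc]
      refine Submodule.smul_mem _ _ ?_
      induction hx using Submodule.span_induction with
      | mem F h =>
        obtain ⟨J, hJ⟩ := h
        by_cases hi : i ∈ J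
        · rw [hJ.1 i hi]; exact zero_mem _
        · exact Submodule.subset_span ⟨_, hJ.xi_mul hi⟩
      | zero => simp
      | add F G _ _ hF hG => rw [mul_add]; exact add_mem hF hG
      | smul c F _ hF => rw [mul_smul_comm]; exact Submodule.smul_mem _ _ hF
  -- The property is not assumed stable under scalars; since weight vectors are, all multiples are
  -- treated at the same time.
  have h2 : ∀ F ∈ Submodule.span ℂ {F : Gr N | ∃ J, IsWt J F}, ∀ c : ℂ, p (c • F) := by
    intro F hF
    induction hF using Submodule.span_induction with
    | mem F h => obtain ⟨J, hJ⟩ := h; exact fun c => wt J _ (hJ.smul c)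
    | zero => exact fun c => by rw [smul_zero]; exact wt ∅ 0 (IsWt.zero _)
    | add F G _ _ hF hG => exact fun c => by rw [smul_add]; exact add _ _ (hF c) (hG c)
    | smul c F _ hF => exact fun d => by rw [smul_smul]; exact hF _
  simpa using h2 F key 1

/-- The composite of the projections `F ↦ ∂ᵢ(ξᵢ F)` over a list of indices. -/
def projOut : List (Fin N) → Gr N → Gr N
  | [], F => F
  | i :: l, F => pd i (xi i * projOut l F)

theorem projOut_add (l : List (Fin N)) (F G : Gr N) :
    projOut l (F + G) = projOut l F + projOut l G := by
  induction l with
  | nil => rfl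
  | cons i l ih => simp only [projOut, ih, mul_add, map_add]

theorem projOut_of_pd_eq_zero {F : Gr N} (hF : ∀ i, pd i F = 0) (l : List (Fin N)) :
    projOut l F = F := by
  induction l with
  | nil => rfl
  | cons i l ih => rw [projOut, ih, pd_xi_mul_self, hF, mul_zero, sub_zero]

/-- The projection for an index j ≠ i passes through left multiplication by ξᵢ, and the one for i
kills its multiples. The vanishing clause is carried along so that later projections in the list
cannot undo it. -/
theorem projOut_xi_mul (l : List (Fin N)) (i : Fin N) (F : Gr N) :
    ∃ G, projOut l (xi i * F) = xi i * G ∧ (i ∈ l → xi i * G = 0) := by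
  induction l with
  | nil => exact ⟨F, rfl, by simp⟩
  | cons j l ih =>
    obtain ⟨G, hG, h0⟩ := ih
    by_cases hij : j = i
    · subst hij
      exact ⟨0, by rw [projOut, hG, xi_mul_xi_mul_self, map_zero, mul_zero], by simp⟩
    · refine ⟨pd j (xi j * G), ?_, ?_⟩
      · rw [projOut, hG, xi_mul_xi_mul, map_neg, pd_xi_mul_of_ne hij, neg_neg]
      · intro hi
        rw [List.mem_cons] at hi
        have h0 := h0 (hi.resolve_left (Ne.symm hij))
        rw [← neg_eq_zero, ← pd_xi_mul_of_ne hij, xi_mul_xi_mul, h0]; simp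

theorem projOut_xi_mul_eq_zero {l : List (Fin N)} {i : Fin N} (hi : i ∈ l) (F : Gr N) :
    projOut l (xi i * F) = 0 := by
  obtain ⟨G, hG, h0⟩ := projOut_xi_mul l i F
  rw [hG, h0 hi]

/-- Elements of weight zero are scalars. -/
theorem IsWt.eq_algebraMap {F : Gr N} (hF : IsWt ∅ F) : ∃ c : ℂ, F = algebraMap ℂ (Gr N) c := by
  -- The composite over all indices projects onto the scalars: it fixes F, which has no derivatives,
  -- and kills every multiple of a generator.
  have h1 : projOut (List.finRange N) F = F := projOut_of_pd_eq_zero (fun i => hF.2 i (by simp)) _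
  have h2 : ∀ F : Gr N, ∃ c : ℂ, projOut (List.finRange N) F = algebraMap ℂ (Gr N) c := by
    intro F
    induction F using CliffordAlgebra.left_induction with
    | algebraMap r => exact ⟨r, projOut_of_pd_eq_zero (fun i => pd_algebraMap i r) _⟩
    | add x y hx hy =>
      obtain ⟨c, hc⟩ := hx
      obtain ⟨d, hd⟩ := hy
      exact ⟨c + d, by rw [projOut_add, hc, hd, map_add]⟩
    | ι_mul x v hx =>
      refine ⟨0, ?_⟩
      change projOut _ (ExteriorAlgebra.ι ℂ v * x) = _
      have h0 : projOut (List.finRange N) (0 : Gr N) = 0 :=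
        projOut_of_pd_eq_zero (fun i => map_zero _) _
      rw [ι_eq_sum, Finset.sum_mul, map_zero]
      refine Finset.sum_induction _ (fun y => projOut (List.finRange N) y = 0)
        (fun x y hx hy => by rw [projOut_add, hx, hy, add_zero]) h0 fun i _ => ?_
      rw [smul_mul_assoc, ← mul_smul_comm]
      exact projOut_xi_mul_eq_zero (List.mem_finRange i) _
  obtain ⟨c, hc⟩ := h2 F
  exact ⟨c, h1.symm.trans hc⟩

theorem IsWt.inv {J : Finset (Fin N)} : ∀ {F : Gr N}, IsWt J F →
    LieConf.inv N F = (-1 : ℂ) ^ J.card • F := by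
  induction J using Finset.induction_on with
  | empty =>
    intro F hF
    obtain ⟨c, rfl⟩ := hF.eq_algebraMap
    rw [Finset.card_empty, pow_zero, one_smul]
    exact AlgHom.commutes (CliffordAlgebra.involute : Gr N →ₐ[ℂ] Gr N) c
  | insert i J hi ih =>
    intro F hF
    have h := hF.pd i
    rw [Finset.erase_insert hi] at h
    have e := hF.xi_mul_pd (Finset.mem_insert_self i J)
    conv_lhs => rw [← e, inv_mul, inv_xi, ih h, mul_smul_comm, neg_mul, e]
    rw [Finset.card_insert_of_notMem hi, pow_succ]; simp

theorem IsWt.isWt_inv {J : Finset (Fin N)} {F : Gr N} (hF : IsWt J F) :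
    IsWt J (LieConf.inv N F) := by
  rw [hF.inv]; exact hF.smul _

/-- The shared variable ξᵢ is split off from F and moved across to G, where it gives zero. -/
theorem IsWt.mul_eq_zero {J J' : Finset (Fin N)} {F G : Gr N} (hF : IsWt J F) (hG : IsWt J' G)
    {i : Fin N} (hi : i ∈ J) (hi' : i ∈ J') : F * G = 0 := by
  rw [← hF.xi_mul_pd hi, xi_mul_comm, mul_assoc, hG.1 i hi', mul_zero]

theorem IsWt.exists_of_pair {i k : Fin N} (h : i ≠ k) {F : Gr N} (hF : IsWt {i, k} F) :
    ∃ c : ℂ, F = c • (xi i * xi k) := by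
  have h1 := (hF.pd i).pd k
  have e : (({i, k} : Finset (Fin N)).erase i).erase k = ∅ := by
    ext x; simp; tauto
  rw [e] at h1
  obtain ⟨c, hc⟩ := h1.eq_algebraMap
  refine ⟨c, ?_⟩
  rw [← hF.xi_mul_pd (show i ∈ _ by simp), ← (hF.pd i).xi_mul_pd (i := k) (by simp [h.symm]), hc,
    Algebra.algebraMap_eq_smul_one]
  simp

theorem IsWt.exists_of_triple {i j k : Fin N} (hij : i ≠ j) (hik : i ≠ k) (hjk : j ≠ k) {F : Gr N}
    (hF : IsWt {i, j, k} F) : ∃ c : ℂ, F = c • (xi i * (xi j * xi k)) := by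
  have h1 := hF.pd i
  have e : (({i, j, k} : Finset (Fin N)).erase i) = {j, k} := by
    ext x; simp; aesop
  rw [e] at h1
  obtain ⟨c, hc⟩ := h1.exists_of_pair hjk
  refine ⟨c, ?_⟩
  rw [← hF.xi_mul_pd (show i ∈ _ by simp), hc, mul_smul_comm]

theorem isWt_xi (i : Fin N) : IsWt {i} (xi i) := by
  have := (isWt_one (N := N)).xi_mul (i := i) (by simp)
  rwa [mul_one] at this

theorem isWt_xi_mul_xi {i j : Fin N} (h : i ≠ j) : IsWt {i, j} (xi i * xi j) :=
  (isWt_xi j).xi_mul (by simpa using h)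

theorem isWt_xi_mul_xi_mul_xi {i j k : Fin N} (hij : i ≠ j) (hik : i ≠ k) (hjk : j ≠ k) :
    IsWt {i, j, k} (xi i * (xi j * xi k)) :=
  (isWt_xi_mul_xi hjk).xi_mul (by simp [hij, hik])

/-- The Euler operator `∑ᵢ cᵢ ξᵢ ∂ᵢ` with coefficients `c`. -/
def eulerOp (c : Fin N → ℂ) : Module.End ℂ (Gr N) :=
  ∑ i, c i • (LinearMap.mulLeft ℂ (xi i) ∘ₗ pd i)

theorem eulerOp_apply (c : Fin N → ℂ) (F : Gr N) : eulerOp c F = ∑ i, c i • (xi i * pd i F) := by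
  simp [eulerOp]

theorem IsWt.eulerOp {J : Finset (Fin N)} {F : Gr N} (hF : IsWt J F) (c : Fin N → ℂ) :
    LieConf.eulerOp c F = (∑ i ∈ J, c i) • F := by
  rw [eulerOp_apply, Finset.sum_smul, ← Finset.sum_subset (Finset.subset_univ J)]
  · exact Finset.sum_congr rfl fun i hi => by rw [hF.xi_mul_pd hi]
  · exact fun i _ hi => by rw [hF.2 i hi, mul_zero, smul_zero]

/-- A function of a diagonalizable operator, prescribed on finitely many eigenvalues. -/
theorem exists_aeval_eigenvector {V : Type*} [AddCommGroup V] [Module ℂ V] (D : Module.End ℂ V)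
    (S : Finset ℂ) (r : ℂ → ℂ) :
    ∃ q : ℂ[X], ∀ w ∈ S, ∀ v : V, D v = w • v → aeval D q v = r w • v := by
  refine ⟨Lagrange.interpolate S id r, fun w hw v hv => ?_⟩
  have h : ∀ q : ℂ[X], aeval D q v = eval w q • v := by
    intro q
    induction q using Polynomial.induction_on' with
    | add p q hp hq => simp [hp, hq, add_smul]
    | monomial n c =>
      have hn : (D ^ n) v = w ^ n • v := by
        induction n with
        | zero => simp
        | succ n ih => rw [pow_succ', Module.End.mul_apply, ih, map_smul, hv, smul_smul, pow_succ]
      simp [aeval_monomial, hn, smul_smul, mul_comm]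
  rw [h]
  congr 1
  exact Lagrange.eval_interpolate_at_node r Function.injective_id.injOn hw

end

end LieConf

namespace LieConf

open Polynomial TensorProduct

noncomputable section

variable {N : ℕ}

/-! ### The `λ`-bracket of `W_N` on elements `A ∂ᵢ` and `f` -/

/-- The element `A ∂ᵢ` of `W_N`. -/
def vecW (i : Fin N) : Gr N →ₗ[ℂ] W N :=
  TensorProduct.mk ℂ ℂ[X] (Gen N) 1 ∘ₗ LinearMap.inl ℂ (Fin N → Gr N) (Gr N) ∘ₗ
    LinearMap.single ℂ (fun _ => Gr N) i

/-- The element `f ∈ Λ(N)` of `W_N`. -/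
def funW : Gr N →ₗ[ℂ] W N :=
  TensorProduct.mk ℂ ℂ[X] (Gen N) 1 ∘ₗ LinearMap.inr ℂ (Fin N → Gr N) (Gr N)

theorem vecW_apply (i : Fin N) (A : Gr N) : vecW i A = 1 ⊗ₜ (Pi.single i A, 0) := rfl

theorem funW_apply (f : Gr N) : funW (N := N) f = 1 ⊗ₜ (0, f) := rfl

theorem sum_single_mul (i : Fin N) (A : Gr N) (g : Fin N → Gr N) :
    ∑ k, (Pi.single i A : Fin N → Gr N) k * g k = A * g i := by
  rw [Finset.sum_eq_single i]
  · simp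
  · intro k _ hk; simp [hk]
  · simp

theorem sum_mul_single (i : Fin N) (A : Gr N) (g : Fin N → Gr N) :
    ∑ k, g k * (Pi.single i A : Fin N → Gr N) k = g i * A := by
  rw [Finset.sum_eq_single i]
  · simp
  · intro k _ hk; simp [hk]
  · simp

theorem map_single (L : Gr N →ₗ[ℂ] Gr N) (j : Fin N) (B : Gr N) (k : Fin N) :
    L ((Pi.single j B : Fin N → Gr N) k) = (Pi.single j (L B) : Fin N → Gr N) k := by
  by_cases h : k = j
  · subst h; simp
  · simp [h]

theorem mul_single_apply (A : Gr N) (j : Fin N) (B : Gr N) (k : Fin N) :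
    A * (Pi.single j B : Fin N → Gr N) k = (Pi.single j (A * B) : Fin N → Gr N) k := by
  by_cases h : k = j
  · subst h; simp
  · simp [h]

theorem single_mul_apply (A : Gr N) (j : Fin N) (B : Gr N) (k : Fin N) :
    (Pi.single j B : Fin N → Gr N) k * A = (Pi.single j (B * A) : Fin N → Gr N) k := by
  by_cases h : k = j
  · subst h; simp
  · simp [h]

theorem wBr_vecW_vecW (t : ℂ[X]) (i j : Fin N) (A B : Gr N) :
    wBr t (vecW i A) (vecW j B) = vecW j (A * pd i B) + vecW i (pd j (inv N A) * B) := by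
  rw [vecW_apply, vecW_apply, wBr_gen]
  have h1 : genBr₁ N (Pi.single i A, 0) (Pi.single j B, 0) = 0 := by
    simp only [genBr₁, LinearMap.mk₂_apply]
    rw [neg_eq_zero, show ((fun k => (Pi.single i A : Fin N → Gr N) k * inv N 0 +
      0 * (Pi.single j B : Fin N → Gr N) k, (2 : ℂ) • ((0 : Gr N) * 0)) : Gen N) = 0 from
        Prod.ext (funext fun k => by simp) (by simp), tmul_zero]
  have h0 : genBr₀ N (Pi.single i A, 0) (Pi.single j B, 0) =
      1 ⊗ₜ (wBracket (Pi.single i A) (Pi.single j B), 0) := by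
    simp only [genBr₀, LinearMap.mk₂_apply]
    rw [show ((fun k => (0 : Gr N) * (Pi.single j B : Fin N → Gr N) k, (0 : Gr N) * 0) : Gen N) = 0
      from Prod.ext (funext fun k => by simp) (by simp), tmul_zero, sub_zero]
    simp [der, derSwap]
  rw [h1, h0, smul_zero, add_zero, vecW_apply, vecW_apply, ← tmul_add]
  congr 1
  refine Prod.ext (funext fun k => ?_) (by simp)
  simp only [wBracket, Prod.mk_add_mk, Pi.add_apply]
  rw [sum_single_mul, sum_mul_single, map_single, map_single, map_single, mul_single_apply,
    single_mul_apply]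

theorem wBr_vecW_funW (t : ℂ[X]) (i : Fin N) (A g : Gr N) :
    wBr t (vecW i A) (funW g) = funW (A * pd i g) - t • vecW i (A * inv N g) := by
  rw [vecW_apply, funW_apply, wBr_gen]
  have h1 : genBr₁ N (Pi.single i A, 0) (0, g) = -vecW i (A * inv N g) := by
    simp only [genBr₁, LinearMap.mk₂_apply, vecW_apply]
    congr 2
    refine Prod.ext (funext fun k => ?_) (by simp)
    simp [single_mul_apply]
  have h0 : genBr₀ N (Pi.single i A, 0) (0, g) = funW (A * pd i g) := by
    have : wBracket (Pi.single i A) (0 : Fin N → Gr N) = 0 := by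
      funext k; simp [wBracket]
    simp only [genBr₀, LinearMap.mk₂_apply, this]
    rw [show ((fun k => (0 : Gr N) * (0 : Fin N → Gr N) k, (0 : Gr N) * g) : Gen N) = 0
      from Prod.ext (funext fun k => by simp) (by simp), tmul_zero, sub_zero]
    simp [der, derSwap, funW_apply, sum_single_mul]
  rw [h1, h0, smul_neg, sub_eq_add_neg]

theorem wBr_funW_vecW (t : ℂ[X]) (j : Fin N) (f B : Gr N) :
    wBr t (funW f) (vecW j B) = -funW (pd j (inv N f) * inv N B) - (X : ℂ[X]) • vecW j (f * B) -
      t • vecW j (f * B) := by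
  rw [vecW_apply, funW_apply, wBr_gen]
  have h1 : genBr₁ N (0, f) (Pi.single j B, 0) = -vecW j (f * B) := by
    simp only [genBr₁, LinearMap.mk₂_apply, vecW_apply]
    congr 2
    refine Prod.ext (funext fun k => ?_) (by simp)
    simp [mul_single_apply]
  have h0 : genBr₀ N (0, f) (Pi.single j B, 0) =
      -funW (pd j (inv N f) * inv N B) - (X : ℂ[X]) • vecW j (f * B) := by
    have h2 : wBracket (0 : Fin N → Gr N) (Pi.single j B) = 0 := by
      funext k; simp [wBracket]
    have h3 : derSwap f (Pi.single j B) = pd j (inv N f) * inv N B := by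
      simp only [derSwap, map_single, sum_mul_single]
    simp only [genBr₀, LinearMap.mk₂_apply, h2, h3, funW_apply, vecW_apply]
    rw [← tmul_neg, smul_tmul', smul_eq_mul, mul_one]
    congr 2
    · simp [der]
    · refine Prod.ext (funext fun k => ?_) (by simp)
      simp [mul_single_apply]
  rw [h1, h0, smul_neg]
  abel

theorem wBr_funW_funW (t : ℂ[X]) (f g : Gr N) :
    wBr t (funW (N := N) f) (funW g) = -((X + 2 * t : ℂ[X]) • funW (f * g)) := by
  rw [funW_apply, funW_apply, wBr_gen]
  have h1 : genBr₁ N (0, f) (0, g) = -((2 : ℂ[X]) • funW (f * g)) := by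
    have h2 : (2 : ℂ[X]) • funW (N := N) (f * g) = (2 : ℂ) • funW (f * g) := by
      rw [← C_smul (M := W N)]; rfl
    rw [h2, ← map_smul]
    simp only [genBr₁, LinearMap.mk₂_apply, funW_apply]
    congr 2
    refine Prod.ext (funext fun k => ?_) (by simp)
    simp
  have h0 : genBr₀ N (0, f) (0, g) = -((X : ℂ[X]) • funW (f * g)) := by
    have h2 : wBracket (0 : Fin N → Gr N) 0 = 0 := by
      funext k; simp [wBracket]
    have h3 : derSwap f (0 : Fin N → Gr N) = 0 := by simp [derSwap]
    simp only [genBr₀, LinearMap.mk₂_apply, h2, h3, funW_apply]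
    rw [smul_tmul', smul_eq_mul, mul_one]
    have h4 : ((0 : Fin N → Gr N), der (0 : Fin N → Gr N) g - 0) = (0 : Gen N) := by simp [der]
    have h5 : ((fun k => f * (0 : Fin N → Gr N) k, f * g) : Gen N) = (0, f * g) := by
      refine Prod.ext (funext fun k => ?_) rfl
      simp
    rw [h4, tmul_zero, zero_sub, h5]
  rw [h1, h0]
  module

theorem wBr_poly_smul_left (q : ℂ[X]) (l : ℂ) (x y : W N) :
    wBr (C l) (q • x) y = (C (eval (-l) q) : ℂ[X]) • wBr (C l) x y := by
  induction q using Polynomial.induction_on with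
  | C a => rw [C_smul (M := W N), wBr_smul_left, eval_C, C_smul (M := W N)]
  | add p q hp hq => rw [add_smul, wBr_add_left, hp, hq, eval_add, C_add, add_smul]
  | monomial n a h =>
    rw [show (C a * X ^ (n + 1) : ℂ[X]) = X * (C a * X ^ n) by ring, mul_smul, wBr_X_left, h,
      eval_mul (p := X), eval_X, smul_smul, ← neg_smul, C_mul, C_neg, neg_mul]

theorem wBr_poly_smul_right (q t : ℂ[X]) (x y : W N) :
    wBr t x (q • y) = (q.comp (X + t) : ℂ[X]) • wBr t x y := by
  induction q using Polynomial.induction_on with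
  | C a => rw [C_smul (M := W N), wBr_smul_right, C_comp, C_smul (M := W N)]
  | add p q hp hq => rw [add_smul, wBr_add_right, hp, hq, add_comp, add_smul]
  | monomial n a h =>
    rw [show (C a * X ^ (n + 1) : ℂ[X]) = X * (C a * X ^ n) by ring, mul_smul, wBr_X_right, h,
      mul_comp (p := X), X_comp, smul_smul]

/-! ### The elements of the twisted divergence-free subalgebras -/

section Elements

variable (u : Gr N) (a : ℂ)

/-- The element `(1 - u) ∂ᵢ`. -/
def pdW (i : Fin N) : W N := vecW i (1 - u)

/-- The element with function part `(1 - u) ∂ⱼF` and derivation part `(1 - u) (∂ - a) F^ ∂ⱼ`. -/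
def potW (j : Fin N) : Gr N →ₗ[ℂ] W N :=
  (Algebra.lsmul ℂ ℂ (W N) (X - C a : ℂ[X])) ∘ₗ vecW j ∘ₗ LinearMap.mulLeft ℂ (1 - u) ∘ₗ inv N +
    funW ∘ₗ LinearMap.mulLeft ℂ (1 - u) ∘ₗ pd j

/-- The divergence-free derivation `(1 - u) (∂ⱼF ∂ᵢ + ∂ᵢF ∂ⱼ)`. -/
def curlW (i j : Fin N) : Gr N →ₗ[ℂ] W N :=
  vecW i ∘ₗ LinearMap.mulLeft ℂ (1 - u) ∘ₗ pd j + vecW j ∘ₗ LinearMap.mulLeft ℂ (1 - u) ∘ₗ pd i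

theorem potW_apply (j : Fin N) (F : Gr N) : potW u a j F =
    (X - C a : ℂ[X]) • vecW j ((1 - u) * inv N F) + funW ((1 - u) * pd j F) := rfl

theorem curlW_apply (i j : Fin N) (F : Gr N) : curlW u i j F =
    vecW i ((1 - u) * pd j F) + vecW j ((1 - u) * pd i F) := rfl

theorem curlW_symm (i j : Fin N) : curlW u i j = curlW u j i := add_comm _ _

variable {u}

/-- `F` has all its terms of degree at least two. -/
structure Deep (u F : Gr N) : Prop where
  mul : u * F = 0
  mul_inv : u * inv N F = 0
  mul_pd : ∀ k, u * pd k F = 0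
  mul_pd_inv : ∀ k, u * pd k (inv N F) = 0
  pd_mul : ∀ k, pd k u * F = 0
  pd_mul_inv : ∀ k, pd k u * inv N F = 0

/-- Two variables are enough: after one differentiation, of u or of F, the two factors still share a
variable. -/
theorem Deep.of_isWt (hu : IsWt Finset.univ u) {J : Finset (Fin N)} {F : Gr N} (hF : IsWt J F)
    (hJ : 2 ≤ J.card) : Deep u F := by
  have key : ∀ G, IsWt J G → u * G = 0 ∧ (∀ k, u * pd k G = 0) ∧ ∀ k, pd k u * G = 0 := by
    intro G hG
    obtain ⟨i, hi⟩ := Finset.card_pos.mp (show 0 < J.card by omega)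
    have h1 : ∀ k, ∃ m, m ∈ J.erase k := fun k =>
      Finset.card_pos.mp (lt_of_lt_of_le (by omega) (Finset.pred_card_le_card_erase (a := k)))
    refine ⟨hu.mul_eq_zero hG (Finset.mem_univ i) hi, fun k => ?_, fun k => ?_⟩
    · obtain ⟨m, hm⟩ := h1 k
      exact hu.mul_eq_zero (hG.pd k) (Finset.mem_univ m) hm
    · obtain ⟨m, hm⟩ := h1 k
      rw [Finset.mem_erase] at hm
      exact (hu.pd k).mul_eq_zero hG (by simp [hm.1]) hm.2
  obtain ⟨h1, h2, h3⟩ := key F hF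
  obtain ⟨k1, k2, k3⟩ := key _ hF.isWt_inv
  exact ⟨h1, k1, h2, k2, h3, k3⟩

/-- In degree at least two the factor 1 - u is invisible, so brackets can be computed as in the
untwisted algebra. -/
theorem Deep.potW {F : Gr N} (hF : Deep u F) (j : Fin N) : potW u a j F =
    (X - C a : ℂ[X]) • vecW j (inv N F) + funW (pd j F) := by
  rw [potW_apply, sub_mul, sub_mul, hF.mul_inv, hF.mul_pd, one_mul, one_mul, sub_zero, sub_zero]

theorem Deep.curlW {F : Gr N} (hF : Deep u F) (i j : Fin N) : curlW u i j F =
    vecW i (pd j F) + vecW j (pd i F) := by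
  rw [curlW_apply, sub_mul, sub_mul, hF.mul_pd, hF.mul_pd, one_mul, one_mul, sub_zero, sub_zero]

/-- At λ = 0 the potential is differentiated. The λ-term collects the shift ∂ ↦ ∂ + λ in the
coefficient ∂ - a and the term -λ of the bracket of a derivation with a function; together they form
a curl. This formula is what generates the algebra from its lowest and highest degrees. -/
theorem wBr_pdW_potW (hu : LieConf.inv N u = u) {F : Gr N} (hF : Deep u F) (l : ℂ) (i j : Fin N) :
    wBr (C l) (pdW u i) (potW u a j F) =
      -potW u a j (pd i F) + (C l : ℂ[X]) • curlW u i j (inv N F) := by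
  have hu1 : inv N (1 - u) = 1 - u := by rw [map_sub, inv_one, hu]
  have e1 : pd j (1 - u) * inv N F = 0 := by
    rw [map_sub, pd_one, zero_sub, neg_mul, hF.pd_mul_inv, neg_zero]
  have e2 : (1 - u) * inv N (pd j F) = -pd j (inv N F) := by
    rw [inv_pd, sub_mul, one_mul, mul_neg, hF.mul_pd_inv, neg_zero, sub_zero]
  have e3 : (1 - u) * pd i (inv N F) = pd i (inv N F) := by
    rw [sub_mul, one_mul, hF.mul_pd_inv, sub_zero]
  have e4 : (1 - u) * pd j (inv N F) = pd j (inv N F) := by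
    rw [sub_mul, one_mul, hF.mul_pd_inv, sub_zero]
  rw [hF.potW, potW_apply, curlW_apply, pdW, wBr_add_right, wBr_poly_smul_right, wBr_vecW_vecW,
    wBr_vecW_funW, hu1, e1, e2, e3, e4, inv_pd, mul_neg, e3, pd_pd i j]
  simp only [map_zero, add_zero, map_neg, mul_neg, sub_comp, X_comp, C_comp, smul_neg]
  module

/-- The fields (1 - u)∂ᵢ fail to commute only through the first derivatives of u, as the products u
∂ₖu vanish. -/
theorem wBr_pdW_pdW (hu : LieConf.inv N u = u) (huu : ∀ k, u * pd k u = 0) (t : ℂ[X])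
    (i j : Fin N) : wBr t (pdW u i) (pdW u j) = -curlW u i j u := by
  have hu1 : inv N (1 - u) = 1 - u := by rw [map_sub, inv_one, hu]
  have e : ∀ k, pd k (1 - u) * u = 0 := fun k => by
    rw [map_sub, pd_one, zero_sub, neg_mul, odd_comm (inv_pd_even hu k), hu, huu, neg_zero]
  rw [pdW, pdW, wBr_vecW_vecW, hu1, curlW_apply, mul_sub, e, mul_one, sub_zero, map_sub, map_sub,
    pd_one, pd_one]
  simp only [zero_sub, mul_neg, map_neg, sub_mul, one_mul, huu, sub_zero]
  abel

/-- The bracket with the element `potW j ξⱼ`, which has function part `1 - u`. -/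
theorem wBr_potW_xi_self (huxi : ∀ k, u * xi k = 0) (hu : LieConf.inv N u = u) {F : Gr N}
    (hF : Deep u F) {J : Finset (Fin N)}
    (hJ : IsWt J F) {j : Fin N} (hj : j ∈ J) (l : ℂ) :
    wBr (C l) (potW u a j (xi j)) (potW u a j F) = -((X + C (2 * l) : ℂ[X]) • potW u a j F) := by
  have hu1 : inv N (1 - u) = 1 - u := by rw [map_sub, inv_one, hu]
  have d : potW u a j (xi j) = (X - C a : ℂ[X]) • vecW j (-xi j) + funW (1 - u) := by
    rw [potW_apply, pd_xi, if_pos rfl, mul_one, inv_xi, mul_neg, sub_mul, huxi, one_mul, sub_zero]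
  have h1 : xi j * pd j (inv N F) = inv N F := hJ.isWt_inv.xi_mul_pd hj
  have h2 : pd j (inv N (-xi j)) = 1 := by rw [map_neg, inv_xi, neg_neg, pd_xi, if_pos rfl]
  have h3 : pd j (1 - u) * inv N (inv N F) = 0 := by
    rw [inv_inv, map_sub, pd_one, zero_sub, neg_mul, hF.pd_mul, neg_zero]
  have h4 : (1 - u) * inv N F = inv N F := by rw [sub_mul, one_mul, hF.mul_inv, sub_zero]
  have h5 : (1 - u) * pd j F = pd j F := by rw [sub_mul, one_mul, hF.mul_pd, sub_zero]
  rw [hF.potW, d, wBr_add_left, wBr_add_right, wBr_add_right, wBr_poly_smul_right,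
    wBr_poly_smul_right, wBr_poly_smul_left, wBr_poly_smul_left, wBr_vecW_vecW, wBr_vecW_funW,
    wBr_funW_vecW, wBr_funW_funW, h2, hu1, h3, h4, h5, pd_pd_self, inv_pd, neg_mul, neg_mul,
    neg_mul, mul_neg, h1]
  have c2 : (C 2 : ℂ[X]) = 2 := rfl
  simp only [map_zero, map_neg, neg_neg, one_mul, mul_zero, sub_comp, X_comp, C_comp, eval_sub,
    eval_X, eval_C, C_sub, C_mul, c2]
  module

/-- Up to sign, `potW u a j (xi j)` acts like a Virasoro element: potentials in the direction j have
conformal weight 2, while those in another direction k have weight 1 and shift -a. This discrepancy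
is what forces cocycle values to vanish in `cocycle_pot_pot`. -/
theorem wBr_potW_xi_of_ne (huxi : ∀ k, u * xi k = 0) (hu : LieConf.inv N u = u) {G : Gr N}
    (hG : Deep u G) {J : Finset (Fin N)}
    (hJ : IsWt J G) {j k : Fin N} (hj : j ∈ J) (hjk : j ≠ k) (l : ℂ) :
    wBr (C l) (potW u a j (xi j)) (potW u a k G) = -((X + C (l - a) : ℂ[X]) • potW u a k G) := by
  have hu1 : inv N (1 - u) = 1 - u := by rw [map_sub, inv_one, hu]
  have d : potW u a j (xi j) = (X - C a : ℂ[X]) • vecW j (-xi j) + funW (1 - u) := by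
    rw [potW_apply, pd_xi, if_pos rfl, mul_one, inv_xi, mul_neg, sub_mul, huxi, one_mul, sub_zero]
  have h1 : xi j * pd j (inv N G) = inv N G := hJ.isWt_inv.xi_mul_pd hj
  have h2 : pd k (inv N (-xi j)) = 0 := by
    rw [map_neg, inv_xi, neg_neg, pd_xi, if_neg hjk.symm]
  have h3 : pd k (1 - u) * inv N (inv N G) = 0 := by
    rw [inv_inv, map_sub, pd_one, zero_sub, neg_mul, hG.pd_mul, neg_zero]
  have h4 : (1 - u) * inv N G = inv N G := by rw [sub_mul, one_mul, hG.mul_inv, sub_zero]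
  have h5 : (1 - u) * pd k G = pd k G := by rw [sub_mul, one_mul, hG.mul_pd, sub_zero]
  have h6 : xi j * pd j (pd k G) = pd k G := (hJ.pd k).xi_mul_pd (by simp [hj, hjk])
  have h7 : xi j * inv N (pd k G) = 0 := (hJ.pd k).isWt_inv.1 j (by simp [hj, hjk])
  rw [hG.potW, d, wBr_add_left, wBr_add_right, wBr_add_right, wBr_poly_smul_right,
    wBr_poly_smul_right, wBr_poly_smul_left, wBr_poly_smul_left, wBr_vecW_vecW, wBr_vecW_funW,
    wBr_funW_vecW, wBr_funW_funW, h2, hu1, h3, h4, h5, neg_mul, neg_mul, neg_mul, h1, h6, h7]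
  have c2 : (C 2 : ℂ[X]) = 2 := rfl
  simp only [map_zero, map_neg, zero_mul, sub_comp, X_comp, C_comp, eval_sub,
    eval_X, eval_C, C_sub, neg_zero]
  module

/-- The bracket with `ξₘ∂ₘ - ξₗ∂ₗ`. -/
theorem curlW_xi_xi (huxi : ∀ k, u * xi k = 0) {l m : Fin N} (h : l ≠ m) :
    curlW u l m (xi l * xi m) = vecW m (xi m) - vecW l (xi l) := by
  rw [curlW_apply, pd_xi_mul_of_ne h.symm, pd_xi_mul_self, pd_xi, pd_xi, if_pos rfl, if_neg h]
  simp only [mul_one, mul_zero, sub_zero, mul_neg, sub_mul, one_mul, huxi, map_neg]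
  abel

theorem wBr_sub_left (t : ℂ[X]) (x x' y : W N) : wBr t (x - x') y = wBr t x y - wBr t x' y := by
  simp only [wBr, show wProd N = nprodExt (genBr N) from rfl, lamEval_nprodExt, map_sub,
    LinearMap.sub_apply]

/-- Since G contains both ξₗ and ξₘ and k is neither index, ξₗ∂ₗ and ξₘ∂ₘ act identically on the
potential for every λ, and their difference acts by zero. -/
theorem wBr_torus_potW_eq_zero (huxi : ∀ k, u * xi k = 0) {G : Gr N} (hG : Deep u G)
    {J : Finset (Fin N)} (hJ : IsWt J G) {l m k : Fin N} (hlm : l ≠ m) (hl : l ∈ J) (hm : m ∈ J)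
    (hlk : l ≠ k) (hmk : m ≠ k) (t : ℂ[X]) :
    wBr t (curlW u l m (xi l * xi m)) (potW u a k G) = 0 := by
  have key : ∀ i, i ∈ J → i ≠ k → wBr t (vecW i (xi i)) (potW u a k G) =
      (X + t - C a : ℂ[X]) • vecW k (inv N G) + funW (pd k G) := by
    intro i hi hik
    have h1 : xi i * pd i (inv N G) = inv N G := hJ.isWt_inv.xi_mul_pd hi
    have h6 : xi i * pd i (pd k G) = pd k G := (hJ.pd k).xi_mul_pd (by simp [hi, hik])
    have h7 : xi i * inv N (pd k G) = 0 := (hJ.pd k).isWt_inv.1 i (by simp [hi, hik])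
    rw [hG.potW, wBr_add_right, wBr_poly_smul_right, wBr_vecW_vecW, wBr_vecW_funW, h1, h6, h7,
      inv_xi, map_neg, pd_xi, if_neg hik.symm]
    simp
  rw [curlW_xi_xi huxi hlm, wBr_sub_left, key m hm hmk, key l hl hlk, sub_self]

/-- The potential has weight zero for ξₘ∂ₘ - ξₗ∂ₗ, so only a λ-term survives. It realizes a curl as
a bracket of a torus element with a potential. -/
theorem wBr_torus_potW_pd (huxi : ∀ k, u * xi k = 0) {F : Gr N} {J : Finset (Fin N)}
    (hJ : IsWt J F) {l m : Fin N} (hG : Deep u (pd l F)) (hF : Deep u (inv N F)) (hlm : l ≠ m)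
    (hl : l ∈ J) (hm : m ∈ J) (t : ℂ[X]) :
    wBr t (curlW u l m (xi l * xi m)) (potW u a m (pd l F)) =
      -(t • curlW u l m (inv N F)) := by
  have e := hJ.isWt_inv
  have h1 : xi m * pd m (inv N (pd l F)) = inv N (pd l F) :=
    (hJ.pd l).isWt_inv.xi_mul_pd (by simp [hm, hlm.symm])
  have h2 : pd l (inv N (pd l F)) = 0 := by rw [inv_pd, map_neg, pd_pd_self, neg_zero]
  have h3 : xi l * inv N (pd m (pd l F)) = -pd m (inv N F) := by
    rw [inv_pd, inv_pd, map_neg, neg_neg, pd_pd, mul_neg, (e.pd m).xi_mul_pd (by simp [hl, hlm])]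
  have h4 : xi m * inv N (pd m (pd l F)) = pd l (inv N F) := by
    rw [inv_pd, inv_pd, map_neg, neg_neg, (e.pd l).xi_mul_pd (by simp [hm, hlm.symm])]
  have h5 : pd l (pd m (pd l F)) = 0 := by rw [pd_pd, pd_pd_self, map_zero, neg_zero]
  rw [curlW_xi_xi huxi hlm, hG.potW, wBr_sub_left, wBr_add_right, wBr_add_right,
    wBr_poly_smul_right, wBr_poly_smul_right, wBr_vecW_vecW, wBr_vecW_vecW, wBr_vecW_funW,
    wBr_vecW_funW, h1, h2, h3, h4, h5, hF.curlW, pd_pd_self, inv_xi, inv_xi, map_neg, map_neg,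
    pd_xi, pd_xi, if_pos rfl, if_neg hlm.symm]
  simp only [mul_zero, map_zero, neg_zero, zero_mul, map_neg, neg_mul, one_mul, add_neg_cancel,
    smul_zero, add_zero, zero_add, smul_neg, zero_sub]
  module

end Elements

end

end LieConf

/-! ### Divergence, parity and vanishing brackets of the special elements -/

namespace LieConf

open Polynomial TensorProduct

noncomputable section

variable {N : ℕ}

theorem one_sub_mul_of_mul_eq_zero {u F : Gr N} (h : u * F = 0) : (1 - u) * F = F := by
  rw [sub_mul, one_mul, h, sub_zero]

/-- An even multiple of `ξ₁ ⋯ ξ_N`. -/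
structure IsEvenTop (u : Gr N) : Prop where
  isWt : IsWt Finset.univ u
  inv : inv N u = u

namespace IsEvenTop

variable {u : Gr N} (hu : IsEvenTop u)

include hu

theorem mul_xi (k : Fin N) : u * xi k = 0 := by
  rw [even_comm hu.inv, hu.isWt.1 k (Finset.mem_univ k)]

theorem mul_self (hN : 2 < N) : u * u = 0 :=
  hu.isWt.mul_eq_zero hu.isWt (Finset.mem_univ ⟨0, by omega⟩) (Finset.mem_univ _)

theorem mul_pd (hN : 2 < N) (k : Fin N) : u * pd k u = 0 := by
  have h := congrArg (LieConf.pd k) (hu.mul_self hN)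
  rw [pd_mul, hu.inv, map_zero, odd_comm (inv_pd_even hu.inv k), hu.inv, ← two_smul ℂ] at h
  exact (smul_eq_zero.mp h).resolve_left two_ne_zero

theorem inv_one_sub : LieConf.inv N (1 - u) = 1 - u := by rw [map_sub, inv_one, hu.inv]

theorem mul_pd_comm (k : Fin N) (F : Gr N) : LieConf.inv N F * pd k u = pd k u * F :=
  (odd_comm (inv_pd_even hu.inv k) F).symm

end IsEvenTop

/-- The element `1 ⊗ f` of `ℂ[∂] ⊗ Λ(N)`. -/
abbrev oneGr : Gr N →ₗ[ℂ] ℂ[X] ⊗[ℂ] Gr N := TensorProduct.mk ℂ ℂ[X] (Gr N) 1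

theorem divTw_vecW (u : Gr N) (a : ℂ) (j : Fin N) (A : Gr N) :
    divTw u a (vecW j A) = oneGr (pd j (inv N A) + A * pd j u) := by
  rw [vecW_apply, divTw_gen, tmul_zero, smul_zero, sub_zero]
  simp only [dvGen, divGen, der, LinearMap.coe_mk, AddHom.coe_mk, smul_zero, add_zero,
    sum_single_mul, map_single]
  congr 2
  rw [Finset.sum_eq_single j]
  · simp
  · intro k _ hk; simp [hk]
  · simp

theorem divTw_funW (u : Gr N) (a : ℂ) (f : Gr N) :
    divTw u a (funW f) = (C a - X : ℂ[X]) • oneGr f := by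
  rw [funW_apply, divTw_gen]
  simp only [dvGen, divGen, der, LinearMap.coe_mk, AddHom.coe_mk, Pi.zero_apply, map_zero,
    Finset.sum_const_zero, zero_mul, zero_add, add_zero, tmul_smul]
  rw [sub_smul (C a : ℂ[X]) X (oneGr f), C_smul (M := ℂ[X] ⊗[ℂ] Gr N)]
  rfl

theorem wInv_vecW (i : Fin N) (A : Gr N) : wInv N (vecW i A) = -vecW i (inv N A) := by
  rw [vecW_apply, wInv_tmul, vecW_apply, ← tmul_neg]
  congr 1
  refine Prod.ext (funext fun k => ?_) ?_
  · simp [genInv, map_single]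
  · simp [genInv]

theorem wInv_funW (f : Gr N) : wInv N (funW f) = funW (inv N f) := by
  rw [funW_apply, wInv_tmul, funW_apply]
  congr 1
  refine Prod.ext (funext fun k => ?_) ?_
  · simp [genInv]
  · simp [genInv]

section Elements

variable {u : Gr N} (hu : IsEvenTop u) (hN : 2 < N) (a : ℂ)

include hu in
theorem wInv_potW (j : Fin N) (F : Gr N) : wInv N (potW u a j F) = -potW u a j (inv N F) := by
  rw [potW_apply, potW_apply, map_add, map_smul, wInv_vecW, wInv_funW, inv_mul, inv_mul,
    hu.inv_one_sub, inv_inv, inv_pd, mul_neg, map_neg, smul_neg, neg_add]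

include hu in
theorem wInv_pdW (i : Fin N) : wInv N (pdW u i) = -pdW u i := by
  rw [pdW, wInv_vecW, hu.inv_one_sub]

include hu in
theorem wInv_curlW (i j : Fin N) (F : Gr N) :
    wInv N (curlW u i j F) = curlW u i j (inv N F) := by
  rw [curlW_apply, curlW_apply, map_add, wInv_vecW, wInv_vecW, inv_mul, inv_mul,
    hu.inv_one_sub, inv_pd, inv_pd, mul_neg, mul_neg, map_neg, map_neg, neg_neg, neg_neg]

include hu hN

theorem divTw_pdW (i : Fin N) : divTw u a (pdW u i) = 0 := by
  rw [pdW, divTw_vecW, hu.inv_one_sub, one_sub_mul_of_mul_eq_zero (hu.mul_pd hN i), map_sub, pd_one]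
  simp

/-- The derivation part contributes (∂ - a) times the function part and the function part
contributes (a - ∂) times itself; the derivative of the factor 1 - u is absorbed by the twist. -/
theorem divTw_potW (j : Fin N) (F : Gr N) : divTw u a (potW u a j F) = 0 := by
  have e : (1 - u) * inv N F * pd j u = pd j u * F := by
    rw [mul_assoc, hu.mul_pd_comm, ← mul_assoc, one_sub_mul_of_mul_eq_zero (hu.mul_pd hN j)]
  rw [potW_apply, map_add, map_smul, divTw_vecW, divTw_funW, inv_mul, inv_inv, hu.inv_one_sub,
    pd_mul, hu.inv_one_sub, e, map_sub, pd_one, zero_sub, neg_mul, neg_add_cancel_comm]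
  module

/-- The two summands contribute mixed second derivatives in opposite orders, and ∂ᵢ, ∂ⱼ anticommute.
-/
theorem divTw_curlW (i j : Fin N) (F : Gr N) : divTw u a (curlW u i j F) = 0 := by
  have e : ∀ k l, pd k (inv N ((1 - u) * pd l F)) + (1 - u) * pd l F * pd k u =
      -((1 - u) * pd k (pd l (inv N F))) := by
    intro k l
    have e1 : pd l F * pd k u = -(pd k u * pd l (inv N F)) := by
      have := hu.mul_pd_comm k (inv N (pd l F))
      rw [inv_inv] at this
      rw [this, inv_pd, mul_neg]
    rw [mul_assoc, e1, mul_neg, ← mul_assoc, one_sub_mul_of_mul_eq_zero (hu.mul_pd hN k), inv_mul,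
      hu.inv_one_sub, inv_pd, mul_neg, map_neg, pd_mul, hu.inv_one_sub, map_sub, pd_one]
    simp
  rw [curlW_apply, map_add, divTw_vecW, divTw_vecW, e, e, pd_pd i j, mul_neg, neg_neg, ← map_add,
    add_neg_cancel, map_zero]

omit hu hN in
-- The derivation terms are products with a common variable. The three function terms are multiples
-- of ∂ⱼF ∂ₖG with coefficients λ + a, ∂ + λ - a and -(∂ + 2λ), which add up to zero.
theorem wBr_potW_potW_eq_zero {F G : Gr N} (hF : Deep u F) (hG : Deep u G)
    {J J' : Finset (Fin N)} (hFJ : IsWt J F) (hGJ : IsWt J' G) {j k : Fin N} (hjk : j ≠ k)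
    (hj : j ∈ J) (hj' : j ∈ J') (hk : k ∈ J) (hk' : k ∈ J') (l : ℂ) :
    wBr (C l) (potW u a j F) (potW u a k G) = 0 := by
  have h1 : inv N F * pd j (inv N G) = 0 :=
    hFJ.isWt_inv.mul_eq_zero (hGJ.isWt_inv.pd j) hk (by simp [hk', hjk.symm])
  have h2 : pd k (inv N (inv N F)) * inv N G = 0 := by
    rw [inv_inv]; exact (hFJ.pd k).mul_eq_zero hGJ.isWt_inv (i := j) (by simp [hj, hjk]) hj'
  have h3 : pd j F * inv N G = 0 :=
    (hFJ.pd j).mul_eq_zero hGJ.isWt_inv (i := k) (by simp [hk, hjk.symm]) hk'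
  have h4 : inv N F * inv N (pd k G) = 0 :=
    hFJ.isWt_inv.mul_eq_zero (hGJ.pd k).isWt_inv hj (by simp [hj', hjk])
  -- Removing both common variables leaves a product that need not vanish; it is compared with ∂ⱼF
  -- ∂ₖG by differentiating a product that is already zero.
  have h5 : inv N F * pd j (pd k G) = -(pd j F * pd k G) := by
    have h : F * pd k G = 0 := hFJ.mul_eq_zero (hGJ.pd k) hj (by simp [hj', hjk])
    have h' := congrArg (pd j) h
    rw [pd_mul, map_zero] at h'
    exact eq_neg_of_add_eq_zero_right h'
  have h6 : pd k (inv N (pd j F)) * inv N (inv N G) = -(pd j F * pd k G) := by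
    have h : inv N (pd j F) * G = 0 :=
      (hFJ.pd j).isWt_inv.mul_eq_zero hGJ (i := k) (by simp [hk, hjk.symm]) hk'
    have h' := congrArg (pd k) h
    rw [pd_mul, map_zero, inv_inv] at h'
    rw [inv_inv]
    exact eq_neg_of_add_eq_zero_left h'
  rw [hF.potW, hG.potW, wBr_add_left, wBr_add_right, wBr_add_right, wBr_poly_smul_right,
    wBr_poly_smul_right, wBr_poly_smul_left, wBr_poly_smul_left, wBr_vecW_vecW, wBr_vecW_funW,
    wBr_funW_vecW, wBr_funW_funW, h1, h2, h3, h4, h5, h6]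
  simp only [map_zero, map_neg, sub_comp, X_comp, C_comp, eval_sub, eval_X, eval_C, C_sub]
  module

end Elements

/-! ### Weights -/

/-- The element `∑ᵢ cᵢ ξᵢ ∂ᵢ`. -/
def torusW (c : Fin N → ℂ) : W N := ∑ i, c i • vecW i (xi i)

theorem wBr_sum_left {ι : Type*} (t : ℂ[X]) (s : Finset ι) (x : ι → W N) (y : W N) :
    wBr t (∑ i ∈ s, x i) y = ∑ i ∈ s, wBr t (x i) y := by
  simp only [wBr, show wProd N = nprodExt (genBr N) from rfl, lamEval_nprodExt, map_sum,
    LinearMap.sum_apply]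

theorem wBr_torusW_vecW (c : Fin N → ℂ) (t : ℂ[X]) (j : Fin N) (B : Gr N) :
    wBr t (torusW c) (vecW j B) = vecW j (eulerOp c B) - c j • vecW j B := by
  have h : ∀ i, wBr t (c i • vecW i (xi i)) (vecW j B) =
      vecW j (c i • (xi i * pd i B)) - if i = j then c j • vecW j B else 0 := by
    intro i
    rw [wBr_smul_left, wBr_vecW_vecW, inv_xi, map_neg, pd_xi]
    by_cases hij : j = i
    · subst hij; simp [smul_add, sub_eq_add_neg]
    · simp [hij, Ne.symm hij]
  rw [torusW, wBr_sum_left, eulerOp_apply, map_sum, Finset.sum_congr rfl fun i _ => h i,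
    Finset.sum_sub_distrib]
  simp

theorem wBr_torusW_funW (c : Fin N → ℂ) (g : Gr N) :
    wBr 0 (torusW c) (funW g) = funW (eulerOp c g) := by
  rw [torusW, wBr_sum_left, eulerOp_apply, map_sum]
  refine Finset.sum_congr rfl fun i _ => ?_
  rw [wBr_smul_left, wBr_vecW_funW, zero_smul, sub_zero, map_smul]

theorem wInv_torusW (c : Fin N → ℂ) : wInv N (torusW c) = torusW c := by
  rw [torusW, map_sum]
  exact Finset.sum_congr rfl fun i _ => by
    rw [wInv_smul, wInv_vecW, inv_xi, map_neg, neg_neg]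

section Elements

variable {u : Gr N} (hu : IsEvenTop u) (a : ℂ) {c : Fin N → ℂ} (hc : ∑ i, c i = 0)

include hu hc

theorem divTw_torusW : divTw u a (torusW c) = 0 := by
  have h : ∀ i, divTw u a (c i • vecW i (xi i)) = c i • oneGr (u - 1) := by
    intro i
    rw [← C_smul (M := W N), map_smul, C_smul (M := ℂ[X] ⊗[ℂ] Gr N), divTw_vecW, inv_xi, map_neg,
      pd_xi, if_pos rfl, hu.isWt.xi_mul_pd (Finset.mem_univ i), neg_add_eq_sub]
  rw [torusW, map_sum, Finset.sum_congr rfl fun i _ => h i, ← Finset.sum_smul, hc, zero_smul]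

/-- The product uB is nonzero only for constant B, and then its weight ∑ cᵢ = 0 is the weight of
constants. So the twist respects weights precisely for the torus elements used here. -/
theorem eulerOp_one_sub_mul {J : Finset (Fin N)} {B : Gr N} (hB : IsWt J B) :
    eulerOp c ((1 - u) * B) = (∑ i ∈ J, c i) • ((1 - u) * B) := by
  have h1 : IsWt Finset.univ (u * B) :=
    ⟨fun i hi => by rw [← mul_assoc, hu.isWt.1 i hi, zero_mul], by simp⟩
  rw [sub_mul, one_mul, map_sub, hB.eulerOp, h1.eulerOp, hc, zero_smul, sub_zero, smul_sub]
  rcases J.eq_empty_or_nonempty with rfl | ⟨i, hi⟩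
  · simp
  · rw [hu.isWt.mul_eq_zero hB (Finset.mem_univ i) hi]; simp

theorem wBr_torusW_pdW (i : Fin N) : wBr 0 (torusW c) (pdW u i) = (-c i) • pdW u i := by
  have h := eulerOp_one_sub_mul hu hc (isWt_one (N := N))
  rw [mul_one, Finset.sum_empty, zero_smul] at h
  rw [pdW, wBr_torusW_vecW, h, map_zero, zero_sub]
  exact (neg_smul (c i) (vecW i (1 - u))).symm

theorem wBr_torusW_potW (j : Fin N) {J : Finset (Fin N)} {F : Gr N} (hF : IsWt J F) :
    wBr 0 (torusW c) (potW u a j F) = (∑ i ∈ J, c i - c j) • potW u a j F := by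
  have h1 : funW (N := N) (eulerOp c ((1 - u) * pd j F)) =
      (∑ i ∈ J, c i - c j) • funW ((1 - u) * pd j F) := by
    by_cases hj : j ∈ J
    · rw [eulerOp_one_sub_mul hu hc (hF.pd j), map_smul, Finset.sum_erase_eq_sub hj]
    · rw [hF.2 j hj]; simp
  rw [potW_apply, wBr_add_right, wBr_poly_smul_right, wBr_torusW_vecW, wBr_torusW_funW, h1,
    eulerOp_one_sub_mul hu hc hF.isWt_inv, map_smul, add_zero, comp_X]
  module

theorem wBr_torusW_curlW (j k : Fin N) {J : Finset (Fin N)} {F : Gr N} (hF : IsWt J F) :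
    wBr 0 (torusW c) (curlW u j k F) = (∑ i ∈ J, c i - c j - c k) • curlW u j k F := by
  have h1 : ∀ j k, wBr 0 (torusW c) (vecW j ((1 - u) * pd k F)) =
      (∑ i ∈ J, c i - c j - c k) • vecW j ((1 - u) * pd k F) := by
    intro j k
    by_cases hk : k ∈ J
    · rw [wBr_torusW_vecW, eulerOp_one_sub_mul hu hc (hF.pd k), map_smul,
        Finset.sum_erase_eq_sub hk]
      module
    · rw [hF.2 k hk, mul_zero, map_zero, smul_zero, ← zero_smul ℂ (0 : W N), wBr_smul_right]
      simp
  rw [curlW_apply, wBr_add_right, h1, h1, smul_add, sub_right_comm]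

end Elements

/-! ### Spanning -/

/-- The `ℂ[∂]`-module spanned by the elements `potW` and `curlW`. -/
def spanW (u : Gr N) (a : ℂ) : Submodule ℂ[X] (W N) :=
  Submodule.span ℂ[X] ((⋃ j, Set.range (potW u a j)) ∪ ⋃ i, ⋃ j, Set.range (curlW u i j))

theorem potW_mem_spanW (u : Gr N) (a : ℂ) (j : Fin N) (F : Gr N) : potW u a j F ∈ spanW u a :=
  Submodule.subset_span (Or.inl (Set.mem_iUnion.mpr ⟨j, F, rfl⟩))

theorem curlW_mem_spanW (u : Gr N) (a : ℂ) (i j : Fin N) (F : Gr N) :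
    curlW u i j F ∈ spanW u a :=
  Submodule.subset_span (Or.inr (Set.mem_iUnion.mpr ⟨i, Set.mem_iUnion.mpr ⟨j, F, rfl⟩⟩))

theorem spanW_induction {u : Gr N} {a : ℂ} {p : W N → Prop}
    (pot : ∀ j J F, IsWt J F → p (potW u a j F))
    (curl : ∀ i j J F, IsWt J F → p (curlW u i j F)) (zero : p 0)
    (add : ∀ x y, p x → p y → p (x + y)) (hX : ∀ x, p x → p ((X : ℂ[X]) • x))
    (hC : ∀ (c : ℂ) x, p x → p (c • x)) {x : W N} (hx : x ∈ spanW u a) : p x := by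
  have hp : ∀ (q : ℂ[X]) x, p x → p (q • x) := by
    intro q x h
    induction q using Polynomial.induction_on with
    | C a => rw [C_smul (M := W N)]; exact hC _ _ h
    | add p q hp hq => rw [add_smul]; exact add _ _ hp hq
    | monomial n a h =>
      rw [show (C a * X ^ (n + 1) : ℂ[X]) = X * (C a * X ^ n) by ring, mul_smul]; exact hX _ h
  have hpot : ∀ j F, p (potW u a j F) := by
    intro j F
    induction F using wtInduction with
    | wt J F hF => exact pot j J F hF
    | add F G hF hG => rw [map_add]; exact add _ _ hF hG
  have hcurl : ∀ i j F, p (curlW u i j F) := by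
    intro i j F
    induction F using wtInduction with
    | wt J F hF => exact curl i j J F hF
    | add F G hF hG => rw [map_add]; exact add _ _ hF hG
  induction hx using Submodule.span_induction with
  | mem x h =>
    rcases h with h | h
    · obtain ⟨j, F, rfl⟩ := Set.mem_iUnion.mp h
      exact hpot j F
    · obtain ⟨i, h⟩ := Set.mem_iUnion.mp h
      obtain ⟨j, F, rfl⟩ := Set.mem_iUnion.mp h
      exact hcurl i j F
  | zero => exact zero
  | add x y _ _ hx hy => exact add _ _ hx hy
  | smul q x _ hx => exact hp q x hx

/-- The degree is the Euler operator with all coefficients 1, with eigenvalues in {0, …, N}, so its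
functions are polynomials in it. In degree N the factor is 0⁻¹ = 0, so T kills the top degree. -/
theorem exists_degree_inverse (N : ℕ) : ∃ T : Module.End ℂ (Gr N), ∀ (J : Finset (Fin N)) (F : Gr N),
    IsWt J F → T F = ((N : ℂ) - J.card)⁻¹ • F := by
  obtain ⟨q, hq⟩ := exists_aeval_eigenvector (eulerOp (N := N) 1)
    ((Finset.range (N + 1)).image fun n : ℕ => (n : ℂ)) fun d => ((N : ℂ) - d)⁻¹
  refine ⟨aeval (eulerOp 1) q, fun J F hF => hq _ ?_ F ?_⟩
  · refine Finset.mem_image_of_mem _ (Finset.mem_range.mpr ?_)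
    have := J.card_le_univ
    rw [Fintype.card_fin] at this
    omega
  · rw [hF.eulerOp]; simp

/-- Each F ↦ ∂ₖ(ξₖF) is the identity minus ξₖ∂ₖ, so the sum counts the variables absent from F. This
is the homotopy formula behind the spanning result. -/
theorem sum_pd_xi_mul {J : Finset (Fin N)} {F : Gr N} (hF : IsWt J F) :
    ∑ k, pd k (xi k * F) = ((N : ℂ) - J.card) • F := by
  have h : ∀ k, pd k (xi k * F) = F - (1 : ℂ) • (xi k * pd k F) := fun k => by
    rw [pd_xi_mul_self, one_smul]
  rw [Finset.sum_congr rfl fun k _ => h k, Finset.sum_sub_distrib]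
  have := hF.eulerOp 1
  rw [eulerOp_apply] at this
  simp only [Pi.one_apply] at this
  rw [this]
  simp [sub_smul, Nat.cast_smul_eq_nsmul]

theorem mk_eq_sum (v : Gen N) :
    (1 : ℂ[X]) ⊗ₜ[ℂ] v = ∑ j, vecW j (v.1 j) + funW (N := N) v.2 := by
  simp only [vecW_apply, funW_apply]
  rw [← tmul_sum, ← tmul_add]
  congr 1
  refine Prod.ext ?_ ?_
  · simp [Prod.fst_sum, Finset.univ_sum_single]
  · simp [Prod.snd_sum]

/-- A Poincaré lemma. An arbitrary x falls into the span after subtracting a chosen preimage of its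
divergence and the top-degree component of its function part. If the divergence is zero, the first
correction is zero, and the second one is too because derivations have no divergence in top degree.
-/
theorem mem_spanW_of_divTw_zero (a : ℂ) {x : W N} (hx : divTw 0 a x = 0) : x ∈ spanW 0 a := by
  obtain ⟨T, hT⟩ := exists_degree_inverse N
  -- The projection onto top degree: below degree N the homotopy formula makes the sum the identity,
  -- and in degree N the map T is zero.
  let τ : Gr N →ₗ[ℂ] Gr N :=
    LinearMap.id - ∑ k, pd k ∘ₗ LinearMap.mulLeft ℂ (xi k) ∘ₗ T
  have hτ : ∀ F, τ F = F - ∑ k, pd k (xi k * T F) := fun F => by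
    simp [τ]
  have hτpd : ∀ k F, τ (pd k F) = 0 := by
    intro k F
    induction F using wtInduction with
    | add F G hF hG => rw [map_add, map_add, hF, hG, add_zero]
    | wt J F hF =>
      by_cases hk : k ∈ J
      · have h := hF.pd k
        have hne : (N : ℂ) - (J.erase k).card ≠ 0 := by
          rw [Finset.card_erase_of_mem hk, sub_ne_zero]
          have h1 := J.card_le_univ
          rw [Fintype.card_fin] at h1
          have h2 := Finset.card_pos.mpr ⟨k, hk⟩
          exact_mod_cast (by omega : N ≠ J.card - 1)
        rw [hτ, hT _ _ h, sum_pd_xi_mul (h.smul _), smul_smul, mul_inv_cancel₀ hne, one_smul,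
          sub_self]
      · rw [hF.2 k hk, map_zero]
  -- A derivation of divergence F whenever F has degree below N; the sign and the involution
  -- compensate those in the definition of the divergence.
  let Yf : Gr N →ₗ[ℂ] W N := -∑ k, vecW k ∘ₗ LinearMap.mulLeft ℂ (xi k) ∘ₗ T ∘ₗ inv N
  have hYf : ∀ F, Yf F = -∑ k, vecW k (xi k * T (inv N F)) := fun F => by simp [Yf]
  let Y : ℂ[X] ⊗[ℂ] Gr N →ₗ[ℂ[X]] W N := Yf.liftBaseChange ℂ[X]
  have hY : ∀ F, Y (oneGr F) = Yf F := fun F => by simp [Y]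
  let Z : ℂ[X] ⊗[ℂ] Gr N →ₗ[ℂ[X]] W N := (funW (N := N)).liftBaseChange ℂ[X]
  have hZ : ∀ F, Z (oneGr F) = funW F := fun F => by simp [Z]
  let τ' : ℂ[X] ⊗[ℂ] Gr N →ₗ[ℂ[X]] ℂ[X] ⊗[ℂ] Gr N := τ.baseChange ℂ[X]
  have hτ' : ∀ F, τ' (oneGr F) = oneGr (τ F) := fun F => rfl
  have hcv : ∀ j A, coeffF N (vecW j A) = 0 := fun j A => by
    simp [coeffF, vecW_apply]
  have hcf : ∀ f, coeffF N (funW f) = oneGr f := fun f => by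
    simp [coeffF, funW_apply]
  have hfun : ∀ f, funW f - Y (divTw 0 a (funW f)) - Z (τ' (coeffF N (funW f))) ∈ spanW 0 a := by
    intro f
    have e : funW f - Y (divTw 0 a (funW f)) - Z (τ' (coeffF N (funW f))) =
        ∑ k, potW 0 a k (xi k * T f) := by
      have hTinv : ∀ F, T (inv N F) = inv N (T F) := by
        intro F
        induction F using wtInduction with
        | add F G hF hG => simp only [map_add, hF, hG]
        | wt J F hF => rw [hF.inv, map_smul, hT J F hF, map_smul, hF.inv, smul_comm]
      rw [divTw_funW, hcf, hτ', hZ, map_smul, hY, hYf, hτ, map_sub, map_sum]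
      simp only [potW_apply, sub_zero, one_mul, Finset.sum_add_distrib, ← Finset.smul_sum, inv_mul,
        inv_xi, neg_mul, map_neg, Finset.sum_neg_distrib, hTinv]
      module
    rw [e]
    exact sum_mem fun k _ => potW_mem_spanW _ _ _ _
  have hvec : ∀ j A, vecW j A - Y (divTw 0 a (vecW j A)) - Z (τ' (coeffF N (vecW j A))) ∈
      spanW 0 a := by
    intro j A
    induction A using wtInduction with
    | add F G hF hG =>
      simp only [map_add]
      convert add_mem hF hG using 1
      abel
    | wt J F hF =>
      rw [hcv, map_zero, map_zero, sub_zero, divTw_vecW, map_zero, mul_zero, add_zero, hY, hYf]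
      by_cases hj : j ∈ J
      · have hB := hF.pd j
        have hne : (N : ℂ) - (J.erase j).card ≠ 0 := by
          rw [Finset.card_erase_of_mem hj, sub_ne_zero]
          have h1 := J.card_le_univ
          rw [Fintype.card_fin] at h1
          have h2 := Finset.card_pos.mpr ⟨j, hj⟩
          exact_mod_cast (by omega : N ≠ J.card - 1)
        -- The curl in the directions j, k of -ξⱼξₖ∂ⱼF is ξⱼ∂ₖ(ξₖ∂ⱼF) ∂ⱼ - ξₖ∂ⱼF ∂ₖ. Summed over k,
        -- the homotopy formula turns the first terms into a multiple of F ∂ⱼ, and the second terms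
        -- are the correction.
        have e : vecW j F - -∑ k, vecW k (xi k * T (inv N (pd j (inv N F)))) =
            ((N : ℂ) - (J.erase j).card)⁻¹ • ∑ k, curlW 0 j k (-(xi j * (xi k * pd j F))) := by
          have e1 : ∀ k, curlW 0 j k (-(xi j * (xi k * pd j F))) =
              vecW j (xi j * pd k (xi k * pd j F)) - vecW k (xi k * pd j F) := by
            intro k
            by_cases hk : k = j
            · subst hk
              rw [xi_mul_xi_mul_self, neg_zero, map_zero, hB.pd_xi_mul (by simp), sub_self]
            · have e2 : -(xi j * (xi k * pd j F)) = xi k * F := by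
                rw [xi_mul_xi_mul, neg_neg, hF.xi_mul_pd hj]
              have e3 : pd k (xi k * F) = xi j * pd k (xi k * pd j F) := by
                rw [← e2, map_neg, pd_xi_mul_of_ne hk, neg_neg]
              rw [e2, curlW_apply, sub_zero, one_mul, one_mul, e3, pd_xi_mul_of_ne (Ne.symm hk),
                map_neg, sub_eq_add_neg]
          have e4 : ∀ k, vecW k (xi k * T (inv N (pd j (inv N F)))) =
              -(((N : ℂ) - (J.erase j).card)⁻¹ • vecW k (xi k * pd j F)) := by
            intro k
            rw [inv_pd, inv_inv, map_neg, hT _ _ hB, mul_neg, mul_smul_comm, map_neg, map_smul]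
          rw [Finset.sum_congr rfl fun k _ => e1 k, Finset.sum_congr rfl fun k _ => e4 k,
            Finset.sum_sub_distrib, ← map_sum, ← Finset.mul_sum, sum_pd_xi_mul hB, mul_smul_comm,
            hF.xi_mul_pd hj, map_smul, Finset.sum_neg_distrib, neg_neg, ← Finset.smul_sum, smul_sub,
            smul_smul, inv_mul_cancel₀ hne, one_smul]
        rw [e, ← C_smul (M := W N)]
        exact Submodule.smul_mem _ _ (sum_mem fun k _ => curlW_mem_spanW _ _ _ _ _)
      -- When ξⱼ does not occur in F, the field F ∂ⱼ is divergence-free; the diagonal curl counts it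
      -- twice.
      · have e : vecW j F = (2⁻¹ : ℂ) • curlW 0 j j (xi j * F) := by
          rw [curlW_apply, sub_zero, one_mul, hF.pd_xi_mul hj, ← two_smul ℂ, smul_smul,
            inv_mul_cancel₀ two_ne_zero, one_smul]
        rw [hF.isWt_inv.2 j hj, e]
        simp only [map_zero, mul_zero, Finset.sum_const_zero, neg_zero, sub_zero]
        rw [← C_smul (M := W N)]
        exact Submodule.smul_mem _ _ (curlW_mem_spanW _ _ _ _ _)
  have hall : ∀ x, x - Y (divTw 0 a x) - Z (τ' (coeffF N x)) ∈ spanW 0 a := by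
    intro x
    have hadd : ∀ x y : W N, x - Y (divTw 0 a x) - Z (τ' (coeffF N x)) ∈ spanW 0 a →
        y - Y (divTw 0 a y) - Z (τ' (coeffF N y)) ∈ spanW 0 a →
        (x + y) - Y (divTw 0 a (x + y)) - Z (τ' (coeffF N (x + y))) ∈ spanW 0 a := by
      intro x y hx hy
      simp only [map_add]
      convert add_mem hx hy using 1
      abel
    induction x using dInduction with
    | gen v =>
      rw [mk_eq_sum]
      refine hadd _ _ ?_ (hfun _)
      refine Finset.sum_induction _ (fun x => x - Y (divTw 0 a x) - Z (τ' (coeffF N x)) ∈ spanW 0 a)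
        hadd (by simp) fun j _ => hvec _ _
    | add x y hx hy => exact hadd x y hx hy
    | hX x hx =>
      simp only [map_smul]
      convert Submodule.smul_mem _ (X : ℂ[X]) hx using 1
      module
  -- Derivatives have no top-degree component, so only the function part is seen.
  have htop : ∀ x, τ' (divTw 0 a x) = (C a - X : ℂ[X]) • τ' (coeffF N x) := by
    intro x
    have hadd : ∀ x y : W N, τ' (divTw 0 a x) = (C a - X : ℂ[X]) • τ' (coeffF N x) →
        τ' (divTw 0 a y) = (C a - X : ℂ[X]) • τ' (coeffF N y) →
        τ' (divTw 0 a (x + y)) = (C a - X : ℂ[X]) • τ' (coeffF N (x + y)) := by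
      intro x y hx hy
      simp only [map_add, hx, hy, smul_add]
    induction x using dInduction with
    | gen v =>
      rw [mk_eq_sum]
      refine hadd _ _ ?_ ?_
      · refine Finset.sum_induction _
          (fun x => τ' (divTw 0 a x) = (C a - X : ℂ[X]) • τ' (coeffF N x)) hadd (by simp) fun j _ => ?_
        rw [hcv, divTw_vecW, map_zero, map_zero, smul_zero, mul_zero, add_zero, hτ', hτpd, map_zero]
      · rw [divTw_funW, hcf, map_smul]
    | add x y hx hy => exact hadd x y hx hy
    | hX x hx => simp only [map_smul, hx, smul_comm (X : ℂ[X])]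
  have h0 := htop x
  rw [hx, map_zero] at h0
  -- The module ℂ[∂] ⊗ Λ(N) is torsion-free and a - ∂ is a nonzero polynomial.
  have h1 : τ' (coeffF N x) = 0 := by
    have hne : (C a - X : ℂ[X]) ≠ 0 := by
      intro h
      have := congrArg (fun p => coeff p 1) h
      simp at this
    exact (smul_eq_zero.mp h0.symm).resolve_left hne
  have h2 := hall x
  rwa [hx, h1, map_zero, map_zero, sub_zero, sub_zero] at h2


theorem mulGen_baseChange_potW (u : Gr N) (a : ℂ) (j : Fin N) (F : Gr N) :
    (mulGen (1 - u)).baseChange ℂ[X] (potW 0 a j F) = potW u a j F := by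
  have h1 : ∀ A, (mulGen (1 - u)).baseChange ℂ[X] (vecW j A) = vecW j ((1 - u) * A) := by
    intro A
    rw [vecW_apply, LinearMap.baseChange_tmul, vecW_apply]
    congr 1
    exact Prod.ext (funext fun k => mul_single_apply _ _ _ _) (mul_zero _)
  have h2 : ∀ f, (mulGen (1 - u)).baseChange ℂ[X] (funW f) = funW ((1 - u) * f) := by
    intro f
    rw [funW_apply, LinearMap.baseChange_tmul, funW_apply]
    congr 1
    exact Prod.ext (funext fun k => mul_zero _) rfl
  rw [potW_apply, potW_apply, map_add, map_smul, h1, h2, sub_zero, one_mul, one_mul]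

theorem mulGen_baseChange_curlW (u : Gr N) (i j : Fin N) (F : Gr N) :
    (mulGen (1 - u)).baseChange ℂ[X] (curlW 0 i j F) = curlW u i j F := by
  have h1 : ∀ j A, (mulGen (1 - u)).baseChange ℂ[X] (vecW j A) = vecW j ((1 - u) * A) := by
    intro j A
    rw [vecW_apply, LinearMap.baseChange_tmul, vecW_apply]
    congr 1
    exact Prod.ext (funext fun k => mul_single_apply _ _ _ _) (mul_zero _)
  rw [curlW_apply, curlW_apply, map_add, h1, h1, sub_zero, one_mul, one_mul]

theorem mulGen_baseChange_comp {u v : Gr N} (h : u * v = 1) (x : W N) :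
    (mulGen u).baseChange ℂ[X] ((mulGen v).baseChange ℂ[X] x) = x := by
  induction x using TensorProduct.induction_on with
  | zero => simp
  | add x y hx hy => simp only [map_add, hx, hy]
  | tmul p w =>
    rw [LinearMap.baseChange_tmul, LinearMap.baseChange_tmul]
    congr 1
    refine Prod.ext (funext fun k => ?_) ?_
    · simp [mulGen, ← mul_assoc, h]
    · simp [mulGen, ← mul_assoc, h]

/-- Differentiating the factor 1 + u produces ∑ Pₖ ∂ₖu, the twist of the divergence; multiplying
that sum by 1 + u does not change it, since u ∂ₖu = 0. -/
theorem divTw_zero_mulGen {u : Gr N} (hu : IsEvenTop u) (hN : 2 < N) (a : ℂ) (x : W N) :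
    divTw 0 a ((mulGen (1 + u)).baseChange ℂ[X] x) =
      (LinearMap.mulLeft ℂ (1 + u)).baseChange ℂ[X] (divTw u a x) := by
  induction x using dInduction with
  | gen v =>
    have e : dvGen 0 a (mulGen (1 + u) v) = (1 + u) * dvGen u a v := by
      have h1 := dvGen_B 0 a (1 + u) v.2 v.1
      have h2 : mulGen (1 + u) v = (fun k => (1 + u) * v.1 k, (1 + u) * v.2) := rfl
      have h3 : dvGen u a v = dvGen 0 a v + der v.1 u := by simp [dvGen, der]
      have h4 : derSwap (1 + u) v.1 = der v.1 u := by
        simp only [derSwap, der, map_add, inv_one, pd_one, zero_add, hu.inv]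
        exact Finset.sum_congr rfl fun k _ => by rw [← hu.mul_pd_comm, inv_inv]
      have h5 : u * der v.1 u = 0 := by
        rw [der, Finset.mul_sum]
        exact Finset.sum_eq_zero fun k _ => by
          rw [← mul_assoc, even_comm hu.inv, mul_assoc, hu.mul_pd hN, mul_zero]
      rw [h2, h1, h3, h4, mul_add, add_mul 1 u (der v.1 u), one_mul, h5, add_zero]
    rw [LinearMap.baseChange_tmul, divTw_gen, divTw_gen, e, map_sub, map_smul,
      LinearMap.baseChange_tmul, LinearMap.baseChange_tmul]
    rfl
  | add x y hx hy => simp only [map_add, hx, hy]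
  | hX x hx => simp only [map_smul, hx]

theorem mem_spanW {u : Gr N} (hu : IsEvenTop u) (hN : 2 < N) (a : ℂ) {x : W N}
    (hx : divTw u a x = 0) : x ∈ spanW u a := by
  have h1 : (mulGen (1 + u)).baseChange ℂ[X] x ∈ spanW 0 a :=
    mem_spanW_of_divTw_zero a (by rw [divTw_zero_mulGen hu hN, hx, map_zero])
  have h2 : (1 - u) * (1 + u) = 1 := by
    rw [sub_mul, one_mul, mul_add, mul_one, hu.mul_self hN]; abel
  rw [← mulGen_baseChange_comp h2 x]
  generalize (mulGen (1 + u)).baseChange ℂ[X] x = y at h1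
  refine spanW_induction (p := fun y => (mulGen (1 - u)).baseChange ℂ[X] y ∈ spanW u a)
    (fun j J F _ => ?_) (fun i j J F _ => ?_) ?_ (fun x y hx hy => ?_) (fun x hx => ?_)
    (fun c x hx => ?_) h1
  · rw [mulGen_baseChange_potW]; exact potW_mem_spanW _ _ _ _
  · rw [mulGen_baseChange_curlW]; exact curlW_mem_spanW _ _ _ _ _
  · rw [map_zero]; exact zero_mem _
  · rw [map_add]; exact add_mem hx hy
  · rw [map_smul]; exact Submodule.smul_mem _ _ hx
  · rw [← C_smul (M := W N), map_smul]; exact Submodule.smul_mem _ _ hx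

end

end LieConf

namespace LieConf

open Polynomial TensorProduct

noncomputable section

/-! ### Cocycles with values in a vector space with trivial action -/

section Cocycle

open LieConformalSuperalgebra

variable {R : Type*} [AddCommGroup R] [Module ℂ R] [Module ℂ[X] R] [IsScalarTower ℂ ℂ[X] R]
  [LieConformalSuperalgebra R]

theorem lamEval_support (t : ℂ[X]) (a b : R) : (Function.support fun n : ℕ =>
    ((n.factorial : ℂ)⁻¹) • (t ^ n • nprod n a b)).Finite := by
  obtain ⟨m, hm⟩ := locality a b
  refine (Finset.range m).finite_toSet.subset fun n hn => ?_
  simp only [Finset.coe_range, Set.mem_Iio]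
  by_contra h
  exact hn (by simp [hm n (not_lt.mp h)])

/-- The value at `λ = t` of the `λ`-bracket, as a bilinear map. -/
def brL (t : ℂ[X]) : R →ₗ[ℂ] R →ₗ[ℂ] R :=
  LinearMap.mk₂ ℂ (lamEval nprod t)
    (fun a a' b => by
      rw [lamEval, lamEval, lamEval, ← finsum_add_distrib (lamEval_support t a b)
        (lamEval_support t a' b)]
      exact finsum_congr fun n => by
        rw [map_add, LinearMap.add_apply, smul_add, smul_add])
    (fun c a b => by
      rw [lamEval, lamEval, smul_finsum' c (lamEval_support t a b)]
      exact finsum_congr fun n => by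
        rw [map_smul, LinearMap.smul_apply, smul_comm (t ^ n) c,
          smul_comm ((n.factorial : ℂ)⁻¹) c])
    (fun a b b' => by
      rw [lamEval, lamEval, lamEval, ← finsum_add_distrib (lamEval_support t a b)
        (lamEval_support t a b')]
      exact finsum_congr fun n => by rw [map_add, smul_add, smul_add])
    (fun c a b => by
      rw [lamEval, lamEval, smul_finsum' c (lamEval_support t a b)]
      exact finsum_congr fun n => by rw [map_smul, smul_comm (t ^ n) c,
          smul_comm ((n.factorial : ℂ)⁻¹) c])

theorem brL_apply (t : ℂ[X]) (a b : R) : brL t a b = lamEval nprod t a b := rfl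

theorem brL_X_left (l : ℂ) (a b : R) : brL (C l) ((X : ℂ[X]) • a) b = -(l • brL (C l) a b) :=
  sesqui_left l a b

theorem brL_X_right (l : ℂ) (a b : R) :
    brL (C l) a ((X : ℂ[X]) • b) = (X : ℂ[X]) • brL (C l) a b + l • brL (C l) a b :=
  (sesqui_right l a b).trans (by rw [add_smul, C_smul]; rfl)

theorem brL_mem (l : ℂ) {i j : ZMod 2} {a b : R} (ha : a ∈ part i) (hb : b ∈ part j) :
    brL (C l) a b ∈ part (i + j) := by
  rw [brL_apply, lamEval, finsum_eq_sum_of_support_subset _ (s := (lamEval_support (C l) a b).toFinset)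
    (by rw [Set.Finite.coe_toFinset])]
  refine sum_mem fun n _ => ?_
  rw [← C_smul]
  exact Submodule.smul_mem _ _ (Submodule.smul_mem _ _ (nprod_mem n ha hb))

theorem exists_homogeneous (a : R) : ∃ a₀ ∈ part (R := R) 0, ∃ a₁ ∈ part (R := R) 1, a = a₀ + a₁ := by
  have h : a ∈ part (R := R) 0 ⊔ part 1 := by
    rw [codisjoint_iff.mp (isCompl_part (R := R)).codisjoint]; trivial
  obtain ⟨a₀, h₀, a₁, h₁, rfl⟩ := Submodule.mem_sup.mp h
  exact ⟨a₀, h₀, a₁, h₁, rfl⟩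

/-- The bracket at `λ = 0` with an even element is a derivation. -/
theorem brL_zero_derivation {h : R} (hh : h ∈ part 0) (m : ℂ) (b c : R) :
    brL (C 0) h (brL (C m) b c) = brL (C m) (brL (C 0) h b) c + brL (C m) b (brL (C 0) h c) := by
  obtain ⟨b₀, h₀, b₁, h₁, e⟩ := exists_homogeneous b
  have j₀ := LieConformalSuperalgebra.jacobi 0 m c hh h₀
  have j₁ := LieConformalSuperalgebra.jacobi 0 m c hh h₁
  simp only [superSign_zero_left, one_smul, zero_add, ← brL_apply] at j₀ j₁
  rw [e]
  simp only [map_add, LinearMap.add_apply, j₀, j₁]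
  abel

variable {K : Type*} [AddCommGroup K] [Module ℂ K]

/-- The cocycle condition for a family `α_λ` of bilinear maps, `λ ∈ ℂ`, with values in a vector
space on which `∂` and the Lie conformal superalgebra act trivially. -/
structure IsCocycle (α : ℂ → R →ₗ[ℂ] R →ₗ[ℂ] K) : Prop where
  X_left : ∀ l a b, α l ((X : ℂ[X]) • a) b = -(l • α l a b)
  X_right : ∀ l a b, α l a ((X : ℂ[X]) • b) = l • α l a b
  jacobi : ∀ (l m : ℂ) {i j : ZMod 2} {a b : R} (c : R), a ∈ part i → b ∈ part j →
    α l a (brL (C m) b c) = α (l + m) (brL (C l) a b) c +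
      superSign i j • α m b (brL (C l) a c)

/-- The coboundary `φ([a_λ b])`. -/
def coboundary (φ : R →ₗ[ℂ] K) (l : ℂ) : R →ₗ[ℂ] R →ₗ[ℂ] K := (brL (C l)).compr₂ φ

theorem coboundary_apply (φ : R →ₗ[ℂ] K) (l : ℂ) (a b : R) :
    coboundary φ l a b = φ (brL (C l) a b) := rfl

namespace IsCocycle

variable {α : ℂ → R →ₗ[ℂ] R →ₗ[ℂ] K} (hα : IsCocycle α)

include hα

theorem sub_coboundary {φ : R →ₗ[ℂ] K} (hφ : ∀ z, φ ((X : ℂ[X]) • z) = 0) :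
    IsCocycle fun l => α l - coboundary φ l where
  X_left l a b := by
    simp only [LinearMap.sub_apply, coboundary_apply, hα.X_left, brL_X_left, map_neg, map_smul,
      smul_sub]
    abel
  X_right l a b := by
    simp only [LinearMap.sub_apply, coboundary_apply, hα.X_right, brL_X_right, map_add, hφ,
      map_smul, smul_sub, zero_add]
  jacobi l m i j a b c ha hb := by
    have h : brL (C l) a (brL (C m) b c) = brL (C (l + m)) (brL (C l) a b) c +
        superSign i j • brL (C m) b (brL (C l) a c) := LieConformalSuperalgebra.jacobi l m c ha hb
    simp only [LinearMap.sub_apply, coboundary_apply, hα.jacobi l m c ha hb, h, map_add, map_smul,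
      smul_sub]
    abel

theorem smul_left (l : ℂ) (p : ℂ[X]) (a b : R) : α l (p • a) b = eval (-l) p • α l a b := by
  induction p using Polynomial.induction_on with
  | C c => rw [C_smul, map_smul, LinearMap.smul_apply, eval_C]
  | add p q hp hq => rw [add_smul, map_add, LinearMap.add_apply, hp, hq, eval_add, add_smul]
  | monomial n c h =>
    rw [show (C c * X ^ (n + 1) : ℂ[X]) = X * (C c * X ^ n) by ring, mul_smul, hα.X_left, h,
      eval_mul (p := X), eval_X, mul_smul, neg_smul]

theorem smul_right (l : ℂ) (p : ℂ[X]) (a b : R) : α l a (p • b) = eval l p • α l a b := by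
  induction p using Polynomial.induction_on with
  | C c => rw [C_smul, map_smul, eval_C]
  | add p q hp hq => rw [add_smul, map_add, hp, hq, eval_add, add_smul]
  | monomial n c h =>
    rw [show (C c * X ^ (n + 1) : ℂ[X]) = X * (C c * X ^ n) by ring, mul_smul, hα.X_right, h,
      eval_mul (p := X), eval_X, mul_smul]

theorem jacobi_even (l m : ℂ) {a : R} (ha : a ∈ part 0) (b c : R) :
    α l a (brL (C m) b c) = α (l + m) (brL (C l) a b) c + α m b (brL (C l) a c) := by
  obtain ⟨b₀, h₀, b₁, h₁, rfl⟩ := exists_homogeneous b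
  have e₀ := hα.jacobi l m c ha h₀
  have e₁ := hα.jacobi l m c ha h₁
  rw [superSign_zero_left, one_smul] at e₀ e₁
  simp only [map_add, LinearMap.add_apply, e₀, e₁]
  abel

theorem jacobi_odd (l m : ℂ) {a b : R} (ha : a ∈ part 1) (hb : b ∈ part 1) (c : R) :
    α l a (brL (C m) b c) = α (l + m) (brL (C l) a b) c - α m b (brL (C l) a c) := by
  rw [hα.jacobi l m c ha hb, superSign_one_one, neg_smul, one_smul, sub_eq_add_neg]

/-- The elements `x` with `α(x, ·) = 0` form a subalgebra. -/
theorem brL_mem_ker {i j : ZMod 2} {x y : R} (hxi : x ∈ part i) (hyj : y ∈ part j)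
    (hx : ∀ l c, α l x c = 0) (hy : ∀ l c, α l y c = 0) (l m : ℂ) (c : R) :
    α m (brL (C l) x y) c = 0 := by
  have h := hα.jacobi l (m - l) c hxi hyj
  rw [hx, hy, smul_zero, add_zero, add_sub_cancel] at h
  exact h.symm

/-- An even element `h` acts trivially on cohomology: a cocycle may be made to vanish on
eigenvectors of `h` with nonzero total weight. -/
theorem exists_normalization {h : R} (hh : h ∈ part 0) (S : Finset ℂ) :
    ∃ φ : R →ₗ[ℂ] K, (∀ z, φ ((X : ℂ[X]) • z) = 0) ∧ ∀ (wb wc : ℂ) (b c : R), wb + wc ∈ S →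
      wb + wc ≠ 0 → brL (C 0) h b = wb • b → brL (C 0) h c = wc • c → ∀ m,
        α m b c = φ (brL (C m) b c) := by
  -- The operator [h₀ ·] is inverted on the eigenvalues in S by a polynomial in it, which commutes
  -- with ∂.
  obtain ⟨q, hq⟩ := exists_aeval_eigenvector (brL (C 0) h) S fun w => w⁻¹
  have hqX : ∀ (q : ℂ[X]) (z : R), aeval (brL (C 0) h : Module.End ℂ R) q ((X : ℂ[X]) • z) =
      (X : ℂ[X]) • aeval (brL (C 0) h : Module.End ℂ R) q z := by
    intro q z
    have hn : ∀ n : ℕ, ((brL (C 0) h : Module.End ℂ R) ^ n) ((X : ℂ[X]) • z) =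
        (X : ℂ[X]) • ((brL (C 0) h : Module.End ℂ R) ^ n) z := by
      intro n
      induction n with
      | zero => simp
      | succ n ih =>
        rw [pow_succ', Module.End.mul_apply, Module.End.mul_apply, ih, brL_X_right, zero_smul,
          add_zero]
    induction q using Polynomial.induction_on' with
    | add p q hp hq => simp only [map_add, LinearMap.add_apply, hp, hq, smul_add]
    | monomial n c =>
      rw [aeval_monomial, Module.End.mul_apply, Module.End.mul_apply, hn,
        Module.algebraMap_end_apply, Module.algebraMap_end_apply, smul_comm]
  -- Cartan's homotopy: the Jacobi identity at λ = 0 reads α₀(h, [b_m c]) = (w_b + w_c) α_m(b, c),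
  -- so α₀(h, ·) composed with the inverse of [h₀ ·] is a primitive. It kills ∂R because ∂ in the
  -- second argument multiplies α₀ by 0.
  refine ⟨α 0 h ∘ₗ aeval (brL (C 0) h : Module.End ℂ R) q, fun z => ?_,
    fun wb wc b c hS hne hb hc m => ?_⟩
  · rw [LinearMap.comp_apply, hqX, hα.X_right, zero_smul]
  · have h1 : brL (C 0) h (brL (C m) b c) = (wb + wc) • brL (C m) b c := by
      rw [brL_zero_derivation hh, hb, hc, map_smul, LinearMap.smul_apply, map_smul, add_smul]
    have h2 := hα.jacobi_even 0 m hh b c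
    rw [hb, hc, zero_add, map_smul, LinearMap.smul_apply, map_smul, ← add_smul] at h2
    rw [LinearMap.comp_apply, hq _ hS _ h1, map_smul, h2, smul_smul, inv_mul_cancel₀ hne, one_smul]

end IsCocycle

end Cocycle

end

end LieConf

namespace LieConf

open Polynomial TensorProduct

noncomputable section

variable {N : ℕ}

open LieConformalSuperalgebra

/-! ### Elements of the subalgebras of twisted divergence-free fields -/

variable {R : Type*} [AddCommGroup R] [Module ℂ R] [Module ℂ[X] R] [IsScalarTower ℂ ℂ[X] R]
  [LieConformalSuperalgebra R]

/-- The map `e` identifies `R` with the subalgebra of `W_N` cut out by `divTw u a`, where `u` is an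
even multiple of `ξ₁ ⋯ ξ_N` and `N > 2`. -/
structure IsDivFree (e : R →ₗ[ℂ[X]] W N) (u : Gr N) (a : ℂ) : Prop where
  top : IsEvenTop u
  two_lt : 2 < N
  injective : Function.Injective e
  map_brL : ∀ (t : ℂ[X]) (x y : R), e (brL t x y) = wBr t (e x) (e y)
  mem_part : ∀ (i : ZMod 2) (x : R), e x ∈ wPart N i → x ∈ part i
  mem_range : ∀ x, (∃ y, e y = x) ↔ divTw u a x = 0

namespace IsDivFree

variable {e : R →ₗ[ℂ[X]] W N} {u : Gr N} {a : ℂ} (h : IsDivFree e u a)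

/-- The element of `R` with given image. -/
def preimage (x : W N) (hx : divTw u a x = 0) : R := ((h.mem_range x).mpr hx).choose

theorem coe_preimage (x : W N) (hx : divTw u a x = 0) : e (h.preimage x hx) = x :=
  ((h.mem_range x).mpr hx).choose_spec

/-- Lift of a linear map with values in the kernel of `divTw u a`. -/
def lift {V : Type*} [AddCommGroup V] [Module ℂ V] (f : V →ₗ[ℂ] W N)
    (hf : ∀ v, divTw u a (f v) = 0) : V →ₗ[ℂ] R where
  toFun v := h.preimage (f v) (hf v)
  map_add' v w := h.injective (by simp only [map_add, coe_preimage])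
  map_smul' c v := h.injective (by
    simp only [map_smul, LinearMap.map_smul_of_tower, coe_preimage, RingHom.id_apply])

theorem coe_lift {V : Type*} [AddCommGroup V] [Module ℂ V] (f : V →ₗ[ℂ] W N)
    (hf : ∀ v, divTw u a (f v) = 0) (v : V) : e (h.lift f hf v) = f v :=
  h.coe_preimage _ (hf v)

/-- `pdW` as an element of the subalgebra. -/
def pd (i : Fin N) : R := h.preimage _ (divTw_pdW h.top h.two_lt a i)

/-- `potW` with values in the subalgebra. -/
def pot (j : Fin N) : Gr N →ₗ[ℂ] R := h.lift (potW u a j) (divTw_potW h.top h.two_lt a j)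

/-- `curlW` with values in the subalgebra. -/
def curl (i j : Fin N) : Gr N →ₗ[ℂ] R := h.lift (curlW u i j) (divTw_curlW h.top h.two_lt a i j)

/-- `torusW` as an element of the subalgebra. -/
def torus {c : Fin N → ℂ} (hc : ∑ i, c i = 0) : R :=
  h.preimage _ (divTw_torusW h.top a hc)

include h

theorem coe_pd (i : Fin N) : e (h.pd i) = pdW u i :=
  h.coe_preimage _ _

theorem coe_pot (j : Fin N) (F : Gr N) : e (h.pot j F) = potW u a j F := h.coe_lift _ _ F

theorem coe_curl (i j : Fin N) (F : Gr N) : e (h.curl i j F) = curlW u i j F := h.coe_lift _ _ F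

theorem coe_torus {c : Fin N → ℂ} (hc : ∑ i, c i = 0) : e (h.torus hc) = torusW c :=
  h.coe_preimage _ _

theorem curl_symm (i j : Fin N) (F : Gr N) : h.curl i j F = h.curl j i F :=
  h.injective (by rw [coe_curl, curlW_symm, coe_curl])

theorem deep {J : Finset (Fin N)} {F : Gr N} (hF : IsWt J F) (hJ : 2 ≤ J.card) : Deep u F :=
  Deep.of_isWt h.top.isWt hF hJ

theorem pd_mem (i : Fin N) : h.pd i ∈ part (R := R) 1 :=
  h.mem_part _ _ (mem_wPart_one.mpr (by rw [coe_pd]; exact wInv_pdW h.top i))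

theorem pot_mem {J : Finset (Fin N)} {F : Gr N} (hF : IsWt J F) (j : Fin N) :
    ∃ i, h.pot j F ∈ part (R := R) i := by
  have e : wInv N (potW u a j F) = (-(-1 : ℂ) ^ J.card) • potW u a j F := by
    rw [wInv_potW h.top, hF.inv, map_smul]; exact (neg_smul ((-1 : ℂ) ^ J.card) (potW u a j F)).symm
  rcases neg_one_pow_eq_or ℂ J.card with h1 | h1
  · refine ⟨1, h.mem_part _ _ (mem_wPart_one.mpr ?_)⟩
    rw [coe_pot, e, h1]
    exact neg_one_smul ℂ (potW u a j F)
  · refine ⟨0, h.mem_part _ _ (mem_wPart_zero.mpr ?_)⟩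
    rw [coe_pot, e, h1, neg_neg]
    exact one_smul ℂ (potW u a j F)

theorem pot_xi_mem (j : Fin N) : h.pot j (xi j) ∈ part (R := R) 0 :=
  h.mem_part _ _ (mem_wPart_zero.mpr (by
    rw [coe_pot, wInv_potW h.top a j (xi j), inv_xi, map_neg, neg_neg]))

theorem curl_xi_mem (i j : Fin N) : h.curl i j (xi i * xi j) ∈ part (R := R) 0 :=
  h.mem_part _ _ (mem_wPart_zero.mpr (by
    rw [coe_curl, wInv_curlW h.top i j _, inv_mul, inv_xi, inv_xi, neg_mul_neg]))

theorem torus_mem {c : Fin N → ℂ} (hc : ∑ i, c i = 0) : h.torus hc ∈ part (R := R) 0 :=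
  h.mem_part _ _ (mem_wPart_zero.mpr (by rw [coe_torus, wInv_torusW c]))

theorem brL_pd_pot {J : Finset (Fin N)} {F : Gr N} (hF : IsWt J F) (hJ : 2 ≤ J.card) (l : ℂ)
    (i j : Fin N) : brL (C l) (h.pd i) (h.pot j F) =
      -h.pot j (LieConf.pd i F) + l • h.curl i j (inv N F) := by
  apply h.injective
  rw [h.map_brL, coe_pd, coe_pot, wBr_pdW_potW a h.top.inv (h.deep hF hJ) l i j,
    C_smul (M := W N), map_add, map_neg, LinearMap.map_smul_of_tower, coe_pot, coe_curl]

theorem brL_pd_pd (l : ℂ) (i j : Fin N) : brL (C l) (h.pd i) (h.pd j) = -h.curl i j u := by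
  apply h.injective
  rw [h.map_brL, coe_pd, coe_pd, wBr_pdW_pdW h.top.inv (h.top.mul_pd h.two_lt) (C l) i j, map_neg,
    coe_curl]

theorem brL_pot_xi_self {J : Finset (Fin N)} {F : Gr N} (hF : IsWt J F) (hJ : 2 ≤ J.card) (l : ℂ)
    {j : Fin N} (hj : j ∈ J) : brL (C l) (h.pot j (xi j)) (h.pot j F) =
      -((X + C (2 * l) : ℂ[X]) • h.pot j F) := by
  apply h.injective
  rw [h.map_brL, coe_pot, coe_pot,
    wBr_potW_xi_self a h.top.mul_xi h.top.inv (h.deep hF hJ) hF hj l, map_neg, map_smul, coe_pot]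

theorem brL_pot_xi_of_ne {J : Finset (Fin N)} {G : Gr N} (hG : IsWt J G) (hJ : 2 ≤ J.card) (l : ℂ)
    {j k : Fin N} (hj : j ∈ J) (hjk : j ≠ k) : brL (C l) (h.pot j (xi j)) (h.pot k G) =
      -((X + C (l - a) : ℂ[X]) • h.pot k G) := by
  apply h.injective
  rw [h.map_brL, coe_pot, coe_pot,
    wBr_potW_xi_of_ne a h.top.mul_xi h.top.inv (h.deep hG hJ) hG hj hjk l, map_neg, map_smul,
    coe_pot]

theorem brL_curl_xi_pot {J : Finset (Fin N)} {G : Gr N} (hG : IsWt J G) (hJ : 2 ≤ J.card) (s : ℂ)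
    {l m k : Fin N} (hlm : l ≠ m) (hl : l ∈ J) (hm : m ∈ J) (hlk : l ≠ k) (hmk : m ≠ k) :
    brL (C s) (h.curl l m (xi l * xi m)) (h.pot k G) = 0 := by
  apply h.injective
  rw [h.map_brL, coe_curl, coe_pot,
    wBr_torus_potW_eq_zero a h.top.mul_xi (h.deep hG hJ) hG hlm hl hm hlk hmk (C s), map_zero]

theorem brL_curl_xi_pot_pd {J : Finset (Fin N)} {F : Gr N} (hF : IsWt J F) (hJ : 3 ≤ J.card)
    (s : ℂ) {l m : Fin N} (hlm : l ≠ m) (hl : l ∈ J) (hm : m ∈ J) :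
    brL (C s) (h.curl l m (xi l * xi m)) (h.pot m (LieConf.pd l F)) =
      -(s • h.curl l m (inv N F)) := by
  apply h.injective
  rw [h.map_brL, coe_curl, coe_pot, wBr_torus_potW_pd a h.top.mul_xi hF
      (h.deep (hF.pd l) (by rw [Finset.card_erase_of_mem hl]; omega))
      (h.deep hF.isWt_inv (by omega)) hlm hl hm (C s), C_smul (M := W N), map_neg,
    LinearMap.map_smul_of_tower, coe_curl]

theorem brL_pot_pot {J J' : Finset (Fin N)} {F G : Gr N} (hF : IsWt J F) (hG : IsWt J' G)
    {j k : Fin N} (hjk : j ≠ k) (hj : j ∈ J) (hj' : j ∈ J') (hk : k ∈ J) (hk' : k ∈ J') (l : ℂ) :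
    brL (C l) (h.pot j F) (h.pot k G) = 0 := by
  have two : ∀ J : Finset (Fin N), j ∈ J → k ∈ J → 2 ≤ J.card := fun J h1 h2 =>
    Finset.one_lt_card.mpr ⟨j, h1, k, h2, hjk⟩
  apply h.injective
  rw [h.map_brL, coe_pot, coe_pot, wBr_potW_potW_eq_zero a (h.deep hF (two J hj hk))
    (h.deep hG (two J' hj' hk')) hF hG hjk hj hj' hk hk' l, map_zero]

section Weights

variable {c : Fin N → ℂ} (hc : ∑ i, c i = 0)

theorem brL_torus_pd (i : Fin N) : brL (C 0) (h.torus hc) (h.pd i) = (-c i) • h.pd i := by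
  apply h.injective
  rw [h.map_brL, C_0, coe_torus, coe_pd, wBr_torusW_pdW h.top hc, LinearMap.map_smul_of_tower,
    coe_pd]

theorem brL_torus_pot (j : Fin N) {J : Finset (Fin N)} {F : Gr N} (hF : IsWt J F) :
    brL (C 0) (h.torus hc) (h.pot j F) = (∑ i ∈ J, c i - c j) • h.pot j F := by
  apply h.injective
  rw [h.map_brL, C_0, coe_torus, coe_pot, wBr_torusW_potW h.top a hc j hF,
    LinearMap.map_smul_of_tower, coe_pot]

theorem brL_torus_curl (j k : Fin N) {J : Finset (Fin N)} {F : Gr N} (hF : IsWt J F) :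
    brL (C 0) (h.torus hc) (h.curl j k F) = (∑ i ∈ J, c i - c j - c k) • h.curl j k F := by
  apply h.injective
  rw [h.map_brL, C_0, coe_torus, coe_curl, wBr_torusW_curlW h.top hc j k hF,
    LinearMap.map_smul_of_tower, coe_curl]

end Weights

/-- `(∂ - a) (1 - u) ∂ⱼ` is the potential of a constant. -/
theorem pot_algebraMap (j : Fin N) (r : ℂ) :
    h.pot j (algebraMap ℂ (Gr N) r) = (C r * (X - C a) : ℂ[X]) • h.pd j := by
  apply h.injective
  have e : inv N (algebraMap ℂ (Gr N) r) = algebraMap ℂ (Gr N) r := AlgHom.commutes _ r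
  rw [coe_pot, map_smul, coe_pd, potW_apply, pd_algebraMap, mul_zero, map_zero, add_zero, e,
    ← Algebra.commutes, ← Algebra.smul_def, map_smul, ← C_smul (M := W N), smul_smul, mul_comm, pdW]

theorem curl_xi (i j k : Fin N) : h.curl i j (xi k) =
    (if j = k then h.pd i else 0) + if i = k then h.pd j else 0 := by
  apply h.injective
  have e1 : ∀ i j, vecW i ((1 - u) * LieConf.pd j (xi k)) = e (if j = k then h.pd i else 0) := by
    intro i j
    rw [pd_xi]
    by_cases hj : j = k
    · rw [if_pos hj, if_pos hj, mul_one, coe_pd]; rfl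
    · rw [if_neg hj, if_neg hj, mul_zero, map_zero, map_zero]
  rw [coe_curl, map_add, ← e1, ← e1, curlW_apply]

/-- Both potentials have function part -ξᵢ, so the difference is a derivation with a factor ∂ - a.
This relation ties together cocycle values on potentials in different directions. -/
theorem pot_sub_pot {i j k : Fin N} (hij : i ≠ j) (hik : i ≠ k) (hjk : j ≠ k) :
    h.pot k (xi i * xi k) - h.pot j (xi i * xi j) =
      -((X - C a : ℂ[X]) • h.curl j k (xi i * (xi j * xi k))) := by
  apply h.injective
  rw [map_sub, map_neg, map_smul, coe_pot, coe_pot, coe_curl]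
  have d1 := h.deep (isWt_xi_mul_xi hik) (Finset.card_pair hik).ge
  have d2 := h.deep (isWt_xi_mul_xi hij) (Finset.card_pair hij).ge
  have d3 := h.deep (isWt_xi_mul_xi_mul_xi hij hik hjk)
    (by rw [Finset.card_eq_three.mpr ⟨i, j, k, hij, hik, hjk, rfl⟩]; omega)
  rw [d1.potW, d2.potW, d3.curlW]
  simp only [inv_mul, inv_xi, pd_xi_mul, pd_xi, if_neg hjk, if_neg hij.symm,
    if_neg hik.symm, if_neg hjk.symm, if_true, mul_one, mul_zero, zero_sub,
    sub_zero, mul_neg, map_neg, neg_neg, neg_mul]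
  module

theorem induction {p : R → Prop} (pot : ∀ j J F, IsWt J F → p (h.pot j F))
    (curl : ∀ i j J F, IsWt J F → p (h.curl i j F)) (zero : p 0)
    (add : ∀ x y, p x → p y → p (x + y)) (hX : ∀ x, p x → p ((X : ℂ[X]) • x))
    (hC : ∀ (c : ℂ) x, p x → p (c • x)) (x : R) : p x := by
  obtain ⟨y, hy, py⟩ : ∃ y, e y = e x ∧ p y := by
    refine spanW_induction (p := fun z => ∃ y, e y = z ∧ p y)
      (fun j J F hF => ⟨_, h.coe_pot j F, pot j J F hF⟩)
      (fun i j J F hF => ⟨_, h.coe_curl i j F, curl i j J F hF⟩) ⟨0, map_zero e, zero⟩ ?_ ?_ ?_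
      (mem_spanW h.top h.two_lt a ((h.mem_range _).mp ⟨x, rfl⟩))
    · rintro _ _ ⟨x, rfl, px⟩ ⟨y, rfl, py⟩
      exact ⟨_, map_add e x y, add _ _ px py⟩
    · rintro _ ⟨x, rfl, px⟩
      exact ⟨_, map_smul e _ x, hX _ px⟩
    · rintro c _ ⟨x, rfl, px⟩
      exact ⟨_, LinearMap.map_smul_of_tower e c x, hC c _ px⟩
  rwa [← h.injective hy]

/-! ### Pairs of complementary weight -/

section Complementary

variable {K : Type*} [AddCommGroup K] [Module ℂ K]
  {α : ℂ → R →ₗ[ℂ] R →ₗ[ℂ] K} (hα : IsCocycle α)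

include hα

/-- The two potentials have zero bracket, but conformal weights 2 and 1 under `h.pot j (xi j)`. The
Jacobi identity becomes (l - m) α_{l+m} = (a - l - m) α_m, whose only solution is zero. -/
theorem cocycle_pot_pot {F G : Gr N} (hF : IsWt Finset.univ F) {J : Finset (Fin N)}
    (hG : IsWt J G) {j k : Fin N} (hjk : j ≠ k) (hj : j ∈ J) (hk : k ∈ J) (m : ℂ) :
    α m (h.pot j F) (h.pot k G) = 0 := by
  have two : 2 ≤ J.card := Finset.one_lt_card.mpr ⟨j, hj, k, hk, hjk⟩
  have twoN : 2 ≤ (Finset.univ : Finset (Fin N)).card := by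
    rw [Finset.card_univ, Fintype.card_fin]; exact h.two_lt.le
  have key : ∀ l m : ℂ, (l - m) • α (l + m) (h.pot j F) (h.pot k G) =
      (a - l - m) • α m (h.pot j F) (h.pot k G) := by
    intro l m
    have e := hα.jacobi_even l m (h.pot_xi_mem j) (h.pot j F) (h.pot k G)
    rw [h.brL_pot_pot hF hG hjk (Finset.mem_univ _) hj (Finset.mem_univ _) hk,
      h.brL_pot_xi_self hF twoN l (Finset.mem_univ _), h.brL_pot_xi_of_ne hG two l hj hjk, map_zero,
      map_neg, map_neg, LinearMap.neg_apply, hα.smul_left, hα.smul_right] at e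
    simp only [eval_add, eval_X, eval_C] at e
    rw [← sub_eq_zero, ← neg_eq_zero, e]
    module
  -- Setting l = m removes the left side and leaves (a - 2m) α_m = 0.
  have h1 : ∀ m, 2 * m ≠ a → α m (h.pot j F) (h.pot k G) = 0 := by
    intro m hm
    have e1 := key m m
    have e2 : (a - m - m) • α m (h.pot j F) (h.pot k G) = 0 := by
      rw [← e1, sub_self, zero_smul]
    refine (smul_eq_zero.mp e2).resolve_left fun h0 => hm ?_
    linear_combination -h0
  by_cases hm : 2 * m = a
  -- The exceptional point m = a/2 is reached from m + t with l = -t: the value at m + t is already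
  -- zero, and the coefficient of α_m is -(2t + m).
  · obtain ⟨t, ht, ht'⟩ : ∃ t : ℂ, t ≠ 0 ∧ 2 * t + m ≠ 0 := by
      by_cases h2 : 2 * 1 + m = 0
      · exact ⟨2, two_ne_zero, fun h0 => two_ne_zero (α := ℂ) (by linear_combination h0 - h2)⟩
      · exact ⟨1, one_ne_zero, h2⟩
    have e := key (-t) (m + t)
    rw [h1 (m + t) fun h0 => ht (by linear_combination (h0 - hm) / 2), smul_zero,
      neg_add_cancel_comm_assoc] at e
    exact (smul_eq_zero.mp e).resolve_left fun h0 => ht' (by linear_combination -h0)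
  · exact h1 m hm

/-- Up to sign the curl is the bracket at λ = 1 of ξₘ∂ₘ - ξₗ∂ₗ with a potential; the other two
brackets in the Jacobi identity vanish. The parameters 1 and s - 1 are chosen to add up to s. -/
theorem cocycle_curl_pot {F G : Gr N} (hF : IsWt Finset.univ F) {J : Finset (Fin N)}
    (hG : IsWt J G) {l m k : Fin N} (hlm : l ≠ m) (hlk : l ≠ k) (hmk : m ≠ k) (hl : l ∈ J)
    (hm : m ∈ J) (hk : k ∈ J) (s : ℂ) : α s (h.curl l m F) (h.pot k G) = 0 := by
  have two : 2 ≤ J.card := Finset.one_lt_card.mpr ⟨l, hl, m, hm, hlm⟩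
  have threeN : 3 ≤ (Finset.univ : Finset (Fin N)).card := by
    rw [Finset.card_univ, Fintype.card_fin]; exact h.two_lt
  have e := hα.jacobi_even 1 (s - 1) (h.curl_xi_mem l m) (h.pot m (LieConf.pd l F)) (h.pot k G)
  rw [h.brL_pot_pot (hF.pd l) hG hmk (by simp [hlm.symm]) hm (by simp [hlk.symm]) hk,
    h.brL_curl_xi_pot_pd hF threeN 1 hlm (Finset.mem_univ _) (Finset.mem_univ _),
    h.brL_curl_xi_pot hG two 1 hlm hl hm hlk hmk, map_zero, map_zero, add_zero, one_smul, hF.inv,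
    map_smul, map_neg, map_smul, LinearMap.neg_apply, LinearMap.smul_apply, add_sub_cancel] at e
  exact (smul_eq_zero.mp (neg_eq_zero.mp e.symm)).resolve_left (by simp)

/-- The same argument with the curl in the second argument, where the parameter s is unaffected by
the choice λ = 1. -/
theorem cocycle_pot_curl {F G : Gr N} (hF : IsWt Finset.univ F) {J : Finset (Fin N)}
    (hG : IsWt J G) {j k l : Fin N} (hjk : j ≠ k) (hjl : j ≠ l) (hkl : k ≠ l) (hj : j ∈ J)
    (hk : k ∈ J) (hl : l ∈ J) (s : ℂ) : α s (h.pot j F) (h.curl k l G) = 0 := by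
  have three : 3 ≤ J.card := Finset.two_lt_card.mpr ⟨j, hj, k, hk, l, hl, hjk, hjl, hkl⟩
  have twoN : 2 ≤ (Finset.univ : Finset (Fin N)).card := by
    rw [Finset.card_univ, Fintype.card_fin]; exact h.two_lt.le
  have e := hα.jacobi_even 1 s (h.curl_xi_mem l k) (h.pot j F) (h.pot k (LieConf.pd l G))
  rw [h.brL_pot_pot hF (hG.pd l) hjk (Finset.mem_univ _) (by simp [hj, hjl]) (Finset.mem_univ _)
      (by simp [hk, hkl]),
    h.brL_curl_xi_pot_pd hG three 1 hkl.symm hl hk,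
    h.brL_curl_xi_pot hF twoN 1 hkl.symm (Finset.mem_univ _) (Finset.mem_univ _) hjl.symm hjk.symm,
    map_zero, map_zero, LinearMap.zero_apply, zero_add, one_smul, hG.inv, map_smul, map_neg,
    map_smul] at e
  rw [h.curl_symm]
  exact (smul_eq_zero.mp (neg_eq_zero.mp e.symm)).resolve_left (by simp)

end Complementary

end IsDivFree

end

end LieConf

namespace LieConf

open Polynomial TensorProduct

noncomputable section

variable {N : ℕ}

open LieConformalSuperalgebra

/-! ### Combinatorics of weights -/

theorem exists_ne_ne (hN : 2 < N) (i k : Fin N) : ∃ j, j ≠ i ∧ j ≠ k := by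
  obtain ⟨j, -, hj⟩ := Finset.exists_mem_notMem_of_card_lt_card
    (s := ({i, k} : Finset (Fin N))) (t := Finset.univ)
    (lt_of_le_of_lt Finset.card_le_two (by rwa [Finset.card_univ, Fintype.card_fin]))
  simp only [Finset.mem_insert, Finset.mem_singleton, not_or] at hj
  exact ⟨j, hj⟩

/-- There are weights of sum zero which satisfy no other integral linear relation. -/
theorem exists_generic_weights (hN : 0 < N) : ∃ c : Fin N → ℂ, ∑ i, c i = 0 ∧
    ∀ n : Fin N → ℤ, ∑ i, n i * c i = 0 → ∀ i j, n i = n j := by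
  -- Powers of a transcendental number are linearly independent over ℤ; subtracting their mean
  -- imposes the single relation ∑ cᵢ = 0.
  obtain ⟨t, ht⟩ : ∃ t : ℝ, Transcendental ℤ t := ⟨_, transcendental_liouvilleNumber le_rfl⟩
  have hN' : (N : ℝ) ≠ 0 := by exact_mod_cast hN.ne'
  refine ⟨fun i => ((t ^ (i : ℕ) - (∑ j : Fin N, t ^ (j : ℕ)) / N : ℝ) : ℂ), ?_, fun n hn => ?_⟩
  · rw [← Complex.ofReal_sum]
    simp [Finset.sum_sub_distrib, mul_div_cancel₀ _ hN']
  · have e1 : ∑ i, (n i : ℝ) * (t ^ (i : ℕ) - (∑ j : Fin N, t ^ (j : ℕ)) / N) = 0 := by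
      beta_reduce at hn
      exact_mod_cast hn
    -- Clearing the denominator N moves the mean from the weights to the coefficients; the vanishing
    -- of the new coefficients says that every nᵢ is the average of all of them.
    have e2 : ∑ i : Fin N, ((N * n i - ∑ j, n j : ℤ) : ℝ) * t ^ (i : ℕ) = 0 := by
      have e3 : ∑ i : Fin N, ((N * n i - ∑ j, n j : ℤ) : ℝ) * t ^ (i : ℕ) =
          N * ∑ i, (n i : ℝ) * (t ^ (i : ℕ) - (∑ j : Fin N, t ^ (j : ℕ)) / N) := by
        simp only [mul_sub, Finset.sum_sub_distrib, ← Finset.sum_mul, Int.cast_sub, Int.cast_mul,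
          Int.cast_natCast, Int.cast_sum, sub_mul, Finset.mul_sum, mul_assoc]
        rw [← Finset.mul_sum, ← Finset.mul_sum]
        field_simp
      rw [e3, e1, mul_zero]
    have e4 : (∑ i : Fin N, C (N * n i - ∑ j, n j) * X ^ (i : ℕ) : ℤ[X]) = 0 := by
      by_contra h0
      refine ht ⟨_, h0, ?_⟩
      simpa using e2
    have e5 : ∀ i, (N : ℤ) * n i = ∑ j, n j := by
      intro i
      have e6 := congrArg (fun p : ℤ[X] => p.coeff i) e4
      simp only [finsetSum_coeff, coeff_C_mul_X_pow, coeff_zero, Fin.val_inj] at e6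
      rw [Finset.sum_ite_eq Finset.univ i] at e6
      simpa [sub_eq_zero] using e6
    intro i j
    have e7 : (N : ℤ) * n i = N * n j := by rw [e5, e5]
    exact mul_left_cancel₀ (by exact_mod_cast hN.ne') e7

theorem sum_weight_pair (c : Fin N → ℂ) (J : Finset (Fin N)) (k i : Fin N) :
    -c i + (∑ l ∈ J, c l - c k) = ∑ l, (((if l ∈ J then 1 else 0) - (if l = k then 1 else 0) -
      (if l = i then 1 else 0) : ℤ) : ℂ) * c l := by
  simp [sub_mul, Finset.sum_sub_distrib]
  ring

theorem sum_weight_triple (c : Fin N → ℂ) (J : Finset (Fin N)) (j k i : Fin N) :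
    -c i + (∑ l ∈ J, c l - c j - c k) = ∑ l, (((if l ∈ J then 1 else 0) - (if l = j then 1 else 0) -
      (if l = k then 1 else 0) - (if l = i then 1 else 0) : ℤ) : ℂ) * c l := by
  simp [sub_mul, Finset.sum_sub_distrib]
  ring

/-- By genericity, the indicator of J minus those of i and k is constant. It is nonnegative at an
index outside {i, k}, which exists as N > 2, and nonpositive at i, so it is zero; this is impossible
if i = k. -/
theorem eq_pair_of_weight {c : Fin N → ℂ} (hN : 2 < N)
    (hc : ∀ n : Fin N → ℤ, ∑ i, n i * c i = 0 → ∀ i j, n i = n j) {J : Finset (Fin N)}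
    {k i : Fin N} (h : -c i + (∑ l ∈ J, c l - c k) = 0) : i ≠ k ∧ J = {i, k} := by
  rw [sum_weight_pair] at h
  have h0 := hc _ h
  obtain ⟨m, hmi, hmk⟩ := exists_ne_ne hN i k
  have hi := h0 m i
  have hk := h0 m k
  simp only [hmi, hmk, if_false, if_true] at hi hk
  have hik : i ≠ k := by
    rintro rfl
    simp only [if_true] at hi
    split_ifs at hi <;> omega
  refine ⟨hik, Finset.ext fun l => ?_⟩
  have hl := h0 m l
  simp only [hmi, hmk, if_false, hik, hik.symm] at hi hk hl
  rw [Finset.mem_insert, Finset.mem_singleton]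
  grind

/-- The indicator of J minus those of i, j, k must be constant. A point of J gives a value at least
0 and i a value at most 0 when the indices are distinct. The case J = ∅ really occurs for N = 3,
with constant -1, but the curl of a constant is zero. -/
theorem eq_triple_of_weight {c : Fin N → ℂ} (hN : 2 < N)
    (hc : ∀ n : Fin N → ℤ, ∑ i, n i * c i = 0 → ∀ i j, n i = n j) {J : Finset (Fin N)}
    {j k i : Fin N} (h : -c i + (∑ l ∈ J, c l - c j - c k) = 0) :
    J = ∅ ∨ i ≠ j ∧ i ≠ k ∧ j ≠ k ∧ J = {i, j, k} := by
  rw [sum_weight_triple] at h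
  have h0 := hc _ h
  rcases Finset.eq_empty_or_nonempty J with hJ | ⟨p, hp⟩
  · exact Or.inl hJ
  refine Or.inr ?_
  by_cases hd : i ≠ j ∧ i ≠ k ∧ j ≠ k
  · obtain ⟨hij, hik, hjk⟩ := hd
    refine ⟨hij, hik, hjk, Finset.ext fun l => ?_⟩
    have hi := h0 p i
    have hj := h0 p j
    have hk := h0 p k
    have hl := h0 p l
    simp only [hp, hij, hik, hjk, hij.symm, hik.symm, hjk.symm, if_true, if_false] at hi hj hk hl
    simp only [Finset.mem_insert, Finset.mem_singleton]
    by_cases h1 : p = i <;> by_cases h2 : p = j <;> by_cases h3 : p = k <;> grind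
  -- With a repeated index, {i, j, k} misses some index, where the function is nonnegative, while at
  -- the repeated index it is negative.
  · exfalso
    obtain ⟨m, -, hm⟩ := Finset.exists_mem_notMem_of_card_lt_card
      (s := ({i, j, k} : Finset (Fin N))) (t := Finset.univ) (by
        rw [Finset.card_univ, Fintype.card_fin]
        refine lt_of_le_of_lt (b := 2) ?_ hN
        by_contra hcard
        have h3 : ({i, j, k} : Finset (Fin N)).card = 3 :=
          le_antisymm Finset.card_le_three (by omega)
        rw [Finset.card_eq_three] at h3
        grind)
    have hi := h0 m i
    have hj := h0 m j
    have hk := h0 m k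
    grind

/-! ### Linear functionals on the subalgebras -/

/-- The augmentation `Λ(N) → ℂ`. -/
def aug (N : ℕ) : Gr N →ₗ[ℂ] ℂ := (ExteriorAlgebra.algebraMapInv : Gr N →ₐ[ℂ] ℂ).toLinearMap

theorem aug_one : aug N 1 = 1 := map_one (ExteriorAlgebra.algebraMapInv : Gr N →ₐ[ℂ] ℂ)

theorem aug_xi_mul (i : Fin N) (F : Gr N) : aug N (xi i * F) = 0 := by
  change (ExteriorAlgebra.algebraMapInv : Gr N →ₐ[ℂ] ℂ) (xi i * F) = 0
  rw [map_mul, xi, ExteriorAlgebra.algebraMapInv, ExteriorAlgebra.lift_ι_apply]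
  simp

theorem aug_eulerOp (c : Fin N → ℂ) (F : Gr N) : aug N (eulerOp c F) = 0 := by
  rw [eulerOp_apply, map_sum]
  exact Finset.sum_eq_zero fun i _ => by rw [map_smul, aug_xi_mul, smul_zero]

theorem aug_pd_eulerOp (c : Fin N → ℂ) (j : Fin N) (F : Gr N) :
    aug N (pd j (eulerOp c F)) = c j * aug N (pd j F) := by
  rw [eulerOp_apply, map_sum, map_sum, Finset.sum_eq_single j]
  · rw [map_smul, pd_xi_mul_self, pd_pd_self, mul_zero, sub_zero, map_smul, smul_eq_mul]
  · intro i _ hi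
    rw [map_smul, pd_xi_mul_of_ne hi.symm, map_smul, map_neg, aug_xi_mul, neg_zero, smul_zero]
  · simp

theorem IsEvenTop.aug_eq_zero {u : Gr N} (hu : IsEvenTop u) (hN : 0 < N) : aug N u = 0 := by
  rw [← hu.isWt.xi_mul_pd (Finset.mem_univ ⟨0, hN⟩), aug_xi_mul]

section Functional

variable {K : Type*} [AddCommGroup K] [Module ℂ K] (y : K) (x : Fin N → K)

/-- The value on `∑ᵢ Pᵢ ∂ᵢ + f` of the functional which picks the constant terms of `f` and
of the `∂Pᵢ/∂ξᵢ` at `∂ = 0`. -/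
def constTerm : W N →ₗ[ℂ] K :=
  ((aug N).smulRight y ∘ₗ LinearMap.snd ℂ (Fin N → Gr N) (Gr N) +
    ∑ i, (aug N ∘ₗ pd i).smulRight (x i) ∘ₗ LinearMap.proj i ∘ₗ
      LinearMap.fst ℂ (Fin N → Gr N) (Gr N)) ∘ₗ evD 0

theorem constTerm_X_smul (z : W N) : constTerm y x ((X : ℂ[X]) • z) = 0 := by
  have h : evD 0 ((X : ℂ[X]) • z) = 0 := by
    induction z using TensorProduct.induction_on with
    | zero => rw [smul_zero, map_zero]
    | tmul p v => rw [smul_tmul', evD_tmul, smul_eq_mul, eval_mul, eval_X, neg_zero, zero_mul,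
        zero_smul]
    | add z w hz hw => rw [smul_add, map_add, hz, hw, add_zero]
  rw [constTerm, LinearMap.comp_apply, h, map_zero]

theorem constTerm_vecW (j : Fin N) (A : Gr N) :
    constTerm y x (vecW j A) = aug N (pd j A) • x j := by
  rw [constTerm, LinearMap.comp_apply, vecW_apply, evD_tmul, eval_one, one_smul]
  simp only [LinearMap.add_apply, LinearMap.comp_apply, LinearMap.snd_apply, map_zero, zero_add,
    LinearMap.sum_apply, LinearMap.fst_apply, LinearMap.proj_apply, LinearMap.smulRight_apply]
  rw [Finset.sum_eq_single j]
  · rw [Pi.single_eq_same]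
  · intro i _ hi
    rw [Pi.single_eq_of_ne hi, map_zero, map_zero, zero_smul]
  · simp

theorem constTerm_funW (f : Gr N) : constTerm y x (funW f) = aug N f • y := by
  rw [constTerm, LinearMap.comp_apply, funW_apply, evD_tmul, eval_one, one_smul]
  simp

/-- The functional reads only coefficients of weight zero: the constant term of f and the
coefficient of ξᵢ in Pᵢ. Hence its coboundary keeps a cocycle normalized. -/
theorem constTerm_torusW (c : Fin N → ℂ) (z : W N) :
    constTerm y x (wBr 0 (torusW c) z) = 0 := by
  induction z using dInduction with
  | gen v =>
    rw [mk_eq_sum, wBr_add_right, map_add, wBr_torusW_funW, constTerm_funW, aug_eulerOp, zero_smul,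
      add_zero]
    refine Finset.sum_induction _ (fun z => constTerm y x (wBr 0 (torusW c) z) = 0)
      (fun z w hz hw => by rw [wBr_add_right, map_add, hz, hw, add_zero]) ?_ fun j _ => ?_
    · rw [← zero_smul ℂ (0 : W N), wBr_smul_right, zero_smul, map_zero]
    · rw [wBr_torusW_vecW, map_sub, map_smul, constTerm_vecW, constTerm_vecW, aug_pd_eulerOp,
        mul_smul, sub_self]
  | add z w hz hw => rw [wBr_add_right, map_add, hz, hw, add_zero]
  | hX z hz => rw [wBr_X_right, add_zero, constTerm_X_smul]

end Functional

/-! ### Solution of the cocycle equations -/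

/-- Putting m = 0 or m = 1 in `hJ` makes A and B affine in l; `hD` then forces B to be constant. The
slopes sᵢₖ of A are antisymmetric by `hS` and additive by `hD`, hence differences xₖ - xᵢ, and the
constant terms are governed by `hD` at l = 0. A third index is needed throughout, which is where N >
2 enters. -/
theorem exists_solution (hN : 2 < N) {K : Type*} [AddCommGroup K] [Module ℂ K] (a : ℂ)
    (A : Fin N → Fin N → ℂ → K) (B : Fin N → Fin N → Fin N → ℂ → K)
    (hJ : ∀ i j k, i ≠ j → i ≠ k → j ≠ k → ∀ l m, A i k l - m • B i j k l = A j k m - l • B j i k m)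
    (hD : ∀ i j k, i ≠ j → i ≠ k → j ≠ k → ∀ l, A i k l - A i j l = -((l - a) • B i j k l))
    (hS : ∀ i j k, i ≠ j → i ≠ k → j ≠ k → ∀ l, B j k i l = -B j i k l) :
    ∃ (y : K) (x : Fin N → K), (∀ i k, i ≠ k → ∀ l, A i k l = -(y + a • x k) + l • (x k - x i)) ∧
      ∀ i j k, i ≠ j → i ≠ k → j ≠ k → ∀ l, B i j k l = x j - x k := by
  have f0 : ∀ i j k, i ≠ j → i ≠ k → j ≠ k → ∀ l, A i k l = A j k 0 - l • B j i k 0 := by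
    intro i j k hij hik hjk l
    have := hJ i j k hij hik hjk l 0
    rwa [zero_smul, sub_zero] at this
  have f1 : ∀ i j k, i ≠ j → i ≠ k → j ≠ k → A i k 0 = A j k 0 := by
    intro i j k hij hik hjk
    simpa using f0 i j k hij hik hjk 0
  -- the `B` are constant
  have f2 : ∀ i j k, i ≠ j → i ≠ k → j ≠ k → ∀ l,
      B i j k l = B i j k 0 + l • (B j i k 1 - B j i k 0) := by
    intro i j k hij hik hjk l
    have e := hJ i j k hij hik hjk l 1
    rw [f0 i j k hij hik hjk l, f0 j i k hij.symm hjk hik 1, f1 j i k hij.symm hjk hik] at e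
    linear_combination (norm := module) -e
  have f3 : ∀ i j k, i ≠ j → i ≠ k → j ≠ k → ∀ l, B i j k l = B i j k 0 := by
    intro i j k hij hik hjk
    have e0 := hD i j k hij hik hjk 0
    have e1 := hD i j k hij hik hjk 1
    have e2 := hD i j k hij hik hjk 2
    have g : ∀ l, A i k l - A i j l = A j k 0 - A k j 0 - l • (B j i k 0 - B k i j 0) := by
      intro l
      rw [f0 i j k hij hik hjk, f0 i k j hik hij hjk.symm]
      module
    rw [g, f2 i j k hij hik hjk] at e0 e1 e2
    -- In `hD` the left side is affine in l and the right side quadratic; half the second difference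
    -- over l = 0, 1, 2 isolates the quadratic coefficient, the slope of B up to sign.
    have e3 : B j i k 1 - B j i k 0 = 0 := by
      linear_combination (norm := module) (1/2 : ℂ) • e2 - e1 + (1/2 : ℂ) • e0
    intro l
    rw [f2 i j k hij hik hjk, e3, smul_zero, add_zero]
  set s : Fin N → Fin N → K := fun i k => A i k 1 - A i k 0 with hs
  have g1 : ∀ i j k, i ≠ j → i ≠ k → j ≠ k → ∀ l, B i j k l = -s j k := by
    intro i j k hij hik hjk l
    rw [hs, f3 i j k hij hik hjk l]
    have e := f0 j i k hij.symm hjk hik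
    simp only [e 1, e 0]
    module
  have g2 : ∀ i k, i ≠ k → ∀ l, A i k l = A i k 0 + l • s i k := by
    intro i k hik l
    obtain ⟨j, hji, hjk⟩ := exists_ne_ne hN i k
    rw [f0 i j k hji.symm hik hjk l, g1 j i k hji hjk hik, f1 i j k hji.symm hik hjk]
    module
  have g3 : ∀ i k, i ≠ k → s k i = -s i k := by
    intro i k hik
    obtain ⟨j, hji, hjk⟩ := exists_ne_ne hN i k
    have e := hS i j k hji.symm hik hjk 0
    rw [g1 j k i hjk hji hik.symm, g1 j i k hji hjk hik] at e
    linear_combination (norm := module) -e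
  have g4 : ∀ i j k, i ≠ j → i ≠ k → j ≠ k → s i k - s i j = s j k := by
    intro i j k hij hik hjk
    have e0 := hD i j k hij hik hjk 0
    have e1 := hD i j k hij hik hjk 1
    rw [g1 i j k hij hik hjk] at e0 e1
    simp only [hs] at e0 e1 ⊢
    linear_combination (norm := module) e1 - e0
  have g5 : ∀ i j k, i ≠ j → i ≠ k → j ≠ k → A i k 0 - A i j 0 = -(a • s j k) := by
    intro i j k hij hik hjk
    rw [hD i j k hij hik hjk 0, g1 i j k hij hik hjk]
    module
  -- A base point: xₖ is the slope from o to k, normalized by x_o = 0, and p serves only to name the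
  -- common value of Aᵢₒ at l = 0.
  let o : Fin N := ⟨0, by omega⟩
  obtain ⟨p, hpo, -⟩ := exists_ne_ne hN o o
  set x : Fin N → K := fun k => if k = o then 0 else s o k with hx
  have hxo : x o = 0 := if_pos rfl
  have hxk : ∀ k, k ≠ o → x k = s o k := fun k hk => if_neg hk
  have g6 : ∀ i k, i ≠ k → s i k = x k - x i := by
    intro i k hik
    by_cases hi : i = o
    · rw [hi, hxo, hxk k (hi ▸ hik.symm), sub_zero]
    · by_cases hk : k = o
      · rw [hk, hxo, hxk i hi, zero_sub, g3 o i (Ne.symm hi)]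
      · rw [hxk k hk, hxk i hi, g4 o i k (Ne.symm hi) (Ne.symm hk) hik]
  have g7 : ∀ i k, i ≠ k → A i k 0 = A p o 0 - a • x k := by
    intro i k hik
    by_cases hk : k = o
    · subst hk
      rw [hxo, smul_zero, sub_zero]
      by_cases hip : i = p
      · rw [hip]
      · exact f1 i p o hip hik hpo
    · obtain ⟨q, hqo, hqk⟩ := exists_ne_ne hN o k
      have e1 : A i k 0 = A q k 0 := by
        by_cases hiq : i = q
        · rw [hiq]
        · exact f1 i q k hiq hik hqk
      have e2 : A q o 0 = A p o 0 := by
        by_cases hqp : q = p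
        · rw [hqp]
        · exact f1 q p o hqp hqo hpo
      have e3 := g5 q o k hqo hqk (Ne.symm hk)
      rw [g6 o k (Ne.symm hk), hxo, e2] at e3
      rw [e1]
      linear_combination (norm := module) e3
  refine ⟨-A p o 0, x, fun i k hik l => ?_, fun i j k hij hik hjk l => ?_⟩
  · rw [g2 i k hik, g6 i k hik, g7 i k hik]
    module
  · rw [g1 i j k hij hik hjk, g6 j k hjk]
    module

end

end LieConf

/-! ### Constant-term coboundaries, normalized cocycles and generators -/

namespace LieConf

open Polynomial TensorProduct

noncomputable section

variable {N : ℕ}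

open LieConformalSuperalgebra

/-- Brackets of derivations do not involve λ. Degree at least three keeps ∂ᵢF in degree two or more,
or zero, so that u plays no role. -/
theorem wBr_pdW_curlW {u : Gr N} (hu : LieConf.inv N u = u) {F : Gr N} {J : Finset (Fin N)}
    (huw : IsWt Finset.univ u) (hF : IsWt J F) (hJ : 3 ≤ J.card) (t : ℂ[X]) (i j k : Fin N) :
    wBr t (pdW u i) (curlW u j k F) = -curlW u j k (pd i F) := by
  have hu1 : inv N (1 - u) = 1 - u := by rw [map_sub, inv_one, hu]
  have d : Deep u F := Deep.of_isWt huw hF (by omega)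
  have di : ∀ i, Deep u (pd i F) := fun i => by
    by_cases hi : i ∈ J
    · exact Deep.of_isWt huw (hF.pd i) (by rw [Finset.card_erase_of_mem hi]; omega)
    · rw [hF.2 i hi]; exact ⟨by simp, by simp, by simp, by simp, by simp, by simp⟩
  have e1 : ∀ m l, pd m (1 - u) * pd l F = 0 := fun m l => by
    rw [map_sub, pd_one, zero_sub, neg_mul, (di l).pd_mul, neg_zero]
  have e2 : ∀ l, (1 - u) * pd i (pd l F) = pd i (pd l F) := fun l => by
    rw [sub_mul, one_mul, (di l).mul_pd, sub_zero]
  rw [d.curlW, (di i).curlW, pdW, wBr_add_right, wBr_vecW_vecW, wBr_vecW_vecW, hu1, e1, e1, e2, e2,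
    pd_pd i j, pd_pd i k]
  simp only [map_zero, add_zero, map_neg]
  abel

namespace IsDivFree

variable {R : Type*} [AddCommGroup R] [Module ℂ R] [Module ℂ[X] R] [IsScalarTower ℂ ℂ[X] R]
  [LieConformalSuperalgebra R]
  {e : R →ₗ[ℂ[X]] W N} {u : Gr N} {a : ℂ} (h : IsDivFree e u a)

include h

theorem brL_pd_curl {J : Finset (Fin N)} {F : Gr N} (hF : IsWt J F) (hJ : 3 ≤ J.card) (t : ℂ[X])
    (i j k : Fin N) : brL t (h.pd i) (h.curl j k F) = -h.curl j k (LieConf.pd i F) := by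
  apply h.injective
  rw [h.map_brL, coe_pd, coe_curl, wBr_pdW_curlW h.top.inv h.top.isWt hF hJ, map_neg, coe_curl]

theorem curl_eq_zero {F : Gr N} (hF : IsWt ∅ F) (i j : Fin N) : h.curl i j F = 0 := by
  apply h.injective
  rw [coe_curl, curlW_apply, hF.2 i (Finset.notMem_empty i), hF.2 j (Finset.notMem_empty j)]
  simp

section Functional

variable {K : Type*} [AddCommGroup K] [Module ℂ K]

theorem aug_one_sub : aug N (1 - u) = 1 := by
  rw [map_sub, aug_one, h.top.aug_eq_zero (by have := h.two_lt; omega), sub_zero]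

theorem constTerm_pot_xi (y : K) (x : Fin N → K) (k : Fin N) :
    constTerm y x (e (h.pot k (xi k))) = y + a • x k := by
  have e1 : (1 - u) * LieConf.inv N (xi k) = -xi k := by
    rw [inv_xi, mul_neg, sub_mul, one_mul, h.top.mul_xi, sub_zero]
  rw [coe_pot, potW_apply, map_add, e1, sub_smul (X : ℂ[X]) (C a) (vecW k (-xi k)), map_sub,
    constTerm_X_smul, C_smul (M := W N),
    map_smul, constTerm_vecW, constTerm_funW, pd_xi, if_pos rfl, mul_one, h.aug_one_sub, map_neg,
    map_neg, pd_xi, if_pos rfl, aug_one]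
  module

theorem constTerm_curl_xi (y : K) (x : Fin N → K) {i k : Fin N} (hik : i ≠ k) :
    constTerm y x (e (h.curl i k (xi i * xi k))) = x k - x i := by
  rw [coe_curl, curlW_xi_xi h.top.mul_xi hik, map_sub, constTerm_vecW, constTerm_vecW, pd_xi,
    if_pos rfl, pd_xi, if_pos rfl, aug_one, one_smul, one_smul]

end Functional

/-! ### Normalized cocycles -/

section Normalized

variable {K : Type*} [AddCommGroup K] [Module ℂ K] {c : Fin N → ℂ} (hc : ∑ i, c i = 0)

omit h in
/-- The weights that occur in the pairs of a generator with an element of a spanning set. -/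
def weights (c : Fin N → ℂ) : Finset ℂ :=
  (Finset.univ.image fun p : Finset (Fin N) × Fin N × Fin N =>
    -c p.2.1 + (∑ l ∈ p.1, c l - c p.2.2)) ∪
  Finset.univ.image fun p : Finset (Fin N) × Fin N × Fin N × Fin N =>
    -c p.2.1 + (∑ l ∈ p.1, c l - c p.2.2.1 - c p.2.2.2)

omit h in
theorem mem_weights_pair (c : Fin N → ℂ) (J : Finset (Fin N)) (i k : Fin N) :
    -c i + (∑ l ∈ J, c l - c k) ∈ weights c :=
  Finset.mem_union_left _ (Finset.mem_image.mpr ⟨(J, i, k), Finset.mem_univ _, rfl⟩)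

omit h in
theorem mem_weights_triple (c : Fin N → ℂ) (J : Finset (Fin N)) (i j k : Fin N) :
    -c i + (∑ l ∈ J, c l - c j - c k) ∈ weights c :=
  Finset.mem_union_right _ (Finset.mem_image.mpr ⟨(J, i, j, k), Finset.mem_univ _, rfl⟩)

/-- Vanishing on pairs of eigenvectors of the torus element `∑ᵢ cᵢ ξᵢ ∂ᵢ` of nonzero weight. -/
def IsNormalized (α : ℂ → R →ₗ[ℂ] R →ₗ[ℂ] K) : Prop :=
  ∀ (wb wv : ℂ) (b v : R), wb + wv ∈ weights c → wb + wv ≠ 0 →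
    brL (C 0) (h.torus hc) b = wb • b → brL (C 0) (h.torus hc) v = wv • v → ∀ l, α l b v = 0

theorem exists_isNormalized {α : ℂ → R →ₗ[ℂ] R →ₗ[ℂ] K} (hα : IsCocycle α) :
    ∃ φ : R →ₗ[ℂ] K, (∀ z, φ ((X : ℂ[X]) • z) = 0) ∧
      h.IsNormalized hc fun l => α l - coboundary φ l := by
  obtain ⟨φ, hφ, hn⟩ := hα.exists_normalization (h.torus_mem hc) (weights c)
  exact ⟨φ, hφ, fun wb wv b v hS h0 hb hv l => by
    rw [LinearMap.sub_apply, LinearMap.sub_apply, coboundary_apply,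
      hn wb wv b v hS h0 hb hv l, sub_self]⟩

/-- The bracket of two weight vectors is a weight vector for the sum of the weights, and an
invariant functional vanishes on nonzero weights. -/
theorem isNormalized_coboundary {φ : R →ₗ[ℂ] K}
    (hφ : ∀ z, φ (brL (C 0) (h.torus hc) z) = 0) : h.IsNormalized hc (coboundary φ) := by
  intro wb wv b v _ h0 hb hv l
  have e := brL_zero_derivation (h.torus_mem hc) l b v
  rw [hb, hv, LinearMap.map_smul, LinearMap.smul_apply, LinearMap.map_smul, ← add_smul] at e
  have e2 := hφ (brL (C l) b v)
  rw [e, LinearMap.map_smul] at e2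
  exact (smul_eq_zero.mp e2).resolve_left h0

variable {hc} {α : ℂ → R →ₗ[ℂ] R →ₗ[ℂ] K}
  (hg : ∀ n : Fin N → ℤ, ∑ i, n i * c i = 0 → ∀ i j, n i = n j)

section

variable (hn : h.IsNormalized hc α)

include hg hn

theorem IsNormalized.pot_eq_zero {b : R} {i : Fin N}
    (hb : brL (C 0) (h.torus hc) b = (-c i) • b) {J : Finset (Fin N)} {F : Gr N} (hF : IsWt J F)
    {k : Fin N} (hJ : ¬(i ≠ k ∧ J = {i, k})) (l : ℂ) : α l b (h.pot k F) = 0 :=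
  hn _ _ _ _ (mem_weights_pair c J i k)
    (fun h0 => hJ (eq_pair_of_weight h.two_lt hg h0)) hb (h.brL_torus_pot hc k hF) l

theorem IsNormalized.curl_eq_zero {b : R} {i : Fin N}
    (hb : brL (C 0) (h.torus hc) b = (-c i) • b) {J : Finset (Fin N)} {F : Gr N} (hF : IsWt J F)
    {j k : Fin N} (hJ : ¬(i ≠ j ∧ i ≠ k ∧ j ≠ k ∧ J = {i, j, k})) (l : ℂ) :
    α l b (h.curl j k F) = 0 := by
  by_cases h0 : -c i + (∑ l ∈ J, c l - c j - c k) = 0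
  · rcases eq_triple_of_weight h.two_lt hg h0 with rfl | h1
    · rw [h.curl_eq_zero hF, map_zero]
    · exact absurd h1 hJ
  · exact hn _ _ _ _ (mem_weights_triple c J i j k) h0 hb (h.brL_torus_curl hc j k hF) l

/-- Elements of weight -cᵢ can pair nontrivially only with the partners singled out by
`eq_pair_of_weight` and `eq_triple_of_weight`; the spanning set reduces everything to these. -/
theorem IsNormalized.eq_zero_of_basis (hα : IsCocycle α) {b : R} {i : Fin N}
    (hb : brL (C 0) (h.torus hc) b = (-c i) • b)
    (h1 : ∀ k F, i ≠ k → IsWt {i, k} F → ∀ l, α l b (h.pot k F) = 0)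
    (h2 : ∀ j k F, i ≠ j → i ≠ k → j ≠ k → IsWt {i, j, k} F → ∀ l, α l b (h.curl j k F) = 0)
    (l : ℂ) (z : R) : α l b z = 0 := by
  induction z using h.induction with
  | pot k J F hF =>
    by_cases hJ : i ≠ k ∧ J = {i, k}
    · exact h1 k F hJ.1 (hJ.2 ▸ hF) l
    · exact hn.pot_eq_zero h hg hb hF hJ l
  | curl j k J F hF =>
    by_cases hJ : i ≠ j ∧ i ≠ k ∧ j ≠ k ∧ J = {i, j, k}
    · exact h2 j k F hJ.1 hJ.2.1 hJ.2.2.1 (hJ.2.2.2 ▸ hF) l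
    · exact hn.curl_eq_zero h hg hb hF hJ l
  | zero => rw [map_zero]
  | add x y hx hy => rw [map_add, hx, hy, add_zero]
  | hX x hx => rw [hα.X_right, hx, smul_zero]
  | hC r x hx => rw [LinearMap.map_smul, hx, smul_zero]

/-- A top potential has weight ∑ cⱼ - cᵢ = -cᵢ, the weight of `h.pd i`, so only pairs of
complementary weight are left, and there every cocycle vanishes. -/
theorem IsNormalized.pot_top_eq_zero (hα : IsCocycle α) (i : Fin N) {G : Gr N}
    (hG : IsWt Finset.univ G) (l : ℂ) (z : R) : α l (h.pot i G) z = 0 := by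
  refine hn.eq_zero_of_basis h hg hα (i := i) ?_ (fun k F hik hF l => ?_)
    (fun j k F hij hik hjk hF l => ?_) l z
  · rw [h.brL_torus_pot hc i hG, hc, zero_sub]
  · exact h.cocycle_pot_pot hα hG hF hik (by simp) (by simp) l
  · exact h.cocycle_pot_curl hα hG hF hij hik hjk (by simp) (by simp) (by simp) l

end

/-- The elements `pd i` and `pot i F`, `F` of top degree, generate the whole algebra. -/
theorem eq_zero_of_generators (hα : IsCocycle α) (h1 : ∀ i l z, α l (h.pd i) z = 0)
    (h2 : ∀ i G l z, IsWt Finset.univ G → α l (h.pot i G) z = 0) (l : ℂ) (y z : R) :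
    α l y z = 0 := by
  -- Descending induction on the degree: for i ∉ J, the bracket at λ = 0 of `h.pd i` with the
  -- potential of ξᵢF is minus the potential of F.
  have hpot : ∀ n, ∀ J : Finset (Fin N), N ≤ J.card + n → ∀ F, IsWt J F → ∀ j l z,
      α l (h.pot j F) z = 0 := by
    intro n
    induction n with
    | zero =>
      intro J hJ F hF j l z
      have hJ' : J = Finset.univ :=
        Finset.card_eq_iff_eq_univ J |>.mp
          (le_antisymm (Finset.card_le_univ J) (by rwa [Fintype.card_fin]))
      exact h2 j F l z (hJ' ▸ hF)
    | succ n ih =>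
      intro J hJ F hF j l z
      by_cases hu : J = Finset.univ
      · exact h2 j F l z (hu ▸ hF)
      obtain ⟨i, hi⟩ : ∃ i, i ∉ J := by
        by_contra! h0
        exact hu (Finset.eq_univ_of_forall h0)
      rcases Finset.eq_empty_or_nonempty J with rfl | hne
      · obtain ⟨r, rfl⟩ := hF.eq_algebraMap
        -- For constant F the bracket formula is unavailable, as ξᵢF has degree one, but the
        -- potential is a ℂ[∂]-multiple of `h.pd j`.
        rw [h.pot_algebraMap, hα.smul_left, h1, smul_zero]
      · have hw : IsWt (insert i J) (xi i * F) := hF.xi_mul hi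
        have hcard := Finset.card_insert_of_notMem hi
        have hpos := hne.card_pos
        have e := h.brL_pd_pot hw (by omega) 0 i j
        obtain ⟨q, hq⟩ := h.pot_mem hw j
        have e2 := hα.brL_mem_ker (h.pd_mem i) hq (h1 i) (ih _ (by omega) _ hw j) 0 l z
        rw [e, hF.pd_xi_mul hi, zero_smul, add_zero, map_neg, LinearMap.neg_apply, neg_eq_zero]
          at e2
        exact e2
  have hpot' : ∀ J F, IsWt J F → ∀ j l z, α l (h.pot j F) z = 0 := fun J => hpot N J (by omega)
  induction y using h.induction generalizing l with
  | pot k J F hF => exact hpot' J F hF k l z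
  | curl j k J F hF =>
    by_cases hJ : 2 ≤ J.card
    -- Taking λ = 1 exposes the curl next to a potential that is already known to be annihilated.
    · have e := h.brL_pd_pot hF.isWt_inv hJ 1 j k
      obtain ⟨q, hq⟩ := h.pot_mem hF.isWt_inv k
      have e2 := hα.brL_mem_ker (h.pd_mem j) hq (h1 j) (hpot' _ _ hF.isWt_inv k) 1 l z
      rw [e, one_smul, inv_inv, map_add, map_neg, LinearMap.add_apply, LinearMap.neg_apply,
        hpot' _ _ (hF.isWt_inv.pd j), neg_zero, zero_add] at e2
      exact e2
    · rcases Finset.eq_empty_or_nonempty J with rfl | hne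
      · rw [h.curl_eq_zero hF, map_zero, LinearMap.zero_apply]
      · have hpos := hne.card_pos
        obtain ⟨i, rfl⟩ := Finset.card_eq_one.mp (show J.card = 1 by omega)
        have hi := hF.pd i
        rw [Finset.erase_singleton] at hi
        obtain ⟨r, hr⟩ := hi.eq_algebraMap
        have e : F = r • xi i := by
          rw [← hF.xi_mul_pd (Finset.mem_singleton_self i), hr, ← Algebra.commutes,
            Algebra.smul_def]
        rw [e, LinearMap.map_smul, h.curl_xi, LinearMap.map_smul, LinearMap.smul_apply, map_add,
          LinearMap.add_apply]
        split_ifs <;> simp [h1]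
  | zero => rw [map_zero, LinearMap.zero_apply]
  | add x y hx hy => rw [map_add, LinearMap.add_apply, hx, hy, add_zero]
  | hX x hx => rw [hα.X_left, hx, smul_zero, neg_zero]
  | hC r x hx => rw [LinearMap.map_smul, LinearMap.smul_apply, hx, smul_zero]

end Normalized

end IsDivFree

end

end LieConf

/-! ### Values of a cocycle on lowest-degree elements; triviality of cocycles -/

namespace LieConf

open Polynomial TensorProduct

noncomputable section

variable {N : ℕ}

open LieConformalSuperalgebra

theorem pd_xi_mul_xi {i k : Fin N} (hik : i ≠ k) : pd i (xi i * xi k) = xi k := by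
  rw [pd_xi_mul_self, pd_xi, if_neg hik, mul_zero, sub_zero]

theorem pd_xi_mul_xi_mul_xi {i j k : Fin N} (hij : i ≠ j) (hik : i ≠ k) :
    pd i (xi i * (xi j * xi k)) = xi j * xi k := by
  rw [pd_xi_mul_self, pd_xi_mul_of_ne hij, pd_xi, if_neg hik, mul_zero, neg_zero, mul_zero,
    sub_zero]

theorem inv_xi_mul_xi_mul_xi (i j k : Fin N) :
    inv N (xi i * (xi j * xi k)) = -(xi i * (xi j * xi k)) := by
  rw [inv_mul, inv_mul, inv_xi, inv_xi, inv_xi, neg_mul_neg, neg_mul]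

namespace IsDivFree

variable {R : Type*} [AddCommGroup R] [Module ℂ R] [Module ℂ[X] R] [IsScalarTower ℂ ℂ[X] R]
  [LieConformalSuperalgebra R]
  {e : R →ₗ[ℂ[X]] W N} {u : Gr N} {a : ℂ} (h : IsDivFree e u a)

include h

variable {K : Type*} [AddCommGroup K] [Module ℂ K] {α : ℂ → R →ₗ[ℂ] R →ₗ[ℂ] K}

/-- The Jacobi identity for `pd i`, `pd j` and `pot k (ξᵢξⱼξₖ)`. -/
theorem cocycle_pd_pot (hα : IsCocycle α) {i j k : Fin N} (hij : i ≠ j) (hik : i ≠ k)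
    (hjk : j ≠ k) (l m : ℂ) :
    α l (h.pd i) (h.pot k (xi i * xi k)) -
        m • α l (h.pd i) (h.curl j k (xi i * (xi j * xi k))) =
      α m (h.pd j) (h.pot k (xi j * xi k)) -
        l • α m (h.pd j) (h.curl i k (xi j * (xi i * xi k))) := by
  have hw : IsWt {i, j, k} (xi i * (xi j * xi k)) := isWt_xi_mul_xi_mul_xi hij hik hjk
  have hcard : ({i, j, k} : Finset (Fin N)).card = 3 :=
    Finset.card_eq_three.mpr ⟨i, j, k, hij, hik, hjk, rfl⟩
  have e := hα.jacobi_odd l m (h.pd_mem i) (h.pd_mem j) (h.pot k (xi i * (xi j * xi k)))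
  rw [h.brL_pd_pot hw (by omega), h.brL_pd_pot hw (by omega), h.brL_pd_pd,
    pd_xi_mul_xi_mul_xi hij hik, inv_xi_mul_xi_mul_xi, map_neg, map_neg (α (l + m)),
    LinearMap.neg_apply,
    -- For u ≠ 0 the bracket of `h.pd i` and `h.pd j` is a curl of u, but u has top degree, so α
    -- vanishes on it paired with the potential of ξᵢξⱼξₖ.
    h.cocycle_curl_pot hα h.top.isWt hw hij hik hjk (by simp) (by simp) (by simp),
    xi_mul_xi_mul i j, map_neg (LieConf.pd j), pd_xi_mul_xi_mul_xi hij.symm hjk] at e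
  rw [xi_mul_xi_mul i j]
  simp only [map_neg, map_add, LinearMap.map_smul, neg_neg] at e ⊢
  linear_combination (norm := module) e

/-- A cocycle is determined on `pd i` by finitely many vectors. -/
theorem exists_cocycle_values (hα : IsCocycle α) : ∃ (y : K) (x : Fin N → K),
    (∀ i k, i ≠ k → ∀ l, α l (h.pd i) (h.pot k (xi i * xi k)) =
      -(y + a • x k) + l • (x k - x i)) ∧
    ∀ i j k, i ≠ j → i ≠ k → j ≠ k → ∀ l,
      α l (h.pd i) (h.curl j k (xi i * (xi j * xi k))) = x j - x k := by
  refine exists_solution h.two_lt a (fun i k l => α l (h.pd i) (h.pot k (xi i * xi k)))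
    (fun i j k l => α l (h.pd i) (h.curl j k (xi i * (xi j * xi k))))
    (fun i j k hij hik hjk l m => h.cocycle_pd_pot hα hij hik hjk l m)
    (fun i j k hij hik hjk l => ?_) (fun i j k hij hik hjk l => ?_)
  · rw [← map_sub, h.pot_sub_pot hij hik hjk, map_neg, hα.smul_right, eval_sub, eval_X, eval_C]
  · rw [h.curl_symm, xi_anticomm k i, mul_neg, map_neg, map_neg]

section

variable (y : K) (x : Fin N → K)

/-- The right side is the general solution found in `exists_solution`, so a constant-term functional
can absorb all remaining values of the cocycle. -/
theorem coboundary_constTerm_pot {i k : Fin N} (hik : i ≠ k) (l : ℂ) :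
    coboundary (constTerm y x ∘ₗ e.restrictScalars ℂ) l (h.pd i) (h.pot k (xi i * xi k)) =
      -(y + a • x k) + l • (x k - x i) := by
  rw [coboundary_apply, h.brL_pd_pot (isWt_xi_mul_xi hik) (Finset.card_pair hik).ge,
    pd_xi_mul_xi hik, inv_mul, inv_xi, inv_xi, neg_mul_neg, LinearMap.comp_apply,
    LinearMap.restrictScalars_apply, map_add, map_neg, LinearMap.map_smul_of_tower, map_add,
    map_neg, LinearMap.map_smul, h.constTerm_pot_xi, h.constTerm_curl_xi y x hik]

theorem coboundary_constTerm_curl {i j k : Fin N} (hij : i ≠ j) (hik : i ≠ k) (hjk : j ≠ k)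
    (l : ℂ) : coboundary (constTerm y x ∘ₗ e.restrictScalars ℂ) l (h.pd i)
      (h.curl j k (xi i * (xi j * xi k))) = x j - x k := by
  rw [coboundary_apply, h.brL_pd_curl (isWt_xi_mul_xi_mul_xi hij hik hjk)
    (Finset.card_eq_three.mpr ⟨i, j, k, hij, hik, hjk, rfl⟩).ge, pd_xi_mul_xi_mul_xi hij hik,
    LinearMap.comp_apply, LinearMap.restrictScalars_apply, map_neg, map_neg,
    h.constTerm_curl_xi y x hjk, neg_sub]

end

/-- Cocycles with values in a vector space with trivial action are coboundaries. -/
theorem exists_eq_coboundary (hα : IsCocycle α) : ∃ φ : R →ₗ[ℂ] K,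
    (∀ z, φ ((X : ℂ[X]) • z) = 0) ∧ ∀ l x y, α l x y = φ (brL (C l) x y) := by
  obtain ⟨c, hc, hg⟩ := exists_generic_weights (N := N) (by have := h.two_lt; omega)
  obtain ⟨φ, hφ, hn⟩ := h.exists_isNormalized hc hα
  have hβ := hα.sub_coboundary hφ
  obtain ⟨y, x, hA, hB⟩ := h.exists_cocycle_values hβ
  set ψ : R →ₗ[ℂ] K := constTerm y x ∘ₗ e.restrictScalars ℂ with hψ
  have hψX : ∀ z, ψ ((X : ℂ[X]) • z) = 0 := fun z => by
    rw [hψ, LinearMap.comp_apply, LinearMap.restrictScalars_apply, map_smul, constTerm_X_smul]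
  have hψn : h.IsNormalized hc (coboundary ψ) := h.isNormalized_coboundary hc fun z => by
    rw [hψ, LinearMap.comp_apply, LinearMap.restrictScalars_apply, h.map_brL, C_0, coe_torus,
      constTerm_torusW]
  have hγ := hβ.sub_coboundary hψX
  have hγn : h.IsNormalized hc fun l => α l - coboundary φ l - coboundary ψ l :=
    fun wb wv b v hS h0 hb hv l => by
      have e := hn wb wv b v hS h0 hb hv l
      have e' := hψn wb wv b v hS h0 hb hv l
      rw [LinearMap.sub_apply, LinearMap.sub_apply, e', sub_zero]
      exact e
  -- The first coboundary removes the nonzero weights, the second one the finitely many values left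
  -- in weight zero.
  have hpd : ∀ i l z, (α l - coboundary φ l - coboundary ψ l) (h.pd i) z = 0 := by
    intro i l z
    refine hγn.eq_zero_of_basis h hg hγ (h.brL_torus_pd hc i) (fun k F hik hF l => ?_)
      (fun j k F hij hik hjk hF l => ?_) l z
    · obtain ⟨r, rfl⟩ := hF.exists_of_pair hik
      rw [LinearMap.map_smul, LinearMap.map_smul, LinearMap.sub_apply, LinearMap.sub_apply,
        hA i k hik, h.coboundary_constTerm_pot y x hik, sub_self, smul_zero]
    · obtain ⟨r, rfl⟩ := hF.exists_of_triple hij hik hjk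
      rw [LinearMap.map_smul, LinearMap.map_smul, LinearMap.sub_apply, LinearMap.sub_apply,
        hB i j k hij hik hjk, h.coboundary_constTerm_curl y x hij hik hjk, sub_self, smul_zero]
  refine ⟨φ + ψ, fun z => by rw [LinearMap.add_apply, hφ, hψX, add_zero], fun l b v => ?_⟩
  have e := h.eq_zero_of_generators hγ hpd
    (fun i G l z hG => hγn.pot_top_eq_zero h hg hγ i hG l z) l b v
  rw [LinearMap.sub_apply, LinearMap.sub_apply, LinearMap.sub_apply, LinearMap.sub_apply,
    coboundary_apply, coboundary_apply] at e
  rw [LinearMap.add_apply]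
  linear_combination (norm := module) e

end IsDivFree

end

end LieConf

namespace LieConf

open Polynomial TensorProduct

noncomputable section

open LieConformalSuperalgebra

/-! ### Homomorphisms and the values of the `λ`-bracket -/

theorem eq_zero_of_sum_pow_smul {V : Type*} [AddCommGroup V] [Module ℂ V] {m : ℕ} {v : ℕ → V}
    (h : ∀ l : ℂ, ∑ n ∈ Finset.range m, l ^ n • v n = 0) {n : ℕ} (hn : n < m) : v n = 0 := by
  refine (Module.forall_dual_apply_eq_zero_iff ℂ (v n)).mp fun f => ?_
  have e : (∑ n ∈ Finset.range m, C (f (v n)) * X ^ n : ℂ[X]) = 0 := by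
    refine Polynomial.funext fun l => ?_
    have e1 := congrArg f (h l)
    rw [map_sum, map_zero] at e1
    rw [eval_finsetSum, eval_zero, ← e1]
    exact Finset.sum_congr rfl fun n _ => by
      rw [map_smul, eval_mul, eval_C, eval_pow, eval_X, smul_eq_mul, mul_comm]
  have e2 := congrArg (fun p : ℂ[X] => p.coeff n) e
  simpa [finsetSum_coeff, coeff_C_mul_X_pow, hn] using e2

section

variable {R : Type*} [AddCommGroup R] [Module ℂ R] [Module ℂ[X] R] [IsScalarTower ℂ ℂ[X] R]
  [LieConformalSuperalgebra R]

theorem brL_eq_sum {a b : R} {m : ℕ} (hm : ∀ n, m ≤ n → nprod n a b = 0) (l : ℂ) :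
    brL (C l) a b = ∑ n ∈ Finset.range m, l ^ n • ((n.factorial : ℂ)⁻¹ • nprod n a b) := by
  rw [brL_apply, lamEval, finsum_eq_sum_of_support_subset (s := Finset.range m)]
  · exact Finset.sum_congr rfl fun n _ => by rw [← C_pow, C_smul, smul_comm]
  · intro n hn
    simp only [Finset.coe_range, Set.mem_Iio]
    by_contra h
    exact hn (by simp [hm n (not_lt.mp h)])

variable {S : Type*} [AddCommGroup S] [Module ℂ S] [Module ℂ[X] S] [IsScalarTower ℂ ℂ[X] S]
  [LieConformalSuperalgebra S]

theorem map_brL_of_map_nprod (f : R →ₗ[ℂ] S) {a b : R}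
    (h : ∀ n, f (nprod n a b) = nprod n (f a) (f b)) (l : ℂ) :
    f (brL (C l) a b) = brL (C l) (f a) (f b) := by
  obtain ⟨m, hm⟩ := locality a b
  rw [brL_eq_sum hm, brL_eq_sum (m := m) fun n hn => by rw [← h, hm n hn, map_zero], map_sum]
  exact Finset.sum_congr rfl fun n _ => by rw [map_smul, map_smul, h]

/-- By locality both sides are polynomials in λ, and a polynomial that vanishes at all complex
numbers has zero coefficients. -/
theorem map_nprod_of_map_brL (f : R →ₗ[ℂ] S) {a b : R}
    (h : ∀ l, f (brL (C l) a b) = brL (C l) (f a) (f b)) (n : ℕ) :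
    f (nprod n a b) = nprod n (f a) (f b) := by
  obtain ⟨m, hm⟩ := locality a b
  obtain ⟨m', hm'⟩ := locality (f a) (f b)
  have hn := (Nat.lt_succ_self n).trans_le (le_max_right (max m m') (n + 1))
  have e := eq_zero_of_sum_pow_smul (m := max (max m m') (n + 1))
    (v := fun n => (n.factorial : ℂ)⁻¹ • (f (nprod n a b) - nprod n (f a) (f b)))
    (fun l => by
      have e := h l
      rw [brL_eq_sum (m := max (max m m') (n + 1)) fun k hk => hm k (by omega),
        brL_eq_sum (m := max (max m m') (n + 1)) fun k hk => hm' k (by omega), map_sum] at e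
      rw [← sub_eq_zero.mpr e, ← Finset.sum_sub_distrib]
      exact Finset.sum_congr rfl fun k _ => by rw [map_smul, map_smul, smul_sub, smul_sub]) hn
  exact sub_eq_zero.mp ((smul_eq_zero.mp e).resolve_left
    (inv_ne_zero (by exact_mod_cast n.factorial_ne_zero)))

end

/-- A `ℂ`-linear map which commutes with `∂` is `ℂ[∂]`-linear. -/
def polyLinear {R K : Type*} [AddCommGroup R] [Module ℂ R] [Module ℂ[X] R] [IsScalarTower ℂ ℂ[X] R]
    [AddCommGroup K] [Module ℂ K] [Module ℂ[X] K] [IsScalarTower ℂ ℂ[X] K] (f : R →ₗ[ℂ] K)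
    (h : ∀ z, f ((X : ℂ[X]) • z) = (X : ℂ[X]) • f z) : R →ₗ[ℂ[X]] K where
  toFun := f
  map_add' := map_add f
  map_smul' p z := by
    rw [RingHom.id_apply]
    induction p using Polynomial.induction_on with
    | C c => rw [C_smul, C_smul, map_smul]
    | add p q hp hq => rw [add_smul, map_add, hp, hq, add_smul]
    | monomial n c hn =>
      rw [show (C c * X ^ (n + 1) : ℂ[X]) = X * (C c * X ^ n) by ring, mul_smul, h, hn,
        ← mul_smul]

/-! ### Central extensions and cocycles -/

section Extension

variable {K S R : Type*} [AddCommGroup K] [Module ℂ K] [Module ℂ[X] K]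
    [IsScalarTower ℂ ℂ[X] K] [LieConformalSuperalgebra K] [AddCommGroup S] [Module ℂ S]
    [Module ℂ[X] S] [IsScalarTower ℂ ℂ[X] S] [LieConformalSuperalgebra S] [AddCommGroup R]
    [Module ℂ R] [Module ℂ[X] R] [IsScalarTower ℂ ℂ[X] R] [LieConformalSuperalgebra R]
    {ι : K →ₗ[ℂ[X]] S} {π : S →ₗ[ℂ[X]] R} (h : IsCentralExtension ι π)

namespace IsCentralExtension

include h

theorem brL_ι_left (l : ℂ) (k : K) (x : S) : brL (C l) (ι k) x = 0 := by
  rw [brL_eq_sum (m := 0) fun n _ => h.central n k x, Finset.range_zero, Finset.sum_empty]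

theorem brL_ι_right (l : ℂ) (x : S) (k : K) : brL (C l) x (ι k) = 0 := by
  have key : ∀ {i j : ZMod 2} {k : K} {x : S}, k ∈ part i → x ∈ part j →
      brL (C l) x (ι k) = 0 := by
    intro i j k x hk hx
    rw [brL_apply, skew l (h.hom_ι.map_part i k hk) hx, lamEval, finsum_eq_zero_of_forall_eq_zero,
      smul_zero, neg_zero]
    intro n
    rw [h.central, smul_zero, smul_zero]
  obtain ⟨k₀, hk₀, k₁, hk₁, rfl⟩ := exists_homogeneous k
  obtain ⟨x₀, hx₀, x₁, hx₁, rfl⟩ := exists_homogeneous x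
  simp only [map_add, LinearMap.add_apply, key hk₀ hx₀, key hk₀ hx₁, key hk₁ hx₀, key hk₁ hx₁,
    add_zero]

theorem map_brL_π (l : ℂ) (x y : S) : π (brL (C l) x y) = brL (C l) (π x) (π y) :=
  map_brL_of_map_nprod (π.restrictScalars ℂ) (fun n => h.hom_π.map_nprod n x y) l

theorem exists_retraction (s : R →ₗ[ℂ[X]] S) (hs : π ∘ₗ s = LinearMap.id) :
    ∃ ρ : S →ₗ[ℂ[X]] K, ∀ z, ι (ρ z) = z - s (π z) := by
  have hr : ∀ z, (LinearMap.id - s ∘ₗ π : S →ₗ[ℂ[X]] S) z ∈ LinearMap.range ι := by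
    intro z
    refine (h.exact _).mp ?_
    have e := LinearMap.congr_fun hs (π z)
    simp only [LinearMap.comp_apply, LinearMap.id_apply] at e
    rw [LinearMap.sub_apply, map_sub, LinearMap.id_apply, LinearMap.comp_apply, e, sub_self]
  refine ⟨(LinearEquiv.ofInjective ι h.injective).symm.toLinearMap ∘ₗ
    LinearMap.codRestrict _ (LinearMap.id - s ∘ₗ π) hr, fun z => ?_⟩
  exact congrArg Subtype.val ((LinearEquiv.ofInjective ι h.injective).apply_symm_apply
    (LinearMap.codRestrict _ (LinearMap.id - s ∘ₗ π) hr z))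

/-- The component of k of the wrong parity is sent into both graded parts of S, so its image is
zero, and ι is injective. -/
theorem part_of_ι {i : ZMod 2} {k : K} (hk : ι k ∈ part i) : k ∈ part i := by
  obtain ⟨k₀, h₀, k₁, h₁, rfl⟩ := exists_homogeneous k
  have m₀ := h.hom_ι.map_part 0 _ h₀
  have m₁ := h.hom_ι.map_part 1 _ h₁
  have hd := Submodule.disjoint_def.mp (isCompl_part (R := S)).disjoint
  rw [map_add] at hk
  have hi : i = 0 ∨ i = 1 := by
    clear hk; revert i; decide
  rcases hi with rfl | rfl
  · have e := hd _ ((Submodule.add_mem_iff_right _ m₀).mp hk) m₁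
    rw [(injective_iff_map_eq_zero ι).mp h.injective _ e, add_zero]
    exact h₀
  · have e := hd _ m₀ ((Submodule.add_mem_iff_left _ m₁).mp hk)
    rw [(injective_iff_map_eq_zero ι).mp h.injective _ e, zero_add]
    exact h₁

variable {s : R →ₗ[ℂ[X]] S} {ρ : S →ₗ[ℂ[X]] K} (hs : π ∘ₗ s = LinearMap.id)
  (hρ : ∀ z, ι (ρ z) = z - s (π z))

include hs hρ

theorem brL_section (l : ℂ) (a b : R) :
    s (brL (C l) a b) = brL (C l) (s a) (s b) - ι (ρ (brL (C l) (s a) (s b))) := by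
  have e : ∀ a, π (s a) = a := fun a => LinearMap.congr_fun hs a
  rw [hρ, h.map_brL_π, e, e, sub_sub_cancel]

/-- This is the Jacobi identity of S on lifts. Replacing a bracket of lifts by the lift of the
bracket changes it by a central element, which outer brackets do not see; ∂ acting by zero on K
gives the sesquilinearity. -/
theorem isCocycle (hp : ∀ (i : ZMod 2) (a : R), a ∈ part i → s a ∈ part i) :
    IsCocycle (R := R) (K := K) fun l => ((brL (C l)).compl₁₂ (s.restrictScalars ℂ)
      (s.restrictScalars ℂ)).compr₂ (ρ.restrictScalars ℂ) where
  X_left l a b := by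
    change ρ (brL (C l) (s _) (s b)) = -(l • ρ (brL (C l) (s a) (s b)))
    rw [map_smul, brL_X_left, map_neg, LinearMap.map_smul_of_tower]
  X_right l a b := by
    change ρ (brL (C l) (s a) (s _)) = l • ρ (brL (C l) (s a) (s b))
    rw [map_smul, brL_X_right, map_add, map_smul, h.X_smul, zero_add, LinearMap.map_smul_of_tower]
  jacobi l m i j a b c ha hb := by
    change ρ (brL (C l) (s a) (s (brL (C m) b c))) =
      ρ (brL (C (l + m)) (s (brL (C l) a b)) (s c)) +
        superSign i j • ρ (brL (C m) (s b) (s (brL (C l) a c)))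
    have e : brL (C l) (s a) (brL (C m) (s b) (s c)) =
        brL (C (l + m)) (brL (C l) (s a) (s b)) (s c) +
          superSign i j • brL (C m) (s b) (brL (C l) (s a) (s c)) :=
      LieConformalSuperalgebra.jacobi l m (s c) (hp i a ha) (hp j b hb)
    rw [h.brL_section hs hρ, h.brL_section hs hρ, h.brL_section hs hρ, map_sub, map_sub, map_sub,
      LinearMap.sub_apply, map_sub (brL (C m) (s b)), h.brL_ι_left, h.brL_ι_right, h.brL_ι_right,
      map_zero, sub_zero, sub_zero, sub_zero,
      e, map_add, LinearMap.map_smul_of_tower]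

end IsCentralExtension

end Extension

end

end LieConf

/-! ### Parity correction and splitting of central extensions -/

namespace LieConf

open Polynomial TensorProduct

noncomputable section

open LieConformalSuperalgebra

section EvenPart

variable {R K : Type*} [AddCommGroup R] [Module ℂ R] [Module ℂ[X] R] [IsScalarTower ℂ ℂ[X] R]
  [LieConformalSuperalgebra R] [AddCommGroup K] [Module ℂ K] [Module ℂ[X] K]
  [IsScalarTower ℂ ℂ[X] K] [LieConformalSuperalgebra K]

/-- The parity-preserving part of a linear map. -/
def evenPart (φ : R →ₗ[ℂ] K) : R →ₗ[ℂ] K :=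
  ((part 0).projection (part 1) isCompl_part).restrictScalars ℂ ∘ₗ φ ∘ₗ
      ((part 0).projection (part 1) isCompl_part).restrictScalars ℂ +
    ((part 1).projection (part 0) isCompl_part.symm).restrictScalars ℂ ∘ₗ φ ∘ₗ
      ((part 1).projection (part 0) isCompl_part.symm).restrictScalars ℂ

theorem evenPart_apply (φ : R →ₗ[ℂ] K) (z : R) : evenPart φ z =
    (part 0).projection (part 1) isCompl_part
        (φ ((part 0).projection (part 1) isCompl_part z)) +
      (part 1).projection (part 0) isCompl_part.symm
        (φ ((part 1).projection (part 0) isCompl_part.symm z)) := rfl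

theorem evenPart_X_smul {φ : R →ₗ[ℂ] K} (hφ : ∀ z, φ ((X : ℂ[X]) • z) = 0) (z : R) :
    evenPart φ ((X : ℂ[X]) • z) = 0 := by
  rw [evenPart_apply, map_smul ((part 0).projection (part 1) isCompl_part),
    map_smul ((part 1).projection (part 0) isCompl_part.symm), hφ, hφ, map_zero, map_zero, add_zero]

theorem evenPart_of_mem_zero (φ : R →ₗ[ℂ] K) {z : R} (hz : z ∈ part 0) :
    evenPart φ z = (part 0).projection (part 1) isCompl_part (φ z) := by
  rw [evenPart_apply, Submodule.projection_apply_of_mem_left _ hz,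
    Submodule.projection_apply_of_mem_right _ hz, map_zero, map_zero, add_zero]

theorem evenPart_of_mem_one (φ : R →ₗ[ℂ] K) {z : R} (hz : z ∈ part 1) :
    evenPart φ z = (part 1).projection (part 0) isCompl_part.symm (φ z) := by
  rw [evenPart_apply, Submodule.projection_apply_of_mem_left _ hz,
    Submodule.projection_apply_of_mem_right _ hz, map_zero, map_zero, zero_add]

theorem evenPart_mem (φ : R →ₗ[ℂ] K) {i : ZMod 2} {z : R} (hz : z ∈ part i) :
    evenPart φ z ∈ part i := by
  have hi : i = 0 ∨ i = 1 := by clear hz; revert i; decide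
  rcases hi with rfl | rfl
  · rw [evenPart_of_mem_zero φ hz]
    exact Submodule.projection_apply_mem _ _
  · rw [evenPart_of_mem_one φ hz]
    exact Submodule.projection_apply_mem _ _

/-- A primitive φ of the cocycle may mix parities. On brackets of homogeneous elements its values
have the correct parity anyway, so passing to the even part does not change its coboundary. -/
theorem evenPart_eq (φ : R →ₗ[ℂ] K) {i : ZMod 2} {z : R} (hz : z ∈ part i) (hφ : φ z ∈ part i) :
    evenPart φ z = φ z := by
  have hi : i = 0 ∨ i = 1 := by clear hz hφ; revert i; decide
  rcases hi with rfl | rfl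
  · rw [evenPart_of_mem_zero φ hz, Submodule.projection_apply_of_mem_left _ hφ]
  · rw [evenPart_of_mem_one φ hz, Submodule.projection_apply_of_mem_left _ hφ]

end EvenPart

/-- If all cocycles with values in trivial modules are coboundaries, then all central extensions
are trivial. -/
theorem hasOnlyTrivialCentralExtensions_of_cocycles.{uR, uK, uS} {R : Type uR} [AddCommGroup R]
    [Module ℂ R] [Module ℂ[X] R] [IsScalarTower ℂ ℂ[X] R] [LieConformalSuperalgebra R]
    (H : ∀ (K : Type uK) [AddCommGroup K] [Module ℂ K] (α : ℂ → R →ₗ[ℂ] R →ₗ[ℂ] K),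
      IsCocycle α → ∃ φ : R →ₗ[ℂ] K, (∀ z, φ ((X : ℂ[X]) • z) = 0) ∧
        ∀ l x y, α l x y = φ (brL (C l) x y)) :
    HasOnlyTrivialCentralExtensions.{uR, uK, uS} R := by
  intro K S _ _ _ _ _ _ _ _ _ _ ι π h
  obtain ⟨s, hp, hs⟩ := h.split
  obtain ⟨ρ, hρ⟩ := h.exists_retraction s hs
  obtain ⟨φ, hφX, hφ⟩ := H K _ (h.isCocycle hs hρ hp)
  have hφ' : ∀ l a b, φ (brL (C l) a b) = ρ (brL (C l) (s a) (s b)) := fun l a b => (hφ l a b).symm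
  have hs' : ∀ a, π (s a) = a := fun a => LinearMap.congr_fun hs a
  have hπι : ∀ k, π (ι k) = 0 := fun k => (h.exact _).mpr ⟨k, rfl⟩
  have hkey : ∀ l a b, evenPart φ (brL (C l) a b) = ρ (brL (C l) (s a) (s b)) := by
    have hom : ∀ {i j : ZMod 2} {a b : R}, a ∈ part i → b ∈ part j → ∀ l,
        evenPart φ (brL (C l) a b) = ρ (brL (C l) (s a) (s b)) := by
      intro i j a b ha hb l
      have hb1 := brL_mem l ha hb
      have hb2 := brL_mem l (hp i a ha) (hp j b hb)
      rw [← hφ']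
      refine evenPart_eq φ hb1 (hφ' l a b ▸ h.part_of_ι ?_)
      rw [hρ, h.map_brL_π, hs', hs']
      exact sub_mem hb2 (hp _ _ hb1)
    intro l a b
    obtain ⟨a₀, ha₀, a₁, ha₁, rfl⟩ := exists_homogeneous a
    obtain ⟨b₀, hb₀, b₁, hb₁, rfl⟩ := exists_homogeneous b
    simp only [map_add, LinearMap.add_apply, hom ha₀ hb₀, hom ha₀ hb₁, hom ha₁ hb₀, hom ha₁ hb₁]
  let ψ : R →ₗ[ℂ[X]] K := polyLinear (evenPart φ) fun z => by
    rw [evenPart_X_smul hφX, h.X_smul]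
  have hψ : ∀ z, (s + ι ∘ₗ ψ) z = s z + ι (evenPart φ z) := fun _ => rfl
  -- The defect of s on a bracket is the cocycle, which is φ of the bracket; the central correction
  -- ιψ cancels it and does not affect brackets of lifts.
  refine ⟨s + ι ∘ₗ ψ, ⟨fun i a ha => ?_, fun n a b => ?_⟩, LinearMap.ext fun a => ?_⟩
  · exact add_mem (hp i a ha) (h.hom_ι.map_part i _ (evenPart_mem φ ha))
  · refine map_nprod_of_map_brL ((s + ι ∘ₗ ψ).restrictScalars ℂ) (fun l => ?_) n
    rw [LinearMap.restrictScalars_apply, LinearMap.restrictScalars_apply,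
      LinearMap.restrictScalars_apply, hψ, hψ, hψ, hkey, h.brL_section hs hρ]
    simp only [map_add, LinearMap.add_apply, h.brL_ι_left, h.brL_ι_right, add_zero, sub_add_cancel]
  · rw [LinearMap.comp_apply, hψ, map_add, hs', hπι, add_zero, LinearMap.id_apply]

end

end LieConf

namespace LieConf

open Polynomial TensorProduct

noncomputable section

open LieConformalSuperalgebra

/-! ### Reduced cohomology -/

/-- In exponents, jk + j(i + k) = ij modulo 2. This is the sign left after the term with [a, c] and
b is put in the order of the Jacobi identity. -/
theorem superSign_mul_superSign (i j k : ZMod 2) :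
    superSign j k * superSign j (i + k) = superSign i j := by
  have e : ∀ i j k : ZMod 2, (j = 1 ∧ k = 1 ↔ j = 1 ∧ i + k = 1) ↔ ¬(i = 1 ∧ j = 1) := by decide
  have := e i j k
  unfold superSign
  split_ifs <;> simp_all

theorem eval_aeval_fin_two {σ : Type*} (v : σ → ℂ) (p q : MvPolynomial σ ℂ)
    (f : MvPolynomial (Fin 2) ℂ) : MvPolynomial.eval v (MvPolynomial.aeval ![p, q] f) =
      MvPolynomial.eval ![MvPolynomial.eval v p, MvPolynomial.eval v q] f := by
  rw [← MvPolynomial.coe_aeval_eq_eval, ← MvPolynomial.coe_aeval_eq_eval, RingHom.coe_coe,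
    RingHom.coe_coe, ← AlgHom.comp_apply, MvPolynomial.comp_aeval]
  congr 2
  ext i
  fin_cases i <;> rfl

theorem eval_aeval_fin_one {σ : Type*} (v : σ → ℂ) (p : MvPolynomial σ ℂ)
    (f : MvPolynomial (Fin 1) ℂ) : MvPolynomial.eval v (MvPolynomial.aeval ![p] f) =
      MvPolynomial.eval (fun _ => MvPolynomial.eval v p) f := by
  rw [← MvPolynomial.coe_aeval_eq_eval, ← MvPolynomial.coe_aeval_eq_eval, RingHom.coe_coe,
    RingHom.coe_coe, ← AlgHom.comp_apply, MvPolynomial.comp_aeval]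
  congr 2
  ext i
  fin_cases i; rfl

theorem eval_swap (l m : ℂ) (f : MvPolynomial (Fin 2) ℂ) :
    MvPolynomial.eval ![l, m] (MvPolynomial.rename (Equiv.swap 0 1) f) =
      MvPolynomial.eval ![m, l] f := by
  rw [MvPolynomial.eval_rename]
  congr 2
  ext i
  fin_cases i <;> rfl

/-- A polynomial which vanishes on the antidiagonal is divisible by `λ₁ + λ₂`. -/
theorem X_add_X_dvd {p : MvPolynomial (Fin 2) ℂ}
    (h : ∀ l : ℂ, MvPolynomial.eval ![l, -l] p = 0) :
    (MvPolynomial.X 0 + MvPolynomial.X 1 : MvPolynomial (Fin 2) ℂ) ∣ p := by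
  have key : ∀ p : MvPolynomial (Fin 2) ℂ,
      (MvPolynomial.X 0 + MvPolynomial.X 1 : MvPolynomial (Fin 2) ℂ) ∣
        p - MvPolynomial.aeval ![MvPolynomial.X 0, -MvPolynomial.X (0 : Fin 2)] p := by
    intro p
    induction p using MvPolynomial.induction_on with
    | C c => simp
    | add p q hp hq =>
      rw [map_add, add_sub_add_comm]
      exact dvd_add hp hq
    | mul_X p i hp =>
      rw [map_mul, MvPolynomial.aeval_X]
      set q : MvPolynomial (Fin 2) ℂ := MvPolynomial.aeval ![MvPolynomial.X 0, -MvPolynomial.X (0 : Fin 2)] p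
      obtain ⟨r, hr⟩ := hp
      have e : p = q + (MvPolynomial.X 0 + MvPolynomial.X 1) * r := by rw [← hr]; ring
      rw [e]
      fin_cases i
      · exact ⟨r * MvPolynomial.X 0, by simp; ring⟩
      -- With p = q + (λ₁ + λ₂) r, the new difference is pλ₂ + qλ₁ = (λ₁ + λ₂)(rλ₂ + q).
      · exact ⟨r * MvPolynomial.X 1 + q, by simp; ring⟩
  have h0 : MvPolynomial.aeval ![MvPolynomial.X 0, -MvPolynomial.X (0 : Fin 2)] p =
      (0 : MvPolynomial (Fin 2) ℂ) := by
    refine MvPolynomial.funext fun v => ?_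
    rw [map_zero, ← h (v 0), eval_aeval_fin_two, map_neg, MvPolynomial.eval_X]
  have := key p
  rwa [h0, sub_zero] at this

theorem X_add_X_ne_zero : (MvPolynomial.X 0 + MvPolynomial.X 1 : MvPolynomial (Fin 2) ℂ) ≠ 0 := by
  intro h
  have := congrArg (MvPolynomial.eval fun _ => (1 : ℂ)) h
  norm_num at this

/-- Linear division by `λ₁ + λ₂`. -/
theorem exists_linear_division : ∃ q : MvPolynomial (Fin 2) ℂ →ₗ[ℂ] MvPolynomial (Fin 2) ℂ,
    ∀ p, (∀ l : ℂ, MvPolynomial.eval ![l, -l] p = 0) →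
      (MvPolynomial.X 0 + MvPolynomial.X 1) * q p = p := by
  obtain ⟨q, hq⟩ := LinearMap.exists_leftInverse_of_injective
    (LinearMap.mulLeft ℂ (MvPolynomial.X 0 + MvPolynomial.X 1 : MvPolynomial (Fin 2) ℂ))
    (LinearMap.ker_eq_bot.mpr (mul_right_injective₀ X_add_X_ne_zero))
  refine ⟨q, fun p hp => ?_⟩
  obtain ⟨r, rfl⟩ := X_add_X_dvd hp
  exact congrArg _ (LinearMap.congr_fun hq r)

section

variable {R : Type*} [AddCommGroup R] [Module ℂ R] [Module ℂ[X] R] [IsScalarTower ℂ ℂ[X] R]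
  [LieConformalSuperalgebra R]

theorem eval_onBracket {σ : Type*} (v : σ → ℂ) (f : R →ₗ[ℂ] MvPolynomial σ ℂ)
    (p : MvPolynomial σ ℂ) (a b : R) : MvPolynomial.eval v (onBracket f p a b) =
      MvPolynomial.eval v (f (brL (C (MvPolynomial.eval v p)) a b)) := by
  obtain ⟨m, hm⟩ := locality a b
  rw [brL_eq_sum hm, onBracket, finsum_eq_sum_of_support_subset (s := Finset.range m), map_sum,
    map_sum, map_sum]
  · refine Finset.sum_congr rfl fun n _ => ?_
    rw [f.map_smul, f.map_smul, MvPolynomial.smul_eval, MvPolynomial.smul_eval,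
      MvPolynomial.smul_eval, map_mul, map_pow]
    ring
  · intro n hn
    simp only [Finset.coe_range, Set.mem_Iio]
    by_contra h
    exact hn (by simp [hm n (not_lt.mp h)])

/-- A functional on which `∂` acts as `-s`, on a value of the `λ`-bracket. -/
theorem map_brL_of_map_X {s : ℂ} {θ : R →ₗ[ℂ] ℂ} (hθ : ∀ z, θ ((X : ℂ[X]) • z) = -(s * θ z))
    (t : ℂ[X]) (a b : R) : θ (brL t a b) = θ (brL (C (eval (-s) t)) a b) := by
  have hp : ∀ (p : ℂ[X]) z, θ (p • z) = eval (-s) p * θ z := by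
    intro p z
    induction p using Polynomial.induction_on with
    | C c => rw [C_smul, map_smul, eval_C, smul_eq_mul]
    | add p q hp hq => rw [add_smul, map_add, hp, hq, eval_add, add_mul]
    | monomial n c h =>
      rw [show (C c * X ^ (n + 1) : ℂ[X]) = X * (C c * X ^ n) by ring, mul_smul, hθ, h,
        eval_mul (p := X), eval_X]
      ring
  obtain ⟨m, hm⟩ := locality a b
  have hs : ∀ t : ℂ[X], brL t a b =
      ∑ n ∈ Finset.range m, ((n.factorial : ℂ)⁻¹) • (t ^ n • nprod n a b) := by
    intro t
    refine finsum_eq_sum_of_support_subset _ fun n hn => ?_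
    simp only [Finset.coe_range, Set.mem_Iio]
    by_contra h
    exact hn (by simp [hm n (not_lt.mp h)])
  rw [hs, hs, map_sum, map_sum]
  refine Finset.sum_congr rfl fun n _ => ?_
  rw [θ.map_smul, θ.map_smul, hp, hp, eval_pow, ← C_pow, eval_C]

/-! #### The differential of a `1`-cochain -/

theorem eval_dOne (φ : R →ₗ[ℂ] MvPolynomial (Fin 1) ℂ) (a b : R) (v : Fin 2 → ℂ) :
    MvPolynomial.eval v (dOne φ a b) =
      -MvPolynomial.eval (fun _ => v 0 + v 1) (φ (brL (C (v 0)) a b)) := by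
  rw [dOne, map_neg, eval_onBracket, LinearMap.comp_apply, AlgHom.toLinearMap_apply,
    eval_aeval_fin_one]
  simp

/-- The differential of a `1`-cochain as a bilinear map. -/
def dOneL (φ : R →ₗ[ℂ] MvPolynomial (Fin 1) ℂ) : R →ₗ[ℂ] R →ₗ[ℂ] MvPolynomial (Fin 2) ℂ :=
  LinearMap.mk₂ ℂ (dOne φ)
    (fun a a' b => MvPolynomial.funext fun v => by
      rw [map_add (MvPolynomial.eval v)]
      simp only [eval_dOne, map_add, LinearMap.add_apply, neg_add])
    (fun c a b => MvPolynomial.funext fun v => by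
      rw [MvPolynomial.smul_eval]
      simp only [eval_dOne, map_smul, LinearMap.smul_apply, MvPolynomial.smul_eval, mul_neg])
    (fun a b b' => MvPolynomial.funext fun v => by
      rw [map_add (MvPolynomial.eval v)]
      simp only [eval_dOne, map_add, neg_add])
    (fun c a b => MvPolynomial.funext fun v => by
      rw [MvPolynomial.smul_eval]
      simp only [eval_dOne, map_smul, MvPolynomial.smul_eval, mul_neg])

theorem dOneL_mem {φ : R →ₗ[ℂ] MvPolynomial (Fin 1) ℂ} (hφ : φ ∈ Cochain₁ R) :
    dOneL φ ∈ Cochain₂ R := by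
  have hX : ∀ (s : ℂ) z, MvPolynomial.eval (fun _ => s) (φ ((X : ℂ[X]) • z)) =
      -(s * MvPolynomial.eval (fun _ => s) (φ z)) := fun s z => by
    rw [show φ ((X : ℂ[X]) • z) = -(MvPolynomial.X 0 * φ z) from hφ z]; simp
  refine ⟨fun a b => MvPolynomial.funext fun v => ?_, fun a b => MvPolynomial.funext fun v => ?_,
    fun i j a b ha hb => MvPolynomial.funext fun v => ?_⟩
  · change MvPolynomial.eval v (dOne φ _ b) = MvPolynomial.eval v (-(_ * dOne φ a b))
    rw [map_neg, map_mul, eval_dOne, eval_dOne, MvPolynomial.eval_X, brL_X_left, map_neg, map_smul,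
      map_neg, MvPolynomial.smul_eval]
    ring
  · change MvPolynomial.eval v (dOne φ a _) = MvPolynomial.eval v (-(_ * dOne φ a b))
    rw [map_neg, map_mul, eval_dOne, eval_dOne, MvPolynomial.eval_X, brL_X_right, map_add, map_add,
      φ.map_smul, MvPolynomial.smul_eval, hX]
    ring
  · change MvPolynomial.eval v (dOne φ b a) =
      MvPolynomial.eval v (-(superSign i j • MvPolynomial.rename _ (dOne φ a b)))
    have e : brL (C (v 0)) b a = -(superSign i j • brL (-C (v 0) - X) a b) := skew (v 0) ha hb
    let θ : R →ₗ[ℂ] ℂ := (MvPolynomial.aeval fun _ => v 0 + v 1).toLinearMap ∘ₗ φ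
    have hθ : ∀ z, θ z = MvPolynomial.eval (fun _ => v 0 + v 1) (φ z) := fun z => by
      rw [← MvPolynomial.coe_aeval_eq_eval]; rfl
    -- After φ is evaluated at λ₁ + λ₂, the operator ∂ is multiplication by -(λ₁ + λ₂), so the
    -- argument -λ₁ - ∂ from skew-symmetry becomes λ₂.
    have e2 := map_brL_of_map_X (θ := θ) (s := v 0 + v 1) (fun z => by rw [hθ, hθ, hX])
      (-C (v 0) - X) a b
    have e3 : eval (-(v 0 + v 1)) (-C (v 0) - X) = v 1 := by simp
    rw [e3, hθ, hθ] at e2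
    rw [map_neg, MvPolynomial.smul_eval, MvPolynomial.eval_rename, eval_dOne, eval_dOne, e, map_neg,
      map_smul, map_neg, MvPolynomial.smul_eval, e2]
    simp [add_comm]

/-! #### The cocycle of a reduced `2`-cocycle -/

/-- The values of a `2`-cochain on the antidiagonal. -/
def antidiagonal (γ : R →ₗ[ℂ] R →ₗ[ℂ] MvPolynomial (Fin 2) ℂ) (l : ℂ) : R →ₗ[ℂ] R →ₗ[ℂ] ℂ :=
  γ.compr₂ (MvPolynomial.aeval ![l, -l]).toLinearMap

omit [Module ℂ[X] R] [IsScalarTower ℂ ℂ[X] R] [LieConformalSuperalgebra R] in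
theorem antidiagonal_apply (γ : R →ₗ[ℂ] R →ₗ[ℂ] MvPolynomial (Fin 2) ℂ) (l : ℂ) (a b : R) :
    antidiagonal γ l a b = MvPolynomial.eval ![l, -l] (γ a b) := by
  rw [← MvPolynomial.coe_aeval_eq_eval]; rfl

/-- A multiple of λ₁ + λ₂ + λ₃ vanishes at (l, m, -l - m), so dγ = 0 there. Each of its three terms
is then evaluated on the antidiagonal, and skew-symmetry brings them into the form of the Jacobi
condition. -/
theorem isCocycle_antidiagonal {γ : R →ₗ[ℂ] R →ₗ[ℂ] MvPolynomial (Fin 2) ℂ}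
    (hγ : γ ∈ ReducedZ₂ R) : IsCocycle (antidiagonal γ) := by
  obtain ⟨⟨h1, h2, h3⟩, β, -, hβ⟩ := hγ
  have hsk : ∀ {i j : ZMod 2} {a b : R}, a ∈ part i → b ∈ part j → ∀ l : ℂ,
      MvPolynomial.eval ![-l, l] (γ b a) = -(superSign i j * antidiagonal γ l a b) := by
    intro i j a b ha hb l
    rw [h3 i j a b ha hb, map_neg, MvPolynomial.smul_eval, eval_swap, antidiagonal_apply]
  refine ⟨fun l a b => ?_, fun l a b => ?_, fun l m i j a b c ha hb => ?_⟩
  · rw [antidiagonal_apply, antidiagonal_apply, h1]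
    simp
  · rw [antidiagonal_apply, antidiagonal_apply, h2]
    simp
  · have hom : ∀ {k : ZMod 2} {c : R}, c ∈ part k → antidiagonal γ l a (brL (C m) b c) =
        antidiagonal γ (l + m) (brL (C l) a b) c +
          superSign i j • antidiagonal γ m b (brL (C l) a c) := by
      intro k c hc
      have e := congrArg (MvPolynomial.eval ![l, m, -l - m]) (hβ i j k a b c ha hb hc)
      have e0 : MvPolynomial.eval ![l, m, -l - m]
          (MvPolynomial.X 0 + MvPolynomial.X 1 + MvPolynomial.X 2) = 0 := by
        simp
      rw [map_mul, e0, zero_mul, dTwo, map_sub, map_add, map_neg, MvPolynomial.smul_eval,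
        MvPolynomial.smul_eval, eval_onBracket, eval_onBracket, eval_onBracket] at e
      simp only [LinearMap.comp_apply, AlgHom.toLinearMap_apply, LinearMap.flip_apply,
        eval_aeval_fin_two, map_add, MvPolynomial.eval_X] at e
      have x0 : (![l, m, -l - m] : Fin 3 → ℂ) 0 = l := rfl
      have x1 : (![l, m, -l - m] : Fin 3 → ℂ) 1 = m := rfl
      have x2 : (![l, m, -l - m] : Fin 3 → ℂ) 2 = -l - m := rfl
      rw [x0, x1, x2, show l + (-l - m) = -m by ring, show m + (-l - m) = -l by ring,
        show -l - m = -(l + m) by ring, ← antidiagonal_apply,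
        hsk hb (brL_mem l ha hc) m, hsk ha (brL_mem m hb hc) l] at e
      rw [smul_eq_mul]
      linear_combination e + antidiagonal γ m b (brL (C l) a c) * superSign_mul_superSign i j k -
        antidiagonal γ l a (brL (C m) b c) * superSign_mul_self i (j + k)
    obtain ⟨c₀, hc₀, c₁, hc₁, rfl⟩ := exists_homogeneous c
    simp only [map_add, hom hc₀, hom hc₁, smul_add]
    ring

theorem subsingleton_subquotient {V : Type*} [AddCommGroup V] [Module ℂ V] {Z B : Submodule ℂ V}
    (h : Z ≤ B) : Subsingleton (Subquotient Z B) :=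
  Submodule.Quotient.subsingleton_iff.mpr (Submodule.submoduleOf_eq_top.mpr h)

/-- The second reduced cohomology vanishes if all cocycles are coboundaries and functionals on
`R / ∂R` lift to `1`-cochains. -/
theorem subsingleton_reducedH₂_of_cocycles
    (H : ∀ α : ℂ → R →ₗ[ℂ] R →ₗ[ℂ] ℂ, IsCocycle α → ∃ φ : R →ₗ[ℂ] ℂ,
      (∀ z, φ ((X : ℂ[X]) • z) = 0) ∧ ∀ l x y, α l x y = φ (brL (C l) x y))
    (L : ∀ φ : R →ₗ[ℂ] ℂ, (∀ z, φ ((X : ℂ[X]) • z) = 0) →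
      ∃ ψ ∈ Cochain₁ R, ∀ z, MvPolynomial.eval (fun _ => 0) (ψ z) = φ z) :
    Subsingleton (ReducedH₂ R) := by
  refine subsingleton_subquotient fun γ hγ => ?_
  obtain ⟨φ, hφX, hφ⟩ := H _ (isCocycle_antidiagonal hγ)
  obtain ⟨ψ, hψ, hψφ⟩ := L φ hφX
  obtain ⟨q, hq⟩ := exists_linear_division
  -- The differential of a 1-cochain carries a minus sign, so γ + dψ is what vanishes on the
  -- antidiagonal, and γ = d(-ψ) + (λ₁ + λ₂)η.
  have hneg : ∀ a b, dOne ((-1 : ℂ) • ψ) a b = -dOne ψ a b := fun a b => by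
    rw [dOne_smul, neg_one_smul]
  obtain ⟨d1, d2, d3⟩ := add_mem hγ.1 (dOneL_mem hψ)
  have hη : ∀ a b, (MvPolynomial.X 0 + MvPolynomial.X 1) * q ((γ + dOneL ψ) a b) =
      (γ + dOneL ψ) a b := by
    intro a b
    refine hq _ fun l => ?_
    change MvPolynomial.eval _ (γ a b + dOne ψ a b) = 0
    rw [map_add, ← antidiagonal_apply, hφ, eval_dOne]
    have e : (![l, -l] : Fin 2 → ℂ) 0 + (![l, -l] : Fin 2 → ℂ) 1 = 0 := by simp
    rw [e, hψφ]
    exact add_neg_cancel _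
  -- The quotient inherits the cochain identities by cancelling the factor λ₁ + λ₂, which is
  -- symmetric and nonzero.
  refine ⟨(-1 : ℂ) • ψ, Submodule.smul_mem _ _ hψ, (γ + dOneL ψ).compr₂ q, ⟨fun a b => ?_, fun a b => ?_,
    fun i j a b ha hb => ?_⟩, fun a b => ?_⟩
  · apply mul_left_cancel₀ X_add_X_ne_zero
    rw [LinearMap.compr₂_apply, LinearMap.compr₂_apply, hη, d1, mul_neg, mul_left_comm, hη]
  · apply mul_left_cancel₀ X_add_X_ne_zero
    rw [LinearMap.compr₂_apply, LinearMap.compr₂_apply, hη, d2, mul_neg, mul_left_comm, hη]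
  · apply mul_left_cancel₀ X_add_X_ne_zero
    have e : MvPolynomial.rename (Equiv.swap 0 1) (MvPolynomial.X 0 + MvPolynomial.X 1) =
        (MvPolynomial.X 0 + MvPolynomial.X 1 : MvPolynomial (Fin 2) ℂ) := by
      rw [map_add, MvPolynomial.rename_X, MvPolynomial.rename_X, Equiv.swap_apply_left,
        Equiv.swap_apply_right, add_comm]
    rw [LinearMap.compr₂_apply, LinearMap.compr₂_apply, hη, d3 i j a b ha hb, mul_neg,
      mul_smul_comm]
    nth_rw 1 [← hη]
    rw [map_mul, e]
  · change _ = dOne _ a b + _ * q ((γ + dOneL ψ) a b)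
    rw [hη, hneg]
    change γ a b = -dOne ψ a b + (γ a b + dOne ψ a b)
    ring

end

end

end LieConf

/-! ### Lifting functionals to 1-cochains, and the two families of algebras -/

namespace LieConf

open Polynomial TensorProduct

noncomputable section

variable {N : ℕ}

open LieConformalSuperalgebra

theorem exists_X_smul_add_evD {V : Type*} [AddCommGroup V] [Module ℂ V] (w : ℂ[X] ⊗[ℂ] V) :
    ∃ w' : ℂ[X] ⊗[ℂ] V, w = (X : ℂ[X]) • w' + 1 ⊗ₜ evD 0 w := by
  have hX : ∀ z : ℂ[X] ⊗[ℂ] V, evD 0 ((X : ℂ[X]) • z) = 0 := by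
    intro z
    induction z using TensorProduct.induction_on with
    | zero => rw [smul_zero, map_zero]
    | tmul p v =>
      rw [smul_tmul', evD_tmul, smul_eq_mul, eval_mul, eval_X, neg_zero, zero_mul, zero_smul]
    | add z w hz hw => rw [smul_add, map_add, hz, hw, add_zero]
  induction w using dInduction with
  | gen v => exact ⟨0, by rw [evD_tmul, eval_one, one_smul, smul_zero, zero_add]⟩
  | add x y hx hy =>
    obtain ⟨x', hx⟩ := hx
    obtain ⟨y', hy⟩ := hy
    refine ⟨x' + y', ?_⟩
    nth_rw 1 [hx, hy]
    rw [smul_add, map_add, tmul_add]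
    abel
  | hX x _ => exact ⟨x, by rw [hX, tmul_zero, add_zero]⟩

theorem divTw_zero_eq (a : ℂ) (x : W N) : divTw 0 a x = divA N a x := by
  induction x using dInduction with
  | gen v =>
    rw [divTw, LinearMap.add_apply, LinearMap.baseChange_tmul]
    simp [der]
  | add x y hx hy => rw [map_add, map_add, hx, hy]
  | hX x hx => rw [map_smul, map_smul, hx]

namespace IsDivFree

section

variable {R : Type*} [AddCommGroup R] [Module ℂ R] [Module ℂ[X] R] [IsScalarTower ℂ ℂ[X] R]
  [LieConformalSuperalgebra R]
  {e : R →ₗ[ℂ[X]] W N} {u : Gr N} {a : ℂ} (h : IsDivFree e u a)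

include h

/-- Linear functionals on `R / ∂R` lift to `1`-cochains. -/
theorem exists_cochain_lift (φ : R →ₗ[ℂ] ℂ) (hφ : ∀ z, φ ((X : ℂ[X]) • z) = 0) :
    ∃ ψ ∈ Cochain₁ R, ∀ z, MvPolynomial.eval (fun _ => 0) (ψ z) = φ z := by
  obtain ⟨Φ, hΦ⟩ : ∃ Φ : Gen N →ₗ[ℂ] ℂ, ∀ z, Φ (evD 0 (e z)) = φ z := by
    have hker : φ ∈ (LinearMap.ker (evD 0 ∘ₗ e.restrictScalars ℂ)).dualAnnihilator := by
      rw [Submodule.mem_dualAnnihilator]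
      intro z hz
      obtain ⟨w, hw⟩ := exists_X_smul_add_evD (e z)
      have hz0 : evD 0 (e z) = 0 := hz
      rw [hz0, tmul_zero, add_zero] at hw
      have hd := (h.mem_range (e z)).mp ⟨z, rfl⟩
      rw [hw, map_smul] at hd
      -- If ∂w is divergence-free then so is w, since the divergence takes values in a torsion-free
      -- module. Hence ∂W_N ∩ R = ∂R, and φ factors through the value at ∂ = 0.
      obtain ⟨z', rfl⟩ := (h.mem_range w).mpr ((smul_eq_zero.mp hd).resolve_left X_ne_zero)
      rw [h.injective (hw.trans (map_smul e _ z').symm), hφ]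
    rw [← LinearMap.range_dualMap_eq_dualAnnihilator_ker] at hker
    obtain ⟨Φ, rfl⟩ := hker
    exact ⟨Φ, fun z => rfl⟩
  -- The cochain sends p(∂)v to p(-λ)Φ(v). It is defined on the free module W_N, where such an
  -- extension is immediate, and then restricted to R.
  let Ψ : W N →ₗ[ℂ] MvPolynomial (Fin 1) ℂ := TensorProduct.lift
    ((LinearMap.mul ℂ (MvPolynomial (Fin 1) ℂ)).compl₁₂
      (aeval (-MvPolynomial.X 0 : MvPolynomial (Fin 1) ℂ)).toLinearMap
      (Algebra.linearMap ℂ (MvPolynomial (Fin 1) ℂ) ∘ₗ Φ))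
  have hΨ : ∀ (p : ℂ[X]) v, Ψ (p ⊗ₜ v) = aeval (-MvPolynomial.X 0 : MvPolynomial (Fin 1) ℂ) p *
      algebraMap ℂ _ (Φ v) := fun _ _ => rfl
  have hX : ∀ w, Ψ ((X : ℂ[X]) • w) = -(MvPolynomial.X 0 * Ψ w) := by
    intro w
    induction w using TensorProduct.induction_on with
    | zero => simp
    | tmul p v =>
      rw [smul_tmul', hΨ, hΨ, smul_eq_mul, map_mul, aeval_X]
      ring
    | add x y hx hy => rw [smul_add, map_add, hx, hy, map_add]; ring
  have h0 : ∀ w, MvPolynomial.eval (fun _ => 0) (Ψ w) = Φ (evD 0 w) := by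
    intro w
    obtain ⟨w', hw⟩ := exists_X_smul_add_evD w
    nth_rw 1 [hw]
    rw [map_add, hX, hΨ]
    simp
  refine ⟨Ψ ∘ₗ e.restrictScalars ℂ, fun z => ?_, fun z => ?_⟩
  · change Ψ (e ((X : ℂ[X]) • z)) = -(_ * Ψ (e z))
    rw [map_smul, hX]
  · exact (h0 (e z)).trans (hΦ z)

theorem hasOnlyTrivialCentralExtensions : HasOnlyTrivialCentralExtensions R :=
  hasOnlyTrivialCentralExtensions_of_cocycles fun _ _ _ _ hα => h.exists_eq_coboundary hα

theorem subsingleton_reducedH₂ : Subsingleton (ReducedH₂ R) :=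
  subsingleton_reducedH₂_of_cocycles (fun _ hα => h.exists_eq_coboundary hα)
    h.exists_cochain_lift

end

theorem of_subalgebra (S : ConformalSubalgebra (W N)) {u : Gr N} {a : ℂ} (hu : IsEvenTop u)
    (hN : 2 < N) (hS : ∀ x, x ∈ S.carrier ↔ divTw u a x = 0) :
    IsDivFree (R := ↥S.carrier) S.carrier.subtype u a where
  top := hu
  two_lt := hN
  injective := Subtype.val_injective
  map_brL t x y := S.coe_lamEval t x y
  mem_part _ _ hx := hx
  mem_range x := ⟨fun ⟨y, hy⟩ => hy ▸ (hS _).mp y.2, fun hx => ⟨⟨x, (hS x).mpr hx⟩, rfl⟩⟩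

end IsDivFree

theorem isDivFree_SAlg (hN : 2 < N) (a : ℂ) : IsDivFree (R := ↥(SAlg N a).carrier) (SAlg N a).carrier.subtype 0 a :=
  IsDivFree.of_subalgebra _ ⟨IsWt.zero _, map_zero _⟩ hN fun x => by
    rw [divTw_zero_eq]; exact LinearMap.mem_ker

theorem isDivFree_STildeAlg (hN : 2 < N) (hE : Even N) :
    IsDivFree (R := ↥(STildeAlg N hE).carrier) (STildeAlg N hE).carrier.subtype (xiTop N) 0 :=
  IsDivFree.of_subalgebra _
    ⟨⟨fun i _ => xi_mul_xiTop i, fun i hi => absurd (Finset.mem_univ i) hi⟩, inv_xiTop hE⟩ hN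
    fun x => mem_ker_div_mulTop hE x

end

end LieConf

theorem mainTheorem9 (N : ℕ) (hN : 2 < N) :
    (∀ a : ℂ,
      LieConf.HasOnlyTrivialCentralExtensions.{0, v, w} (LieConf.SAlg N a).carrier ∧
      Subsingleton (LieConf.ReducedH₂ (LieConf.SAlg N a).carrier)) ∧
    (∀ hE : Even N,
      LieConf.HasOnlyTrivialCentralExtensions.{0, v, w} (LieConf.STildeAlg N hE).carrier ∧
      Subsingleton (LieConf.ReducedH₂ (LieConf.STildeAlg N hE).carrier)) :=
  ⟨fun a => ⟨(LieConf.isDivFree_SAlg hN a).hasOnlyTrivialCentralExtensions,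
      (LieConf.isDivFree_SAlg hN a).subsingleton_reducedH₂⟩,
    fun hE => ⟨(LieConf.isDivFree_STildeAlg hN hE).hasOnlyTrivialCentralExtensions,
      (LieConf.isDivFree_STildeAlg hN hE).subsingleton_reducedH₂⟩⟩
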